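/- Let $(M^n,g)$ be a compact smooth Riemannian manifold (without boundary), let $\tau>0$, and let $f\in C^\infty(M)$ satisfy the gradient shrinking Ricci soliton equation $$R_{ij}+\nabla_i\nabla_j f=\frac1{2\tau}\,g_{ij}.$$ For a one-form $\omega$ and a smooth symmetric 2-tensor $h$ put $\operatorname{div}_f\omega=\nabla_i\omega_i-\omega_i\nabla_i f$, $(\operatorname{div}_f h)_i=\nabla_jh_{ij}-h_{ij}\nabla_jf$, $(\operatorname{div}_f^\dagger\omega)_{ij}=-\tfrac12(\nabla_i\omega_j+\nabla_j\omega_i)$, $\Delta_f=\Delta-\nabla f\cdot\nabla$, and $Rm(h,\cdot)_{ik}=R_{ijkl}h_{jl}$, with the sign convention $R_{ik}=g^{jl}R_{ijkl}$ (repeated indices are contracted with $g$). The stability operator is $$\hat N h=\tfrac12\Delta_f h+Rm(h,\cdot)+\operatorname{div}_f^\dagger\operatorname{div}_f h+\tfrac12\nabla^2\hat v_h-Rc\;\frac{\int_M\langle Rc,h\rangle e^{-f}dV}{\int_M R\,e^{-f}dV},$$ where $\hat v_h$ is the smooth solution of $$\Delta_f\hat v_h+\frac{\hat v_h}{2\tau}=\operatorname{div}_f\operatorname{div}_f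 h,\qquad \int_M\hat v_h\,e^{-f}dV=0.$$ Then for $h=Rc$ this problem has exactly one smooth solution $\hat v_{Rc}$, and the Ricci tensor is a null direction of the stability operator: $$\hat N(Rc)=0.$$ -/

import Mathlib

open scoped Manifold ContDiff
open MeasureTheory

noncomputable section

namespace Shrinker

/-! ### Tensor calculus on an open subset of Euclidean space

`G : E n → Matrix` is the matrix of metric components `g_ij` in a coordinate system; tensor fields
are given by their components. Everything below is the classical index formula. -/

/-- The Euclidean space in which coordinates live. -/
abbrev E (n : ℕ) := EuclideanSpace ℝ (Fin n)

section Coordinates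

variable {n : ℕ}

/-- The coordinate partial derivative `∂_i F`. -/
def pd (i : Fin n) (F : E n → ℝ) (y : E n) : ℝ :=
  fderiv ℝ F y (EuclideanSpace.single i 1)

/-- The Christoffel symbol `Γ^k_ij = ½ g^{kl} (∂_i g_jl + ∂_j g_il - ∂_l g_ij)`. -/
def christoffel (G : E n → Matrix (Fin n) (Fin n) ℝ) (k i j : Fin n) (y : E n) : ℝ :=
  (1 / 2) * ∑ l, (G y)⁻¹ k l *
    (pd i (fun z => G z j l) y + pd j (fun z => G z i l) y - pd l (fun z => G z i j) y)

/-- The covariant derivative of a one-form: `∇_k θ_i`. -/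
def cov1 (G : E n → Matrix (Fin n) (Fin n) ℝ) (θ : Fin n → E n → ℝ)
    (k i : Fin n) (y : E n) : ℝ :=
  pd k (θ i) y - ∑ m, christoffel G m k i y * θ m y

/-- The covariant derivative of a 2-tensor: `∇_k h_ij`. -/
def cov2 (G : E n → Matrix (Fin n) (Fin n) ℝ) (h : Fin n → Fin n → E n → ℝ)
    (k i j : Fin n) (y : E n) : ℝ :=
  pd k (h i j) y - (∑ m, christoffel G m k i y * h m j y)
    - ∑ m, christoffel G m k j y * h i m y

/-- The covariant derivative of a 3-tensor: `∇_k T_aij`. -/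
def cov3 (G : E n → Matrix (Fin n) (Fin n) ℝ) (T : Fin n → Fin n → Fin n → E n → ℝ)
    (k a i j : Fin n) (y : E n) : ℝ :=
  pd k (T a i j) y - (∑ m, christoffel G m k a y * T m i j y)
    - (∑ m, christoffel G m k i y * T a m j y)
    - ∑ m, christoffel G m k j y * T a i m y

/-- `∂_m`-component of `R(∂_i, ∂_j) ∂_l = ∇_i ∇_j ∂_l - ∇_j ∇_i ∂_l`. -/
def curvUp (G : E n → Matrix (Fin n) (Fin n) ℝ) (i j l m : Fin n) (y : E n) : ℝ :=
  pd i (christoffel G m j l) y - pd j (christoffel G m i l) y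
    + ∑ p, (christoffel G m i p y * christoffel G p j l y
      - christoffel G m j p y * christoffel G p i l y)

/-- The Riemann tensor `R_ijkl = g(R(∂_i, ∂_j) ∂_l, ∂_k)`; in this convention the unit sphere has
`R_ijkl = g_ik g_jl - g_il g_jk`, and `R_ik = g^{jl} R_ijkl`. -/
def riem (G : E n → Matrix (Fin n) (Fin n) ℝ) (i j k l : Fin n) (y : E n) : ℝ :=
  ∑ m, G y k m * curvUp G i j l m y

/-- `Rm(h, ·)_ik = R_ijkl h_jl`, the indices `j` and `l` being contracted with the metric. -/
def rmC (G : E n → Matrix (Fin n) (Fin n) ℝ) (h : Fin n → Fin n → E n → ℝ)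
    (i k : Fin n) (y : E n) : ℝ :=
  ∑ j, ∑ l, ∑ a, ∑ b, (G y)⁻¹ j a * (G y)⁻¹ l b * riem G i j k l y * h a b y

/-- The Ricci tensor `R_ik = g^{jl} R_ijkl`. -/
def ricC (G : E n → Matrix (Fin n) (Fin n) ℝ) (i k : Fin n) (y : E n) : ℝ :=
  ∑ j, ∑ l, (G y)⁻¹ j l * riem G i j k l y

/-- The metric trace `g^{ij} h_ij`. -/
def trC (G : E n → Matrix (Fin n) (Fin n) ℝ) (h : Fin n → Fin n → E n → ℝ) (y : E n) : ℝ :=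
  ∑ i, ∑ j, (G y)⁻¹ i j * h i j y

/-- The inner product of 2-tensors `<h, k> = g^{ia} g^{jb} h_ij k_ab`. -/
def innerC (G : E n → Matrix (Fin n) (Fin n) ℝ) (h k : Fin n → Fin n → E n → ℝ) (y : E n) : ℝ :=
  ∑ i, ∑ j, ∑ a, ∑ b, (G y)⁻¹ i a * (G y)⁻¹ j b * h i j y * k a b y

/-- The Hessian `∇_i ∇_j v` of a function. -/
def hessC (G : E n → Matrix (Fin n) (Fin n) ℝ) (v : E n → ℝ) (i j : Fin n) (y : E n) : ℝ :=
  cov1 G (fun a => pd a v) i j y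

/-- `Δ_f v = Δ v - <∇ f, ∇ v>` on functions. -/
def lapF0C (G : E n → Matrix (Fin n) (Fin n) ℝ) (f v : E n → ℝ) (y : E n) : ℝ :=
  ∑ k, ∑ l, (G y)⁻¹ k l * (hessC G v k l y - pd k f y * pd l v y)

/-- `(Δ_f h)_ij = g^{kl} (∇_k ∇_l h_ij - ∇_k f ∇_l h_ij)` on 2-tensors. -/
def lapF2C (G : E n → Matrix (Fin n) (Fin n) ℝ) (f : E n → ℝ) (h : Fin n → Fin n → E n → ℝ)
    (i j : Fin n) (y : E n) : ℝ :=
  ∑ k, ∑ l, (G y)⁻¹ k l * (cov3 G (cov2 G h) k l i j y - pd k f y * cov2 G h l i j y)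

/-- `div_f θ = ∇_i θ_i - θ_i ∇_i f` on one-forms. -/
def divF1C (G : E n → Matrix (Fin n) (Fin n) ℝ) (f : E n → ℝ) (θ : Fin n → E n → ℝ)
    (y : E n) : ℝ :=
  ∑ i, ∑ j, (G y)⁻¹ i j * (cov1 G θ i j y - pd i f y * θ j y)

/-- `(div_f h)_i = ∇_j h_ij - h_ij ∇_j f` on 2-tensors. -/
def divF2C (G : E n → Matrix (Fin n) (Fin n) ℝ) (f : E n → ℝ) (h : Fin n → Fin n → E n → ℝ)
    (i : Fin n) (y : E n) : ℝ :=
  ∑ j, ∑ k, (G y)⁻¹ j k * (cov2 G h k i j y - h i j y * pd k f y)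

/-- `(div_f^† θ)_ij = -(∇_i θ_j + ∇_j θ_i) / 2`. -/
def divDagC (G : E n → Matrix (Fin n) (Fin n) ℝ) (θ : Fin n → E n → ℝ)
    (i j : Fin n) (y : E n) : ℝ :=
  -(cov1 G θ i j y + cov1 G θ j i y) / 2

end Coordinates

/-! ### Tensor fields on a manifold -/

section Manifold

variable {n : ℕ} {M : Type*} [TopologicalSpace M] [ChartedSpace (E n) M]

/-- One-forms on `M`. -/
abbrev OneForm (n : ℕ) (M : Type*) [TopologicalSpace M] [ChartedSpace (E n) M] :=
  ∀ x : M, TangentSpace (𝓡 n) x →L[ℝ] ℝ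

/-- Covariant 2-tensor fields on `M`. -/
abbrev Tensor2 (n : ℕ) (M : Type*) [TopologicalSpace M] [ChartedSpace (E n) M] :=
  ∀ x : M, TangentSpace (𝓡 n) x →L[ℝ] TangentSpace (𝓡 n) x →L[ℝ] ℝ

/-- Smooth Riemannian metrics on `M`. -/
abbrev Metric (n : ℕ) (M : Type*) [TopologicalSpace M] [ChartedSpace (E n) M]
    [IsManifold (𝓡 n) ∞ M] :=
  Bundle.ContMDiffRiemannianMetric (𝓡 n) ∞ (E n) (fun x : M => TangentSpace (𝓡 n) x)

/-- The coordinate vector field `∂_i` of the chart at `p`, at the point with coordinates `y`. -/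
def coordVec (p : M) (i : Fin n) (y : E n) : TangentSpace (𝓡 n) ((chartAt (E n) p).symm y) :=
  mfderiv (𝓡 n) (𝓡 n) (chartAt (E n) p).symm y
    (EuclideanSpace.single i (1 : ℝ) : E n)

/-- The coordinate covector `dx^i` of the chart at `x`, at the point `x`. -/
def coordCovec (x : M) (i : Fin n) : TangentSpace (𝓡 n) x →L[ℝ] ℝ :=
  (EuclideanSpace.proj i : E n →L[ℝ] ℝ).comp
    (mfderiv (𝓡 n) (𝓡 n) (chartAt (E n) x) x : TangentSpace (𝓡 n) x →L[ℝ] E n)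

/-- A function on `M` in the coordinates of the chart at `p`. -/
def comp0 (u : M → ℝ) (p : M) (y : E n) : ℝ := u ((chartAt (E n) p).symm y)

/-- The components of a one-form in the chart at `p`. -/
def comp1 (θ : OneForm n M) (p : M) (i : Fin n) (y : E n) : ℝ :=
  θ ((chartAt (E n) p).symm y) (coordVec p i y)

/-- The components of a 2-tensor in the chart at `p`. -/
def comp2 (h : Tensor2 n M) (p : M) (i j : Fin n) (y : E n) : ℝ :=
  h ((chartAt (E n) p).symm y) (coordVec p i y) (coordVec p j y)

/-- The coordinates of `x` in the chart at `x`. -/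
def coord (x : M) : E n := chartAt (E n) x x

/-- The covector at `x` with components `A_i` in the chart at `x`. -/
def ofComp1 (x : M) (A : Fin n → ℝ) : TangentSpace (𝓡 n) x →L[ℝ] ℝ :=
  ∑ i, A i • coordCovec x i

/-- The bilinear form at `x` with components `A_ij` in the chart at `x`, i.e. `A_ij dx^i ⊗ dx^j`. -/
def ofComp2 (x : M) (A : Fin n → Fin n → ℝ) :
    TangentSpace (𝓡 n) x →L[ℝ] TangentSpace (𝓡 n) x →L[ℝ] ℝ :=
  ∑ i, ∑ j, A i j • (coordCovec x i).smulRight (coordCovec x j)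

/-! ### Riemannian geometry of `(M, g)` and of the weight `e^{-f}`

Each value at `x` is computed in the chart at `x`; the formulas are covariant, so any other chart
around `x` gives the same. -/

variable [IsManifold (𝓡 n) ∞ M]

/-- The matrix `g_ij` of the metric in the chart at `p`. -/
def gram (g : Metric n M) (p : M) (y : E n) : Matrix (Fin n) (Fin n) ℝ :=
  Matrix.of fun i j => comp2 g.inner p i j y

/-- The Ricci tensor. -/
def ricci (g : Metric n M) : Tensor2 n M :=
  fun x => ofComp2 x fun i j => ricC (gram g x) i j (coord x)

/-- The scalar curvature. -/
def scal (g : Metric n M) (x : M) : ℝ :=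
  trC (gram g x) (comp2 (ricci g) x) (coord x)

/-- The pointwise inner product of 2-tensors. -/
def inner2 (g : Metric n M) (h k : Tensor2 n M) (x : M) : ℝ :=
  innerC (gram g x) (comp2 h x) (comp2 k x) (coord x)

/-- `Rm(h, ·)`. -/
def rm (g : Metric n M) (h : Tensor2 n M) : Tensor2 n M :=
  fun x => ofComp2 x fun i j => rmC (gram g x) (comp2 h x) i j (coord x)

/-- The Hessian of a function. -/
def hess (g : Metric n M) (v : M → ℝ) : Tensor2 n M :=
  fun x => ofComp2 x fun i j => hessC (gram g x) (comp0 v x) i j (coord x)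

/-- `Δ_f` on functions. -/
def lapF0 (g : Metric n M) (f v : M → ℝ) (x : M) : ℝ :=
  lapF0C (gram g x) (comp0 f x) (comp0 v x) (coord x)

/-- `Δ_f` on 2-tensors. -/
def lapF2 (g : Metric n M) (f : M → ℝ) (h : Tensor2 n M) : Tensor2 n M :=
  fun x => ofComp2 x fun i j => lapF2C (gram g x) (comp0 f x) (comp2 h x) i j (coord x)

/-- `div_f` on one-forms. -/
def divF1 (g : Metric n M) (f : M → ℝ) (θ : OneForm n M) (x : M) : ℝ :=
  divF1C (gram g x) (comp0 f x) (comp1 θ x) (coord x)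

/-- `div_f` on 2-tensors. -/
def divF2 (g : Metric n M) (f : M → ℝ) (h : Tensor2 n M) : OneForm n M :=
  fun x => ofComp1 x fun i => divF2C (gram g x) (comp0 f x) (comp2 h x) i (coord x)

/-- `div_f^†` on one-forms. -/
def divDag (g : Metric n M) (θ : OneForm n M) : Tensor2 n M :=
  fun x => ofComp2 x fun i j => divDagC (gram g x) (comp1 θ x) i j (coord x)

variable [MeasurableSpace M]

/-- The Riemannian measure `√(det g_ij) dy` of the domain of the chart at `p`, extended by zero. -/
def chartVolume (g : Metric n M) (p : M) : Measure M :=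
  (((volume : Measure (E n)).restrict (chartAt (E n) p).target).withDensity
    fun y => ENNReal.ofReal (Real.sqrt (gram g p y).det)).map (chartAt (E n) p).symm

/-- The Riemannian volume measure: the least measure that dominates `chartVolume g p` for every
`p`. By the change of variables formula the chart measures agree on overlaps, so that (on a second
countable `M`) this is the unique measure that restricts to `√(det g_ij) dy` on every chart. -/
def riemVolume (g : Metric n M) : Measure M := ⨆ p : M, chartVolume g p

/-- The weighted integral `∫_M u e^{-f} dV`. -/
def wInt (g : Metric n M) (f u : M → ℝ) : ℝ :=
  ∫ x, u x * Real.exp (-f x) ∂(riemVolume g)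

/-- `v` is a smooth solution of `Δ_f v + v / (2τ) = div_f div_f h`, `∫_M v e^{-f} dV = 0`. -/
def IsVHat (g : Metric n M) (f : M → ℝ) (τ : ℝ) (h : Tensor2 n M) (v : M → ℝ) : Prop :=
  ContMDiff (𝓡 n) 𝓘(ℝ, ℝ) ∞ v ∧
  (∀ x, lapF0 g f v x + v x / (2 * τ) = divF1 g f (divF2 g f h) x) ∧
  wInt g f v = 0

open Classical in
/-- The function `v̂_h`, the solution `v` of `IsVHat g f τ h v` (zero if there is none). -/
def vHat (g : Metric n M) (f : M → ℝ) (τ : ℝ) (h : Tensor2 n M) : M → ℝ :=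
  if H : ∃ v, IsVHat g f τ h v then H.choose else 0

/-- The stability operator
`N̂ h = ½ Δ_f h + Rm(h, ·) + div_f^† div_f h + ½ ∇² v̂_h - Rc ∫ <Rc, h> e^{-f} / ∫ R e^{-f}`. -/
def stabilityOp (g : Metric n M) (f : M → ℝ) (τ : ℝ) (h : Tensor2 n M) : Tensor2 n M :=
  (1 / 2 : ℝ) • lapF2 g f h + rm g h + divDag g (divF2 g f h)
    + (1 / 2 : ℝ) • hess g (vHat g f τ h)
    - (wInt g f (inner2 g (ricci g) h) / wInt g f (scal g)) • ricci g

/-- The gradient shrinking soliton equation `Rc + ∇² f = g / (2τ)` with `τ > 0` and a smooth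
potential function `f`. -/
structure IsGradientShrinker (g : Metric n M) (f : M → ℝ) (τ : ℝ) : Prop where
  smooth : ContMDiff (𝓡 n) 𝓘(ℝ, ℝ) ∞ f
  pos : 0 < τ
  soliton : ricci g + hess g f = (1 / (2 * τ)) • (g.inner : Tensor2 n M)

end Manifold

end Shrinker

end

noncomputable section

set_option maxSynthPendingDepth 3

namespace Shrinker

/-! ### Covariant derivatives of tensors of arbitrary rank on an open set of a vector space -/

/-! On a shrinker every term of `N̂(Rc)` can be computed. The contracted second Bianchi identity
gives `2 div Rc = dR`. Since `g` is parallel, `∇Rc = -∇³f`, and the Ricci identity for `df` turns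
the antisymmetric part of `∇Rc` into the curvature applied to `∇f`; its trace reads `div Rc - dR =
-Rc(∇f)`. Together these give `dR = 2 Rc(∇f)` and `div_f Rc = 0` (`fderiv_scalar`, `div_ric`). So
the term `div_f^† div_f Rc` vanishes, and `v̂` solves the homogeneous equation `Δ_f v + v/(2τ) = 0`.

This equation has only the solution zero (`eq_zero_of_eigen`). For the value `1/(2τ)` the soliton
equation cancels everything in the weighted Bochner formula except the Hessian: `Δ_f |∇v|² = 2
|∇²v|² ≥ 0` (`bochner_soliton`). The weak maximum principle, applied to `|∇v|² + ε e^{Kv}` with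
suitable `K` and `ε`, forces `∇v = 0`, and then the equation gives `v = 0`.

What is left is `½ Δ_f Rc + Rm(Rc, ·)` minus a multiple of `Rc`. Commuting derivatives in `ΔRc`
shows that the first two terms add up to `Rc/(2τ)` (`lap_ric`). Differentiating `dR = 2 Rc(∇f)` and
tracing gives `Δ_f R = R/τ - 2|Rc|²` (`lap_scalar`); by the weighted divergence theorem
(`wInt_lapF0`) the left side integrates to zero, so `∫|Rc|² e^{-f} = (1/(2τ)) ∫ R e^{-f}`. The
quotient is therefore `1/(2τ)` once `∫ R e^{-f} > 0`: a minimum of `R` shows `R ≥ 0`, and at a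
maximum of `f` the traced soliton equation gives `R > 0` (`wInt_scal_pos`). This needs `n > 0` and
`M` nonempty; otherwise the claim is trivial.

The identities are proved on an open subset of a vector space for a connection `d + Γ`, with tensors
as iterated continuous linear maps and traces as sums over a frame at one point. The index formulas
are identified with this calculus in the namespace `IsMetricOn`. As the value of a tensor at `x` is
defined in the chart at `x`, differentiating in one fixed chart requires the invariance of Hessian
and curvature under the transition maps, which are isometries (`isIsometricOn_trans`). -/

theorem two_le_smooth : minSmoothness ℝ 2 ≤ ∞ := by
  simp only [minSmoothness_of_isRCLikeNormedField]
  exact WithTop.coe_le_coe.2 (le_top : (2 : ℕ∞) ≤ ⊤)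

/-- A normed space on which the endomorphisms of `V` act by derivations. -/
class TensorSpace (V W : Type*) [NormedAddCommGroup V] [NormedSpace ℝ V]
    [NormedAddCommGroup W] [NormedSpace ℝ W] where
  act : (V →L[ℝ] V) →L[ℝ] W →L[ℝ] W
  act_bracket : ∀ (A B : V →L[ℝ] V) (w : W),
    act (A.comp B - B.comp A) w = act A (act B w) - act B (act A w)

section TensorCalculus

variable {V W X Y Z : Type*} [NormedAddCommGroup V] [NormedSpace ℝ V]
  [NormedAddCommGroup W] [NormedSpace ℝ W] [NormedAddCommGroup X] [NormedSpace ℝ X]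
  [NormedAddCommGroup Y] [NormedSpace ℝ Y] [NormedAddCommGroup Z] [NormedSpace ℝ Z]

instance tensorSpaceReal : TensorSpace V ℝ where
  act := 0
  act_bracket := by simp

instance tensorSpaceSelf : TensorSpace V V where
  act := ContinuousLinearMap.id ℝ _
  act_bracket := by simp

/-- Covariant slots receive the minus sign of the derivation rule. Nesting this instance covers all
tensors built from `ℝ` and `V`; in particular `nabla Γ T` is again a tensor field, so `nabla` can be
iterated. The bracket law is what turns a commutator of covariant derivatives into the action of the
curvature. -/
instance tensorSpaceHom [TensorSpace V X] [TensorSpace V Y] : TensorSpace V (X →L[ℝ] Y) where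
  act := (ContinuousLinearMap.compL ℝ X Y Y).comp TensorSpace.act
    - (ContinuousLinearMap.compL ℝ X X Y).flip.comp TensorSpace.act
  act_bracket A B T := by
    ext x
    have h1 := TensorSpace.act_bracket A B (T x)
    have h2 := TensorSpace.act_bracket A B x
    simp only [map_sub, sub_apply] at h1 h2
    simp only [ContinuousLinearMap.comp_apply, sub_apply, ContinuousLinearMap.compL_apply,
      ContinuousLinearMap.flip_apply, map_sub]
    have h3 := congrArg T h2
    simp only [map_sub] at h3
    rw [sub_sub_sub_comm, h1, h3]
    abel

/-- The action of an endomorphism of `V` on tensors. -/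
def act [TensorSpace V W] (A : V →L[ℝ] V) (w : W) : W := TensorSpace.act A w

/-- The action as a continuous bilinear map. -/
def actL (V W : Type*) [NormedAddCommGroup V] [NormedSpace ℝ V]
    [NormedAddCommGroup W] [NormedSpace ℝ W] [TensorSpace V W] :
    (V →L[ℝ] V) →L[ℝ] W →L[ℝ] W := TensorSpace.act

@[simp] theorem actL_apply [TensorSpace V W] (A : V →L[ℝ] V) (w : W) :
    actL V W A w = act A w := rfl

@[simp] theorem act_real (A : V →L[ℝ] V) (w : ℝ) : act A w = 0 := rfl

@[simp] theorem act_self (A : V →L[ℝ] V) (w : V) : act A w = A w := rfl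

@[simp] theorem act_hom [TensorSpace V X] [TensorSpace V Y] (A : V →L[ℝ] V) (T : X →L[ℝ] Y)
    (x : X) : act A T x = act A (T x) - T (act A x) := rfl

@[simp] theorem act_add_right [TensorSpace V W] (A : V →L[ℝ] V) (w w' : W) :
    act A (w + w') = act A w + act A w' := map_add (actL V W A) w w'

@[simp] theorem act_sub_right [TensorSpace V W] (A : V →L[ℝ] V) (w w' : W) :
    act A (w - w') = act A w - act A w' := map_sub (actL V W A) w w'

@[simp] theorem act_neg_right [TensorSpace V W] (A : V →L[ℝ] V) (w : W) :
    act A (-w) = -act A w := map_neg (actL V W A) w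

@[simp] theorem act_zero_right [TensorSpace V W] (A : V →L[ℝ] V) :
    act A (0 : W) = 0 := map_zero (actL V W A)

@[simp] theorem act_smul_right [TensorSpace V W] (A : V →L[ℝ] V) (c : ℝ) (w : W) :
    act A (c • w) = c • act A w := map_smul (actL V W A) c w

theorem act_sum_right [TensorSpace V W] {ι : Type*} (s : Finset ι) (A : V →L[ℝ] V) (w : ι → W) :
    act A (∑ i ∈ s, w i) = ∑ i ∈ s, act A (w i) := map_sum (actL V W A) w s

@[simp] theorem act_add_left [TensorSpace V W] (A B : V →L[ℝ] V) (w : W) :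
    act (A + B) w = act A w + act B w := by
  simp [← actL_apply]

@[simp] theorem act_sub_left [TensorSpace V W] (A B : V →L[ℝ] V) (w : W) :
    act (A - B) w = act A w - act B w := by
  simp [← actL_apply]

theorem act_comp_sub_comp [TensorSpace V W] (A B : V →L[ℝ] V) (w : W) :
    act (A.comp B) w - act (B.comp A) w = act A (act B w) - act B (act A w) := by
  rw [← act_sub_left]
  exact TensorSpace.act_bracket A B w

/-- The covariant derivative of a tensor field with respect to the connection `d + Γ`. -/
def nabla [TensorSpace V W] (Γ : V → V →L[ℝ] V →L[ℝ] V) (T : V → W) (y : V) : V →L[ℝ] W :=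
  fderiv ℝ T y + ((actL V W).flip (T y)).comp (Γ y)

variable [TensorSpace V W] [TensorSpace V X] [TensorSpace V Y] [TensorSpace V Z]
  {Γ : V → V →L[ℝ] V →L[ℝ] V} {U : Set V} {y : V}

theorem nabla_apply (Γ : V → V →L[ℝ] V →L[ℝ] V) (T : V → W) (y u : V) :
    nabla Γ T y u = fderiv ℝ T y u + act (Γ y u) (T y) := rfl

theorem nabla_congr {T S : V → W} (h : T =ᶠ[nhds y] S) : nabla Γ T y = nabla Γ S y := by
  ext u
  rw [nabla_apply, nabla_apply, h.fderiv_eq, h.eq_of_nhds]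

theorem contDiffOn_nabla (hU : IsOpen U) (hΓ : ContDiffOn ℝ ∞ Γ U) {T : V → W}
    (hT : ContDiffOn ℝ ∞ T U) : ContDiffOn ℝ ∞ (nabla Γ T) U := by
  refine (hT.fderiv_of_isOpen hU (m := ∞) (by simp)).add ?_
  exact ContDiffOn.clm_comp ((actL V W).flip.contDiff.comp_contDiffOn hT) hΓ

theorem nabla_add {T S : V → W} (hT : DifferentiableAt ℝ T y) (hS : DifferentiableAt ℝ S y) :
    nabla Γ (fun z => T z + S z) y = nabla Γ T y + nabla Γ S y := by
  ext u
  rw [add_apply, nabla_apply, nabla_apply, nabla_apply, fderiv_fun_add hT hS]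
  simp only [act_add_right, add_apply]
  abel

theorem nabla_sub {T S : V → W} (hT : DifferentiableAt ℝ T y) (hS : DifferentiableAt ℝ S y) :
    nabla Γ (fun z => T z - S z) y = nabla Γ T y - nabla Γ S y := by
  ext u
  rw [sub_apply, nabla_apply, nabla_apply, nabla_apply, fderiv_fun_sub hT hS]
  simp only [act_sub_right, sub_apply]
  abel

theorem nabla_neg (T : V → W) : nabla Γ (fun z => -T z) y = -nabla Γ T y := by
  ext u
  rw [neg_apply, nabla_apply, nabla_apply, fderiv_fun_neg]
  simp only [act_neg_right, neg_apply]
  abel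

theorem nabla_const_smul (c : ℝ) {T : V → W} (hT : DifferentiableAt ℝ T y) :
    nabla Γ (fun z => c • T z) y = c • nabla Γ T y := by
  ext u
  rw [smul_apply, nabla_apply, nabla_apply, fderiv_fun_const_smul hT]
  simp

theorem nabla_zero : nabla Γ (fun _ => (0 : W)) y = 0 := by
  ext u
  simp [nabla_apply]

/-- Natural linear maps between tensor spaces are parallel. -/
theorem nabla_natural (L : X →L[ℝ] Y) (hL : ∀ (A : V →L[ℝ] V) x, act A (L x) = L (act A x))
    {T : V → X} (hT : DifferentiableAt ℝ T y) (u : V) :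
    nabla Γ (fun z => L (T z)) y u = L (nabla Γ T y u) := by
  rw [nabla_apply, nabla_apply, hL]
  have h : HasFDerivAt (fun z => L (T z)) (L.comp (fderiv ℝ T y)) y :=
    L.hasFDerivAt.comp y hT.hasFDerivAt
  rw [h.fderiv]
  simp

/-- The Leibniz rule for natural bilinear maps between tensor spaces. -/
theorem nabla_bilin (B : X →L[ℝ] Y →L[ℝ] Z)
    (hB : ∀ (A : V →L[ℝ] V) x w, act A (B x w) = B (act A x) w + B x (act A w))
    {T : V → X} {S : V → Y} (hT : DifferentiableAt ℝ T y) (hS : DifferentiableAt ℝ S y) (u : V) :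
    nabla Γ (fun z => B (T z) (S z)) y u = B (nabla Γ T y u) (S y) + B (T y) (nabla Γ S y u) := by
  have h := (B.hasFDerivAt.comp y hT.hasFDerivAt).clm_apply hS.hasFDerivAt
  have h' : fderiv ℝ (fun z => B (T z) (S z)) y = _ := h.fderiv
  rw [nabla_apply, nabla_apply, nabla_apply, hB, h']
  simp
  abel

/-- The Leibniz rule for the evaluation of tensors. -/
theorem nabla_clm_apply {T : V → X →L[ℝ] Y} {S : V → X} (hT : DifferentiableAt ℝ T y)
    (hS : DifferentiableAt ℝ S y) (u : V) :
    nabla Γ (fun z => T z (S z)) y u = nabla Γ T y u (S y) + T y (nabla Γ S y u) := by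
  refine nabla_bilin (ContinuousLinearMap.id ℝ (X →L[ℝ] Y)) (fun A x w => ?_) hT hS u
  simp

/-- The Leibniz rule for the composition of tensors. -/
theorem nabla_clm_comp {T : V → Y →L[ℝ] Z} {S : V → X →L[ℝ] Y} (hT : DifferentiableAt ℝ T y)
    (hS : DifferentiableAt ℝ S y) (u : V) :
    nabla Γ (fun z => (T z).comp (S z)) y u
      = (nabla Γ T y u).comp (S y) + (T y).comp (nabla Γ S y u) := by
  refine nabla_bilin (ContinuousLinearMap.compL ℝ X Y Z) (fun A x w => ?_) hT hS u
  ext v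
  simp

theorem nabla_flip {T : V → X →L[ℝ] Y →L[ℝ] Z} (hT : DifferentiableAt ℝ T y) (u : V) :
    nabla Γ (fun z => (T z).flip) y u = (nabla Γ T y u).flip := by
  refine nabla_natural
    (ContinuousLinearMap.flipₗᵢ ℝ X Y Z).toContinuousLinearEquiv.toContinuousLinearMap
    (fun A x => ?_) hT u
  ext v w
  simp
  abel

/-- The curvature tensor `R(u, v) = [∇_u, ∇_v]` of the connection `d + Γ`. -/
def curv (Γ : V → V →L[ℝ] V →L[ℝ] V) (y : V) : V →L[ℝ] V →L[ℝ] V →L[ℝ] V :=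
  let Q := ((ContinuousLinearMap.compL ℝ V (V →L[ℝ] V) (V →L[ℝ] V)).flip (Γ y)).comp
    ((ContinuousLinearMap.compL ℝ V V V).comp (Γ y))
  fderiv ℝ Γ y - (fderiv ℝ Γ y).flip + Q - Q.flip

theorem curv_apply (Γ : V → V →L[ℝ] V →L[ℝ] V) (y u v : V) :
    curv Γ y u v = fderiv ℝ Γ y u v - fderiv ℝ Γ y v u + (Γ y u).comp (Γ y v)
      - (Γ y v).comp (Γ y u) := rfl

theorem contDiffOn_curv (hU : IsOpen U) (hΓ : ContDiffOn ℝ ∞ Γ U) :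
    ContDiffOn ℝ ∞ (curv Γ) U := by
  have h := hΓ.fderiv_of_isOpen hU (m := ∞) (by simp)
  have hQ : ContDiffOn ℝ ∞ (fun y =>
      ((ContinuousLinearMap.compL ℝ V (V →L[ℝ] V) (V →L[ℝ] V)).flip (Γ y)).comp
    ((ContinuousLinearMap.compL ℝ V V V).comp (Γ y))) U :=
    ((ContinuousLinearMap.contDiff _).comp_contDiffOn hΓ).clm_comp
      (contDiffOn_const.clm_comp hΓ)
  have hf := fun (X : V → V →L[ℝ] V →L[ℝ] V →L[ℝ] V) (hX : ContDiffOn ℝ ∞ X U) =>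
    (ContinuousLinearMap.flipₗᵢ ℝ V V (V →L[ℝ] V)).toContinuousLinearEquiv.contDiff.comp_contDiffOn
      hX
  exact ((h.sub (hf _ h)).add hQ).sub (hf _ hQ)

theorem curv_antisymm (Γ : V → V →L[ℝ] V →L[ℝ] V) (y u v : V) : curv Γ y u v = -curv Γ y v u := by
  rw [curv_apply, curv_apply]
  abel

/-- The first Bianchi identity. -/
theorem curv_bianchi (hΓ : ∀ᶠ z in nhds y, ∀ u v, Γ z u v = Γ z v u)
    (hd : DifferentiableAt ℝ Γ y) (u v w : V) :
    curv Γ y u v w + curv Γ y v w u + curv Γ y w u v = 0 := by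
  have hs : ∀ a b c, fderiv ℝ Γ y a b c = fderiv ℝ Γ y a c b := by
    intro a b c
    have h1 : fderiv ℝ (fun z => Γ z b c) y a = fderiv ℝ Γ y a b c := by
      rw [((hd.hasFDerivAt.clm_apply (hasFDerivAt_const b y)).clm_apply
        (hasFDerivAt_const c y)).fderiv]
      simp
    have h2 : fderiv ℝ (fun z => Γ z c b) y a = fderiv ℝ Γ y a c b := by
      rw [((hd.hasFDerivAt.clm_apply (hasFDerivAt_const c y)).clm_apply
        (hasFDerivAt_const b y)).fderiv]
      simp
    rw [← h1, ← h2]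
    have : (fun z => Γ z b c) =ᶠ[nhds y] fun z => Γ z c b := hΓ.mono fun z hz => hz b c
    rw [this.fderiv_eq]
  have h0 := hΓ.self_of_nhds
  simp only [curv_apply, sub_apply, add_apply, ContinuousLinearMap.comp_apply]
  rw [hs u v w, hs v w u, hs w u v, h0 v w, h0 u w, h0 u v]
  abel

theorem fderiv_nabla (hΓ : DifferentiableAt ℝ Γ y) {T : V → W} (hT : DifferentiableAt ℝ T y)
    (hT' : DifferentiableAt ℝ (fderiv ℝ T) y) (u v : V) :
    fderiv ℝ (nabla Γ T) y u v = fderiv ℝ (fderiv ℝ T) y u v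
      + act (fderiv ℝ Γ y u v) (T y) + act (Γ y v) (fderiv ℝ T y u) := by
  have h := hT'.hasFDerivAt.add
    (((actL V W).flip.hasFDerivAt.comp y hT.hasFDerivAt).clm_comp hΓ.hasFDerivAt)
  have h' : fderiv ℝ (nabla Γ T) y = _ := h.fderiv
  rw [h']
  simp
  abel

/-- The Ricci identity for tensors of arbitrary rank. -/
theorem nabla_nabla_sub (hU : IsOpen U) (hy : y ∈ U) (hΓ : ContDiffOn ℝ ∞ Γ U)
    (hs : ∀ u v, Γ y u v = Γ y v u) {T : V → W}
    (hT : ContDiffOn ℝ ∞ T U) (u v : V) :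
    nabla Γ (nabla Γ T) y u v - nabla Γ (nabla Γ T) y v u = act (curv Γ y u v) (T y) := by
  have hTy : ContDiffAt ℝ ∞ T y := hT.contDiffAt (hU.mem_nhds hy)
  have hd : DifferentiableAt ℝ Γ y := (hΓ.contDiffAt (hU.mem_nhds hy)).differentiableAt (by simp)
  have hd2 : DifferentiableAt ℝ (fderiv ℝ T) y :=
    (hTy.fderiv_right (m := ∞) (by simp)).differentiableAt (by simp)
  have hsymm : fderiv ℝ (fderiv ℝ T) y u v = fderiv ℝ (fderiv ℝ T) y v u :=
    (hTy.isSymmSndFDerivAt two_le_smooth).eq u v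
  rw [nabla_apply Γ (nabla Γ T), nabla_apply Γ (nabla Γ T)]
  simp only [add_apply, act_hom, act_self, nabla_apply, curv_apply,
    act_add_right, act_add_left, act_sub_left,
    fderiv_nabla hd (hTy.differentiableAt (by simp)) hd2]
  -- Symmetry removes the second derivatives of `T`, and vanishing torsion the terms in `Γ y u v`.
  -- The remaining Christoffel terms form the commutator of two actions, which is the quadratic part
  -- of the curvature.
  rw [hsymm, hs u v]
  have := act_comp_sub_comp (Γ y u) (Γ y v) (T y)
  rw [← sub_eq_zero] at this ⊢
  rw [← neg_eq_zero, ← this]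
  abel

/-- The second Bianchi identity. -/
theorem nabla_curv_cyclic (hU : IsOpen U) (hy : y ∈ U) (hΓ : ContDiffOn ℝ ∞ Γ U)
    (hs : ∀ u v, Γ y u v = Γ y v u) (u v w : V) :
    nabla Γ (curv Γ) y u v w + nabla Γ (curv Γ) y v w u + nabla Γ (curv Γ) y w u v = 0 := by
  have hΓy : ContDiffAt ℝ ∞ Γ y := hΓ.contDiffAt (hU.mem_nhds hy)
  have hd : DifferentiableAt ℝ Γ y := hΓy.differentiableAt (by simp)
  have hd2 : DifferentiableAt ℝ (fderiv ℝ Γ) y :=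
    (hΓy.fderiv_right (m := ∞) (by simp)).differentiableAt (by simp)
  have hdc : DifferentiableAt ℝ (curv Γ) y :=
    ((contDiffOn_curv hU hΓ).contDiffAt (hU.mem_nhds hy)).differentiableAt (by simp)
  have hsymm : ∀ u v, fderiv ℝ (fderiv ℝ Γ) y u v = fderiv ℝ (fderiv ℝ Γ) y v u :=
    fun u v => (hΓy.isSymmSndFDerivAt two_le_smooth).eq u v
  -- In the cyclic sum the second derivatives of `Γ` cancel by symmetry, the products of `Γ` with
  -- its derivative cancel against the connection terms of `nabla`, and the cubic terms cancel by
  -- the Jacobi identity for the endomorphisms `Γ y u`.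
  have key : ∀ a b c, fderiv ℝ (curv Γ) y a b c
      = fderiv ℝ (fderiv ℝ Γ) y a b c - fderiv ℝ (fderiv ℝ Γ) y a c b
        + ((fderiv ℝ Γ y a b).comp (Γ y c) + (Γ y b).comp (fderiv ℝ Γ y a c))
        - ((fderiv ℝ Γ y a c).comp (Γ y b) + (Γ y c).comp (fderiv ℝ Γ y a b)) := by
    intro a b c
    have h1 : fderiv ℝ (fun z => curv Γ z b c) y a = fderiv ℝ (curv Γ) y a b c := by
      rw [((hdc.hasFDerivAt.clm_apply (hasFDerivAt_const b y)).clm_apply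
        (hasFDerivAt_const c y)).fderiv]
      simp
    have e : ∀ p, HasFDerivAt (fun z => Γ z p) ((fderiv ℝ Γ y).flip p) y := by
      intro p
      exact (hd.hasFDerivAt.clm_apply (hasFDerivAt_const p y)).congr_fderiv (by ext; simp)
    have e2 : ∀ p q, HasFDerivAt (fun z => fderiv ℝ Γ z p q)
        (((fderiv ℝ (fderiv ℝ Γ) y).flip p).flip q) y := by
      intro p q
      exact ((hd2.hasFDerivAt.clm_apply (hasFDerivAt_const p y)).clm_apply
        (hasFDerivAt_const q y)).congr_fderiv (by ext; simp)
    have h2 := (((e2 b c).sub (e2 c b)).add ((e b).clm_comp (e c))).sub ((e c).clm_comp (e b))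
    have h3 : fderiv ℝ (fun z => curv Γ z b c) y = _ := h2.fderiv
    rw [← h1, h3]
    ext x
    simp
    abel
  ext x
  simp only [add_apply, nabla_apply, act_hom, act_self, key, sub_apply,
    ContinuousLinearMap.comp_apply, curv_apply]
  rw [hsymm u v, hsymm v w, hsymm w u, hs u v, hs v w, hs w u]
  simp only [map_sub, map_add, zero_apply]
  abel

end TensorCalculus

/-! ### Levi-Civita connections: frames, contractions, symmetries of the curvature, Bianchi
identities -/

section LeviCivita

variable {V W : Type*} [NormedAddCommGroup V] [NormedSpace ℝ V]
  [NormedAddCommGroup W] [NormedSpace ℝ W]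

/-- `Γ` is the Levi-Civita connection of the Riemannian metric `g` on the open set `U`, and `γ` is
the inverse of `g`. -/
structure IsLeviCivita (U : Set V) (g : V → V →L[ℝ] V →L[ℝ] ℝ) (γ : V → (V →L[ℝ] ℝ) →L[ℝ] V)
    (Γ : V → V →L[ℝ] V →L[ℝ] V) : Prop where
  isOpen : IsOpen U
  smooth_metric : ContDiffOn ℝ ∞ g U
  smooth_inv : ContDiffOn ℝ ∞ γ U
  smooth_conn : ContDiffOn ℝ ∞ Γ U
  symm : ∀ y ∈ U, ∀ u v, g y u v = g y v u
  pos : ∀ y ∈ U, ∀ v, v ≠ 0 → 0 < g y v v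
  inv_metric : ∀ y ∈ U, ∀ v, γ y (g y v) = v
  metric_inv : ∀ y ∈ U, ∀ φ, g y (γ y φ) = φ
  torsion_free : ∀ y ∈ U, ∀ u v, Γ y u v = Γ y v u
  parallel : ∀ y ∈ U, nabla Γ g y = 0

/-- A family `b` is a (Parseval) frame for the bilinear form `B` if every vector `x` equals
`∑ B(x, b_i) b_i`. -/
def IsFrame {ι : Type*} [Fintype ι] (B : V →L[ℝ] V →L[ℝ] ℝ) (b : ι → V) : Prop :=
  ∀ x, ∑ i, B x (b i) • b i = x

/-- A symmetric form has an orthogonal basis, and positivity allows its vectors to be normalised. A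
frame is only ever chosen at a single point: contractions are differentiated by naturality, so local
frame fields are not needed. -/
theorem exists_isFrame [FiniteDimensional ℝ V] (B : V →L[ℝ] V →L[ℝ] ℝ) (hs : ∀ u v, B u v = B v u)
    (hp : ∀ v, v ≠ 0 → 0 < B v v) : ∃ b : Fin (Module.finrank ℝ V) → V, IsFrame B b := by
  let B' : LinearMap.BilinForm ℝ V := LinearMap.mk₂ ℝ (fun u v => B u v) (by simp) (by simp)
    (by simp) (by simp)
  have hB' : ∀ u v, B' u v = B u v := fun u v => rfl
  obtain ⟨v, hv⟩ := LinearMap.BilinForm.exists_orthogonal_basis (B := B') ⟨fun u w => by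
    simp [hB', hs u w]⟩
  have hv0 : ∀ i, 0 < B (v i) (v i) := fun i => hp _ (v.ne_zero i)
  refine ⟨fun i => (Real.sqrt (B (v i) (v i)))⁻¹ • v i, fun x => ?_⟩
  have hx := v.sum_repr x
  have key : ∀ i, B x (v i) = v.repr x i * B (v i) (v i) := by
    intro i
    conv_lhs => rw [← hx]
    simp only [map_sum, map_smul, sum_apply, smul_apply, smul_eq_mul]
    rw [Finset.sum_eq_single i]
    · intro j _ hj
      have : B (v j) (v i) = 0 := hv hj
      rw [this, mul_zero]
    · simp
  conv_rhs => rw [← hx]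
  refine Finset.sum_congr rfl fun i _ => ?_
  rw [map_smul, smul_eq_mul, key, smul_smul]
  congr 1
  have h1 := hv0 i
  have h2 := Real.mul_self_sqrt h1.le
  have h3 : Real.sqrt (B (v i) (v i)) ≠ 0 := (Real.sqrt_pos.2 h1).ne'
  field_simp
  rw [Real.sq_sqrt h1.le, mul_comm]

section Frame

variable {ι : Type*} [Fintype ι] {B : V →L[ℝ] V →L[ℝ] ℝ} {b : ι → V}

theorem IsFrame.apply (hb : IsFrame B b) (T : V →L[ℝ] W) (x : V) :
    ∑ i, B x (b i) • T (b i) = T x := by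
  conv_rhs => rw [← hb x]
  simp

/-- The trace of an endomorphism in a frame. -/
theorem IsFrame.sum_coord [FiniteDimensional ℝ V] {κ : Type*} [Fintype κ] (e : Module.Basis κ ℝ V)
    (hb : IsFrame B b) (A : V →L[ℝ] V) :
    ∑ j, e.coord j (A (e j)) = ∑ i, B (A (b i)) (b i) := by
  have h1 : ∀ j, e.coord j (A (e j)) = ∑ i, B (e j) (b i) * e.coord j (A (b i)) := by
    intro j
    conv_lhs => rw [← hb (e j)]
    simp
  simp_rw [h1]
  rw [Finset.sum_comm]
  refine Finset.sum_congr rfl fun i _ => ?_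
  conv_rhs => rw [← e.sum_repr (A (b i))]
  simp only [map_sum, map_smul, sum_apply, smul_apply, smul_eq_mul, e.coord_apply]
  exact Finset.sum_congr rfl fun j _ => mul_comm _ _

end Frame

section Contraction

variable [FiniteDimensional ℝ V] {κ : Type*} [Fintype κ] (e : Module.Basis κ ℝ V)

/-- The covectors of the dual basis. -/
def dualVec (j : κ) : V →L[ℝ] ℝ := (e.coord j).toContinuousLinearMap

omit [Fintype κ] in
@[simp] theorem dualVec_apply (j : κ) (v : V) : dualVec e j v = e.repr v j := rfl

theorem sum_dualVec (v : V) : ∑ j, dualVec e j v • e j = v := e.sum_repr v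

theorem sum_apply_dualVec (φ : V →L[ℝ] ℝ) : ∑ j, φ (e j) • dualVec e j = φ := by
  ext v
  conv_rhs => rw [← sum_dualVec e v]
  simp only [map_sum, map_smul, sum_apply, smul_apply, smul_eq_mul]
  exact Finset.sum_congr rfl fun j _ => mul_comm _ _

/-- The contraction of a covariant with a contravariant index. -/
def contr (W : Type*) [NormedAddCommGroup W] [NormedSpace ℝ W] :
    ((V →L[ℝ] ℝ) →L[ℝ] V →L[ℝ] W) →L[ℝ] W :=
  ∑ j, (ContinuousLinearMap.apply ℝ W (e j)).comp
    (ContinuousLinearMap.apply ℝ (V →L[ℝ] W) (dualVec e j))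

theorem contr_apply (L : (V →L[ℝ] ℝ) →L[ℝ] V →L[ℝ] W) :
    contr e W L = ∑ j, L (dualVec e j) (e j) := by
  simp [contr]

/-- Endomorphisms act on the dual basis by minus the transpose, so the actions on the covector slot
and on the vector slot cancel in the contraction. By `nabla_natural` the contraction then commutes
with `nabla`. -/
theorem contr_natural [TensorSpace V W] (A : V →L[ℝ] V) (L : (V →L[ℝ] ℝ) →L[ℝ] V →L[ℝ] W) :
    act A (contr e W L) = contr e W (act A L) := by
  have hdual : ∀ j, act A (dualVec e j) = -∑ k, dualVec e j (A (e k)) • dualVec e k := by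
    intro j
    ext v
    have := congrArg (fun φ => φ v) (sum_apply_dualVec e ((dualVec e j).comp A))
    simp only [sum_apply, smul_apply] at this
    simp only [act_hom, act_real, act_self, neg_apply, sum_apply, smul_apply, zero_sub]
    rw [neg_inj, ← ContinuousLinearMap.comp_apply, ← this]
    rfl
  have h : ∑ j, L (act A (dualVec e j)) (e j) = -∑ j, L (dualVec e j) (A (e j)) := by
    have h2 : ∀ j, L (dualVec e j) (A (e j))
        = ∑ k, dualVec e k (A (e j)) • L (dualVec e j) (e k) := by
      intro j
      conv_lhs => rw [← sum_dualVec e (A (e j))]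
      simp only [map_sum, map_smul]
    simp_rw [h2, hdual]
    rw [Finset.sum_comm, ← Finset.sum_neg_distrib]
    simp
  simp only [contr_apply, act_hom, sub_apply, act_sum_right, act_self]
  rw [Finset.sum_sub_distrib, Finset.sum_sub_distrib, h]
  simp

/-- The Ricci contraction `(u, w) ↦ tr (v ↦ L(v, u) w)`. -/
def ricContr : (V →L[ℝ] V →L[ℝ] V →L[ℝ] V) →L[ℝ] V →L[ℝ] V →L[ℝ] ℝ :=
  ∑ j, (ContinuousLinearMap.compL ℝ V (V →L[ℝ] V) (V →L[ℝ] ℝ)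
    (ContinuousLinearMap.compL ℝ V V ℝ (dualVec e j))).comp
      (ContinuousLinearMap.apply ℝ (V →L[ℝ] V →L[ℝ] V) (e j))

theorem ricContr_apply (L : V →L[ℝ] V →L[ℝ] V →L[ℝ] V) (u w : V) :
    ricContr e L u w = ∑ j, dualVec e j (L (e j) u w) := by
  simp [ricContr]

/-- This is `tr (AB) = tr (BA)`, on which the naturality of the Ricci contraction rests. -/
theorem sum_dualVec_comm (A B : V →L[ℝ] V) :
    ∑ j, dualVec e j (A (B (e j))) = ∑ j, dualVec e j (B (A (e j))) := by
  have h : ∀ (A B : V →L[ℝ] V) j, dualVec e j (A (B (e j)))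
      = ∑ k, dualVec e k (B (e j)) * dualVec e j (A (e k)) := by
    intro A B j
    conv_lhs => rw [← sum_dualVec e (B (e j))]
    rw [map_sum, map_sum]
    exact Finset.sum_congr rfl fun k _ => by rw [map_smul, map_smul, smul_eq_mul]
  simp_rw [h]
  rw [Finset.sum_comm]
  simp only [mul_comm]

theorem ricContr_natural (A : V →L[ℝ] V) (L : V →L[ℝ] V →L[ℝ] V →L[ℝ] V) :
    act A (ricContr e L) = ricContr e (act A L) := by
  ext u w
  simp only [ricContr_apply, act_hom, sub_apply, act_real, act_self, map_sub,
    Finset.sum_sub_distrib]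
  have := sum_dualVec_comm e A ((L.flip u).flip w)
  simp only [ContinuousLinearMap.flip_apply] at this
  rw [this]
  ring

/-- Raising an index with the inverse `β` of `B` sends `∑ B(b_i, e_j) e^j` back to `b_i`. All metric
traces become frame sums through this. -/
theorem IsFrame.contr_comp {ι : Type*} [Fintype ι] {B : V →L[ℝ] V →L[ℝ] ℝ} {b : ι → V}
    (hs : ∀ u v, B u v = B v u) (hb : IsFrame B b)
    {β : (V →L[ℝ] ℝ) →L[ℝ] V} (hβ : ∀ v, β (B v) = v) (T : V →L[ℝ] V →L[ℝ] W) :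
    contr e W (T.comp β) = ∑ i, T (b i) (b i) := by
  have h1 : ∀ j, T (β (dualVec e j)) (e j)
      = ∑ i, B (e j) (b i) • T (β (dualVec e j)) (b i) := fun j =>
    (hb.apply (T (β (dualVec e j))) (e j)).symm
  simp only [contr_apply, ContinuousLinearMap.comp_apply]
  simp_rw [h1]
  rw [Finset.sum_comm]
  refine Finset.sum_congr rfl fun i _ => ?_
  have h2 : ∑ j, B (e j) (b i) • β (dualVec e j) = b i := by
    conv_rhs => rw [← hβ (b i), ← sum_apply_dualVec e (B (b i))]
    simp only [map_sum, map_smul, hs (b i)]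
  have h3 := congrArg (fun v => T v (b i)) h2
  simpa only [map_sum, map_smul, sum_apply, smul_apply] using h3

end Contraction

/-- The Ricci tensor of the connection `d + Γ`. -/
def ric [FiniteDimensional ℝ V] {κ : Type*} [Fintype κ] (e : Module.Basis κ ℝ V)
    (Γ : V → V →L[ℝ] V →L[ℝ] V) (y : V) : V →L[ℝ] V →L[ℝ] ℝ := ricContr e (curv Γ y)

/-- The metric trace of a tensor field in its first two arguments. -/
def mtr [FiniteDimensional ℝ V] {κ : Type*} [Fintype κ] (e : Module.Basis κ ℝ V)
    (γ : V → (V →L[ℝ] ℝ) →L[ℝ] V) (T : V → V →L[ℝ] V →L[ℝ] W) (y : V) : W :=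
  contr e W ((T y).comp (γ y))

namespace IsLeviCivita

variable {U : Set V} {g : V → V →L[ℝ] V →L[ℝ] ℝ} {γ : V → (V →L[ℝ] ℝ) →L[ℝ] V}
  {Γ : V → V →L[ℝ] V →L[ℝ] V} {y : V}

theorem mem_nhds (h : IsLeviCivita U g γ Γ) (hy : y ∈ U) : U ∈ nhds y := h.isOpen.mem_nhds hy

theorem differentiableAt (h : IsLeviCivita U g γ Γ) (hy : y ∈ U) {T : V → W}
    (hT : ContDiffOn ℝ ∞ T U) : DifferentiableAt ℝ T y :=
  (hT.contDiffAt (h.mem_nhds hy)).differentiableAt (by simp)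

theorem smooth_nabla (h : IsLeviCivita U g γ Γ) [TensorSpace V W] {T : V → W}
    (hT : ContDiffOn ℝ ∞ T U) : ContDiffOn ℝ ∞ (nabla Γ T) U :=
  contDiffOn_nabla h.isOpen h.smooth_conn hT

theorem smooth_curv (h : IsLeviCivita U g γ Γ) : ContDiffOn ℝ ∞ (curv Γ) U :=
  contDiffOn_curv h.isOpen h.smooth_conn

theorem nabla_congr_on (h : IsLeviCivita U g γ Γ) [TensorSpace V W] (hy : y ∈ U) {T S : V → W}
    (hTS : ∀ z ∈ U, T z = S z) : nabla Γ T y = nabla Γ S y :=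
  nabla_congr (Filter.mem_of_superset (h.mem_nhds hy) hTS)

theorem fderiv_metric (h : IsLeviCivita U g γ Γ) (hy : y ∈ U) (u v w : V) :
    fderiv ℝ g y u v w = g y (Γ y u v) w + g y v (Γ y u w) := by
  have h1 := congrArg (fun L => L u v w) (h.parallel y hy)
  simp only [nabla_apply, add_apply, act_hom, sub_apply, act_real, act_self, zero_apply] at h1
  linarith

/-- Differentiate `γ ∘ g = id`: the identity is parallel and so is `g`; the factor `g` is then
cancelled by evaluating at `γ φ`. -/
theorem nabla_inv (h : IsLeviCivita U g γ Γ) (hy : y ∈ U) : nabla Γ γ y = 0 := by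
  have h1 : nabla Γ (fun z => (γ z).comp (g z)) y = 0 := by
    rw [h.nabla_congr_on hy (S := fun _ => ContinuousLinearMap.id ℝ V)]
    · ext u v
      simp [nabla_apply]
    · intro z hz
      ext v
      exact h.inv_metric z hz v
  ext u φ
  have h2 := congrArg (fun L => L u (γ y φ)) h1
  simp only [nabla_clm_comp (h.differentiableAt hy h.smooth_inv)
    (h.differentiableAt hy h.smooth_metric), h.parallel y hy, add_apply,
    ContinuousLinearMap.comp_apply, zero_apply, map_zero, add_zero, h.metric_inv y hy] at h2
  exact h2

/-- The Ricci identity applied to the parallel tensor `g`: the curvature endomorphism annihilates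
the metric. -/
theorem curv_skew (h : IsLeviCivita U g γ Γ) (hy : y ∈ U) (u v w x : V) :
    g y (curv Γ y u v w) x = -g y (curv Γ y u v x) w := by
  have h0 : nabla Γ (nabla Γ g) y = 0 := by
    rw [h.nabla_congr_on hy (S := fun _ => 0) (fun z hz => h.parallel z hz)]
    exact nabla_zero
  have h1 := nabla_nabla_sub h.isOpen hy h.smooth_conn (h.torsion_free y hy) h.smooth_metric u v
  have h2 := congrArg (fun L => L w x) h1
  simp only [h0, zero_apply, sub_zero, act_hom, act_real, act_self, sub_apply] at h2
  rw [h.symm y hy (curv Γ y u v x) w]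
  linarith

/-- The classical octahedron argument: a linear combination of four first Bianchi identities and the
two skew-symmetries. -/
theorem curv_pair (h : IsLeviCivita U g γ Γ) (hy : y ∈ U) (u v w x : V) :
    g y (curv Γ y u v w) x = g y (curv Γ y w x u) v := by
  have hB : ∀ a b c d, g y (curv Γ y a b c) d + g y (curv Γ y b c a) d
      + g y (curv Γ y c a b) d = 0 := by
    intro a b c d
    have := curv_bianchi (Filter.mem_of_superset (h.mem_nhds hy) h.torsion_free)
      (h.differentiableAt hy h.smooth_conn) a b c
    have h2 := congrArg (fun z => g y z d) this
    simpa only [map_add, add_apply, map_zero, zero_apply] using h2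
  have hA : ∀ a b c d, g y (curv Γ y a b c) d = -g y (curv Γ y b a c) d := by
    intro a b c d
    rw [curv_antisymm Γ y a b]
    simp
  have hS := fun a b c d => h.curv_skew hy a b c d
  have b1 := hB u v w x
  have b2 := hB v w x u
  have b3 := hB w x u v
  have b4 := hB x u v w
  have := hS u v w x
  have := hS v w u x
  have := hS w u v x
  have := hS w x v u
  have := hS x v w u
  have := hS x u w v
  have := hS u w x v
  have := hS u v x w
  have := hS v x u w
  have := hA u w x v
  have := hA w u v x
  have := hA v x u w
  have := hA x v w u
  have := hA u v w x
  have := hA w x u v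
  have := hS w u x v
  have := hS x v u w
  linarith

/-- Writing `∇R` through derivatives of scalar functions lets a pointwise symmetry of `R`, valid on
a neighbourhood, pass to `∇R`. -/
theorem metric_nabla_curv (h : IsLeviCivita U g γ Γ) (hy : y ∈ U) (u a b c d : V) :
    g y (nabla Γ (curv Γ) y u a b c) d = fderiv ℝ (fun z => g z (curv Γ z a b c) d) y u
      - g y (curv Γ y (Γ y u a) b c) d - g y (curv Γ y a (Γ y u b) c) d
      - g y (curv Γ y a b (Γ y u c)) d - g y (curv Γ y a b c) (Γ y u d) := by
  have hR := (h.differentiableAt hy h.smooth_curv).hasFDerivAt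
  have hg := (h.differentiableAt hy h.smooth_metric).hasFDerivAt
  have h1 := (hg.clm_apply (((hR.clm_apply (hasFDerivAt_const a y)).clm_apply
    (hasFDerivAt_const b y)).clm_apply (hasFDerivAt_const c y))).clm_apply (hasFDerivAt_const d y)
  have h2 : fderiv ℝ (fun z => g z (curv Γ z a b c) d) y = _ := h1.fderiv
  rw [h2]
  simp only [add_apply, ContinuousLinearMap.comp_apply, ContinuousLinearMap.flip_apply,
    zero_apply, map_zero, zero_add, h.fderiv_metric hy, nabla_apply, act_hom, act_self, sub_apply,
    map_add, map_sub]
  ring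

theorem nabla_curv_pair (h : IsLeviCivita U g γ Γ) (hy : y ∈ U) (u a b c d : V) :
    g y (nabla Γ (curv Γ) y u a b c) d = g y (nabla Γ (curv Γ) y u c d a) b := by
  rw [h.metric_nabla_curv hy, h.metric_nabla_curv hy]
  have : (fun z => g z (curv Γ z a b c) d) =ᶠ[nhds y] fun z => g z (curv Γ z c d a) b :=
    Filter.mem_of_superset (h.mem_nhds hy) fun z hz => h.curv_pair hz a b c d
  rw [this.fderiv_eq, h.curv_pair hy (Γ y u a), h.curv_pair hy a (Γ y u b),
    h.curv_pair hy a b (Γ y u c), h.curv_pair hy a b c (Γ y u d)]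
  ring

theorem nabla_curv_antisymm (h : IsLeviCivita U g γ Γ) (hy : y ∈ U) (u a b : V) :
    nabla Γ (curv Γ) y u a b = -nabla Γ (curv Γ) y u b a := by
  have h1 : nabla Γ (curv Γ) y = nabla Γ (fun z => -(curv Γ z).flip) y :=
    h.nabla_congr_on hy fun z _ => by
      ext u v w
      rw [curv_antisymm]
      rfl
  have h2 := congrArg (fun L => L u a b) h1
  rw [nabla_neg, neg_apply, nabla_flip (h.differentiableAt hy h.smooth_curv)] at h2
  exact h2

section Ricci

variable [FiniteDimensional ℝ V] {κ : Type*} [Fintype κ] (e : Module.Basis κ ℝ V)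

theorem exists_frame (h : IsLeviCivita U g γ Γ) (hy : y ∈ U) :
    ∃ b : Fin (Module.finrank ℝ V) → V, IsFrame (g y) b :=
  exists_isFrame _ (h.symm y hy) (h.pos y hy)

theorem smooth_ric (h : IsLeviCivita U g γ Γ) : ContDiffOn ℝ ∞ (ric e Γ) U :=
  (ricContr e).contDiff.comp_contDiffOn h.smooth_curv

theorem smooth_mtr (h : IsLeviCivita U g γ Γ) {T : V → V →L[ℝ] V →L[ℝ] W}
    (hT : ContDiffOn ℝ ∞ T U) : ContDiffOn ℝ ∞ (mtr e γ T) U :=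
  (contr e W).contDiff.comp_contDiffOn (hT.clm_comp h.smooth_inv)

/-- The metric trace is parallel. -/
theorem nabla_mtr [TensorSpace V W] (h : IsLeviCivita U g γ Γ) (hy : y ∈ U)
    {T : V → V →L[ℝ] V →L[ℝ] W} (hT : ContDiffOn ℝ ∞ T U) (u : V) :
    nabla Γ (mtr e γ T) y u = contr e W ((nabla Γ T y u).comp (γ y)) := by
  have hTy := h.differentiableAt hy hT
  have hγ := h.differentiableAt hy h.smooth_inv
  have h1 := nabla_natural (Γ := Γ) (contr e W) (contr_natural e)
    (T := fun z => (T z).comp (γ z)) (y := y) (h.differentiableAt hy (hT.clm_comp h.smooth_inv)) u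
  refine h1.trans ?_
  rw [nabla_clm_comp hTy hγ, h.nabla_inv hy]
  simp

variable {ι : Type*} [Fintype ι] {b : ι → V}

theorem mtr_eq_sum (h : IsLeviCivita U g γ Γ) (hy : y ∈ U) (hb : IsFrame (g y) b)
    (T : V → V →L[ℝ] V →L[ℝ] W) : mtr e γ T y = ∑ i, T y (b i) (b i) :=
  hb.contr_comp e (h.symm y hy) (h.inv_metric y hy) (T y)

theorem nabla_mtr_eq_sum [TensorSpace V W] (h : IsLeviCivita U g γ Γ) (hy : y ∈ U)
    (hb : IsFrame (g y) b) {T : V → V →L[ℝ] V →L[ℝ] W} (hT : ContDiffOn ℝ ∞ T U) (u : V) :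
    nabla Γ (mtr e γ T) y u = ∑ i, nabla Γ T y u (b i) (b i) := by
  rw [h.nabla_mtr e hy hT]
  exact hb.contr_comp e (h.symm y hy) (h.inv_metric y hy) _

theorem _root_.Shrinker.IsFrame.ricContr_eq_sum {B : V →L[ℝ] V →L[ℝ] ℝ} (hb : IsFrame B b)
    (L : V →L[ℝ] V →L[ℝ] V →L[ℝ] V) (u w : V) :
    ricContr e L u w = ∑ i, B (L (b i) u w) (b i) := by
  rw [ricContr_apply]
  have := hb.sum_coord e ((L.flip u).flip w)
  simpa using this

theorem _root_.Shrinker.IsFrame.ric_eq_sum {B : V →L[ℝ] V →L[ℝ] ℝ} (hb : IsFrame B b) (u w : V) :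
    ric e Γ y u w = ∑ i, B (curv Γ y (b i) u w) (b i) :=
  hb.ricContr_eq_sum e _ u w

theorem ric_eq_sum' (h : IsLeviCivita U g γ Γ) (hy : y ∈ U) (hb : IsFrame (g y) b) (u w : V) :
    ric e Γ y u w = ∑ i, g y (curv Γ y u (b i) (b i)) w := by
  rw [hb.ric_eq_sum e]
  refine Finset.sum_congr rfl fun i _ => ?_
  rw [h.curv_skew hy, curv_antisymm]
  simp

theorem nabla_ric (h : IsLeviCivita U g γ Γ) (hy : y ∈ U) (v : V) :
    nabla Γ (ric e Γ) y v = ricContr e (nabla Γ (curv Γ) y v) :=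
  nabla_natural (ricContr e) (ricContr_natural e) (h.differentiableAt hy h.smooth_curv) v

theorem ric_symm (h : IsLeviCivita U g γ Γ) (hy : y ∈ U) (u w : V) :
    ric e Γ y u w = ric e Γ y w u := by
  obtain ⟨b, hb⟩ := h.exists_frame hy
  rw [hb.ric_eq_sum e, h.ric_eq_sum' e hy hb]
  refine Finset.sum_congr rfl fun i _ => ?_
  rw [h.curv_pair hy]

theorem nabla_ric_symm (h : IsLeviCivita U g γ Γ) (hy : y ∈ U) (v u w : V) :
    nabla Γ (ric e Γ) y v u w = nabla Γ (ric e Γ) y v w u := by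
  have h1 : nabla Γ (ric e Γ) y = nabla Γ (fun z => (ric e Γ z).flip) y :=
    h.nabla_congr_on hy fun z hz => by
      ext u w
      exact h.ric_symm e hz u w
  conv_lhs => rw [h1]
  rw [nabla_flip (h.differentiableAt hy (h.smooth_ric e))]
  rfl

/-- The once contracted second Bianchi identity. -/
theorem sum_nabla_curv (h : IsLeviCivita U g γ Γ) (hy : y ∈ U) (hb : IsFrame (g y) b)
    (u v c : V) : ∑ i, g y (nabla Γ (curv Γ) y (b i) (b i) u v) c
      = nabla Γ (ric e Γ) y c v u - nabla Γ (ric e Γ) y v c u := by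
  rw [h.nabla_ric e hy, h.nabla_ric e hy, hb.ricContr_eq_sum e, hb.ricContr_eq_sum e,
    ← Finset.sum_sub_distrib]
  refine Finset.sum_congr rfl fun i _ => ?_
  -- Pair symmetry turns the summand on the left into `∇_{b i} R(v, c) (b i)` paired with `u`, the
  -- first of the three cyclic terms. The other two are, up to sign, the summands of the derivatives
  -- of Ricci along `v` and `c`; `e1` brings these to the same form.
  have hB := congrArg (fun L => g y (L (b i)) u)
    (nabla_curv_cyclic h.isOpen hy h.smooth_conn (h.torsion_free y hy) (b i) v c)
  simp only [add_apply, map_add, zero_apply, map_zero] at hB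
  rw [h.nabla_curv_pair hy (b i), h.nabla_curv_pair hy c (b i) v u (b i),
    h.nabla_curv_pair hy v (b i) c u (b i)]
  have e1 : ∀ p q r, g y (nabla Γ (curv Γ) y p u (b i) q) r
      = g y (nabla Γ (curv Γ) y p r q (b i)) u := by
    intro p q r
    rw [h.nabla_curv_pair hy, h.nabla_curv_antisymm hy p q r]
    have : ∀ a b c d, g y (nabla Γ (curv Γ) y p a b c) d
        = -g y (nabla Γ (curv Γ) y p a b d) c := by
      intro a b c d
      rw [h.nabla_curv_pair hy, h.nabla_curv_antisymm hy]
      simp only [neg_apply, map_neg]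
      rw [h.nabla_curv_pair hy]
    rw [this]
    simp
  rw [e1, e1]
  have e2 := h.nabla_curv_antisymm hy c v (b i)
  have e3 := congrArg (fun L => g y (L (b i)) u) e2
  simp only [neg_apply, map_neg] at e3
  linarith

/-- The scalar curvature. -/
def scalar (γ : V → (V →L[ℝ] ℝ) →L[ℝ] V) (Γ : V → V →L[ℝ] V →L[ℝ] V) : V → ℝ :=
  mtr e γ (ric e Γ)

/-- The twice contracted second Bianchi identity. -/
theorem sum_nabla_ric (h : IsLeviCivita U g γ Γ) (hy : y ∈ U) (hb : IsFrame (g y) b) (v : V) :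
    2 * ∑ i, nabla Γ (ric e Γ) y (b i) (b i) v = fderiv ℝ (scalar e γ Γ) y v := by
  have h1 : fderiv ℝ (scalar e γ Γ) y v = ∑ i, nabla Γ (ric e Γ) y v (b i) (b i) := by
    have := h.nabla_mtr_eq_sum e hy hb (h.smooth_ric e) v
    rwa [nabla_apply, act_real, add_zero] at this
  -- The trace of `sum_nabla_curv`. On its left side the antisymmetry of the curvature produces
  -- minus a second copy of the divergence of Ricci, hence the factor 2.
  have h2 : ∑ c, ∑ i, g y (nabla Γ (curv Γ) y (b i) (b i) (b c) v) (b c)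
      = ∑ c, (nabla Γ (ric e Γ) y (b c) v (b c) - nabla Γ (ric e Γ) y v (b c) (b c)) :=
    Finset.sum_congr rfl fun c _ => h.sum_nabla_curv e hy hb (b c) v (b c)
  rw [Finset.sum_comm, Finset.sum_sub_distrib] at h2
  have h3 : ∀ i, ∑ c, g y (nabla Γ (curv Γ) y (b i) (b i) (b c) v) (b c)
      = -nabla Γ (ric e Γ) y (b i) (b i) v := by
    intro i
    rw [h.nabla_ric e hy, hb.ricContr_eq_sum e, ← Finset.sum_neg_distrib]
    refine Finset.sum_congr rfl fun c _ => ?_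
    rw [h.nabla_curv_antisymm hy]
    simp
  simp only [h3, Finset.sum_neg_distrib] at h2
  simp only [h.nabla_ric_symm e hy _ v] at h2
  rw [h1]
  linarith

end Ricci

end IsLeviCivita

end LeviCivita

/-! ### Hessians and the Bochner formula -/

namespace IsLeviCivita

variable {V : Type*} [NormedAddCommGroup V] [NormedSpace ℝ V]
  {U : Set V} {g : V → V →L[ℝ] V →L[ℝ] ℝ} {γ : V → (V →L[ℝ] ℝ) →L[ℝ] V}
  {Γ : V → V →L[ℝ] V →L[ℝ] V} {y : V} {f v : V → ℝ} {c : ℝ}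

theorem metric_inv_apply (h : IsLeviCivita U g γ Γ) (hy : y ∈ U) (φ : V →L[ℝ] ℝ) (u : V) :
    g y (γ y φ) u = φ u := by
  rw [h.metric_inv y hy]

theorem smooth_fderiv (h : IsLeviCivita U g γ Γ) (hf : ContDiffOn ℝ ∞ f U) :
    ContDiffOn ℝ ∞ (fderiv ℝ f) U :=
  hf.fderiv_of_isOpen h.isOpen (m := ∞) (by simp)

theorem smooth_grad (h : IsLeviCivita U g γ Γ) (hf : ContDiffOn ℝ ∞ f U) :
    ContDiffOn ℝ ∞ (fun z => γ z (fderiv ℝ f z)) U :=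
  h.smooth_inv.clm_apply (h.smooth_fderiv hf)

theorem hess_symm (h : IsLeviCivita U g γ Γ) (hy : y ∈ U) (hf : ContDiffOn ℝ ∞ f U) (u w : V) :
    nabla Γ (fderiv ℝ f) y u w = nabla Γ (fderiv ℝ f) y w u := by
  have hfy : ContDiffAt ℝ ∞ f y := hf.contDiffAt (h.mem_nhds hy)
  simp only [nabla_apply, add_apply, act_hom, act_real, act_self]
  rw [(hfy.isSymmSndFDerivAt two_le_smooth).eq u w, h.torsion_free y hy u w]

theorem nabla_grad (h : IsLeviCivita U g γ Γ) (hy : y ∈ U) (hf : ContDiffOn ℝ ∞ f U) (u : V) :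
    nabla Γ (fun z => γ z (fderiv ℝ f z)) y u = γ y (nabla Γ (fderiv ℝ f) y u) := by
  rw [nabla_clm_apply (h.differentiableAt hy h.smooth_inv)
    (h.differentiableAt hy (h.smooth_fderiv hf)), h.nabla_inv hy]
  simp

/-- The Ricci identity for the differential of a function. -/
theorem nabla_hess_sub (h : IsLeviCivita U g γ Γ) (hy : y ∈ U) (hf : ContDiffOn ℝ ∞ f U)
    (l u w : V) : nabla Γ (nabla Γ (fderiv ℝ f)) y l u w - nabla Γ (nabla Γ (fderiv ℝ f)) y u l w
      = -fderiv ℝ f y (curv Γ y l u w) := by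
  have := congrArg (fun L => L w) (nabla_nabla_sub h.isOpen hy h.smooth_conn
    (h.torsion_free y hy) (h.smooth_fderiv hf) l u)
  simpa using this

/-- The covariant derivative of the Ricci identity for the differential of a function. -/
theorem nabla_nabla_hess_sub (h : IsLeviCivita U g γ Γ) (hy : y ∈ U) (hf : ContDiffOn ℝ ∞ f U)
    (k l u w : V) :
    nabla Γ (nabla Γ (nabla Γ (fderiv ℝ f))) y k l u w
      - nabla Γ (nabla Γ (nabla Γ (fderiv ℝ f))) y k u l w
      = -(nabla Γ (fderiv ℝ f) y k (curv Γ y l u w)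
        + fderiv ℝ f y (nabla Γ (curv Γ) y k l u w)) := by
  have hF := (h.differentiableAt hy (h.smooth_fderiv hf)).hasFDerivAt
  have hR := (h.differentiableAt hy h.smooth_curv).hasFDerivAt
  have hQ := (h.differentiableAt hy (h.smooth_nabla (h.smooth_nabla (h.smooth_fderiv hf)))).hasFDerivAt
  have hS : ∀ l u, HasFDerivAt (fun z => nabla Γ (nabla Γ (fderiv ℝ f)) z l u w) _ y := fun l u =>
    ((hQ.clm_apply (hasFDerivAt_const l y)).clm_apply (hasFDerivAt_const u y)).clm_apply
      (hasFDerivAt_const w y)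
  have hT := hF.clm_apply (((hR.clm_apply (hasFDerivAt_const l y)).clm_apply
    (hasFDerivAt_const u y)).clm_apply (hasFDerivAt_const w y))
  have hE : (fun z => nabla Γ (nabla Γ (fderiv ℝ f)) z l u w
      - nabla Γ (nabla Γ (fderiv ℝ f)) z u l w)
      =ᶠ[nhds y] fun z => -fderiv ℝ f z (curv Γ z l u w) :=
    Filter.mem_of_superset (h.mem_nhds hy) fun z hz => h.nabla_hess_sub hz hf l u w
  have hD := congrArg (fun L => L k)
    ((((hS l u).sub (hS u l)).congr_of_eventuallyEq hE.symm).unique hT.neg)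
  simp only [add_apply, sub_apply, neg_apply, ContinuousLinearMap.comp_apply,
    ContinuousLinearMap.flip_apply, zero_apply, map_zero, zero_add] at hD
  have a1 := h.nabla_hess_sub hy hf (Γ y k l) u w
  have a2 := h.nabla_hess_sub hy hf l (Γ y k u) w
  have a3 := h.nabla_hess_sub hy hf l u (Γ y k w)
  rw [nabla_apply Γ (nabla Γ (nabla Γ (fderiv ℝ f))), nabla_apply Γ (curv Γ),
    nabla_apply Γ (fderiv ℝ f) y k]
  simp only [add_apply, act_hom, sub_apply, act_real, act_self, map_add, map_sub]
  linarith

variable [FiniteDimensional ℝ V] {κ : Type*} [Fintype κ] {e : Module.Basis κ ℝ V}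
  {ι : Type*} [Fintype ι] {b : ι → V}

/-- Pairing the sum with a vector and using skew-symmetry gives minus the Ricci trace. Curvature
terms left by commuting derivatives become Ricci terms through this formula. -/
theorem ric_sharp (h : IsLeviCivita U g γ Γ) (hy : y ∈ U) (hb : IsFrame (g y) b) (u : V) :
    ∑ i, curv Γ y (b i) u (b i) = -γ y (ric e Γ y u) := by
  have key : g y (∑ i, curv Γ y (b i) u (b i)) = -ric e Γ y u := by
    ext x
    simp only [map_sum, sum_apply, neg_apply]
    rw [hb.ric_eq_sum e, ← Finset.sum_neg_distrib]
    exact Finset.sum_congr rfl fun i _ => h.curv_skew hy _ _ _ _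
  rw [← h.inv_metric y hy (∑ i, curv Γ y (b i) u (b i)), key, map_neg]

/-- The Laplacian of a function, as the trace of its Hessian, is smooth. -/
theorem fderiv_lap (h : IsLeviCivita U g γ Γ) (hy : y ∈ U) (hb : IsFrame (g y) b)
    (hv : ContDiffOn ℝ ∞ v U) (u : V) : fderiv ℝ (mtr e γ (nabla Γ (fderiv ℝ v))) y u
      = ∑ i, nabla Γ (nabla Γ (fderiv ℝ v)) y u (b i) (b i) := by
  have := h.nabla_mtr_eq_sum e hy hb (h.smooth_nabla (h.smooth_fderiv hv)) u
  rwa [nabla_apply, act_real, add_zero] at this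

/-- The Bochner formula. -/
theorem bochner (h : IsLeviCivita U g γ Γ) (hy : y ∈ U) (hb : IsFrame (g y) b)
    (hv : ContDiffOn ℝ ∞ v U) :
    ∑ i, nabla Γ (fderiv ℝ fun z => fderiv ℝ v z (γ z (fderiv ℝ v z))) y (b i) (b i)
      = 2 * (∑ i, nabla Γ (fderiv ℝ v) y (b i) (γ y (nabla Γ (fderiv ℝ v) y (b i)))
        + fderiv ℝ (mtr e γ (nabla Γ (fderiv ℝ v))) y (γ y (fderiv ℝ v y))
        + ric e Γ y (γ y (fderiv ℝ v y)) (γ y (fderiv ℝ v y))) := by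
  have h1 : ∀ z ∈ U, fderiv ℝ (fun z => fderiv ℝ v z (γ z (fderiv ℝ v z))) z
      = (2 : ℝ) • nabla Γ (fderiv ℝ v) z (γ z (fderiv ℝ v z)) := by
    intro z hz
    ext u
    have := nabla_clm_apply (Γ := Γ) (h.differentiableAt hz (h.smooth_fderiv hv))
      (h.differentiableAt hz (h.smooth_grad hv)) u
    rw [nabla_apply, act_real, add_zero, h.nabla_grad hz hv] at this
    rw [this, smul_apply, h.hess_symm hz hv u, smul_eq_mul,
      ← h.metric_inv_apply hz (fderiv ℝ v z), h.symm z hz, h.metric_inv z hz,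
      h.hess_symm hz hv u]
    ring
  have hN := γ y (fderiv ℝ v y)
  have hs := h.smooth_nabla (h.smooth_fderiv hv)
  have h2 : ∀ u w, nabla Γ (fderiv ℝ fun z => fderiv ℝ v z (γ z (fderiv ℝ v z))) y u w
      = 2 * (nabla Γ (nabla Γ (fderiv ℝ v)) y u (γ y (fderiv ℝ v y)) w
        + nabla Γ (fderiv ℝ v) y w (γ y (nabla Γ (fderiv ℝ v) y u))) := by
    intro u w
    rw [h.nabla_congr_on hy h1, nabla_const_smul _ (h.differentiableAt hy
      (hs.clm_apply (h.smooth_grad hv))), smul_apply, smul_apply,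
      nabla_clm_apply (h.differentiableAt hy hs) (h.differentiableAt hy (h.smooth_grad hv)),
      h.nabla_grad hy hv, add_apply, smul_eq_mul, h.hess_symm hy hv w]
  have h3 := h.fderiv_lap (e := e) hy hb hv (γ y (fderiv ℝ v y))
  have h4 : ∑ i, fderiv ℝ v y (curv Γ y (b i) (γ y (fderiv ℝ v y)) (b i))
      = -ric e Γ y (γ y (fderiv ℝ v y)) (γ y (fderiv ℝ v y)) := by
    rw [← map_sum, h.ric_sharp (e := e) hy hb, map_neg, ← h.metric_inv_apply hy (fderiv ℝ v y),
      h.symm y hy, h.metric_inv y hy]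
  simp only [h2]
  rw [← Finset.mul_sum, Finset.sum_add_distrib, h3, ← neg_eq_iff_eq_neg.2 h4,
    ← Finset.sum_neg_distrib]
  -- Exchanging the first two slots of `∇³v` turns the trace into the derivative of `Δv` along `∇v`.
  -- The cost is a curvature term, whose sum is the Ricci term by `h4`.
  have h5 : ∀ i, nabla Γ (nabla Γ (fderiv ℝ v)) y (b i) (γ y (fderiv ℝ v y)) (b i)
      = nabla Γ (nabla Γ (fderiv ℝ v)) y (γ y (fderiv ℝ v y)) (b i) (b i)
        + -fderiv ℝ v y (curv Γ y (b i) (γ y (fderiv ℝ v y)) (b i)) := fun i => by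
    rw [← h.nabla_hess_sub hy hv]
    ring
  simp only [h5, Finset.sum_add_distrib]
  ring

/-- The soliton equation `Rc + ∇² f = c g` on `U`. -/
def IsSoliton (U : Set V) (g : V → V →L[ℝ] V →L[ℝ] ℝ) (Γ : V → V →L[ℝ] V →L[ℝ] V)
    (e : Module.Basis κ ℝ V) (f : V → ℝ) (c : ℝ) : Prop :=
  ContDiffOn ℝ ∞ f U ∧ ∀ z ∈ U, ric e Γ z + nabla Γ (fderiv ℝ f) z = c • g z

/-! ### Identities on a gradient soliton -/

section Soliton

variable (h : IsLeviCivita U g γ Γ) (hs : IsSoliton U g Γ e f c)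

include hs

omit [Fintype ι] in
theorem hess_eq_of_soliton (hy : y ∈ U) (u w : V) :
    nabla Γ (fderiv ℝ f) y u w = c * g y u w - ric e Γ y u w := by
  have := congrArg (fun L => L u w) (hs.2 y hy)
  simp only [add_apply, smul_apply, smul_eq_mul] at this
  linarith

include h

omit [Fintype ι] in
theorem nabla_ric_eq_neg_nabla_hess (hy : y ∈ U) :
    nabla Γ (ric e Γ) y = -nabla Γ (nabla Γ (fderiv ℝ f)) y := by
  have hH := h.smooth_nabla (h.smooth_fderiv hs.1)
  rw [h.nabla_congr_on hy (S := fun z => c • g z - nabla Γ (fderiv ℝ f) z)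
    (fun z hz => by rw [← hs.2 z hz]; abel),
    nabla_sub (h.differentiableAt hy (h.smooth_metric.const_smul c)) (h.differentiableAt hy hH),
    nabla_const_smul c (h.differentiableAt hy h.smooth_metric), h.parallel y hy]
  simp

omit [Fintype ι] in
-- As `g` is parallel, `∇Rc = -∇³f`, and the antisymmetric part of `∇³f` in its first two slots is
-- given by the Ricci identity.
theorem nabla_ric_sub (hy : y ∈ U) (l u w : V) :
    nabla Γ (ric e Γ) y l u w - nabla Γ (ric e Γ) y u l w = fderiv ℝ f y (curv Γ y l u w) := by
  have := h.nabla_hess_sub hy hs.1 l u w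
  rw [h.nabla_ric_eq_neg_nabla_hess hs hy]
  simp only [neg_apply]
  linarith

omit [Fintype ι] in
theorem nabla_nabla_ric_sub (hy : y ∈ U) (k l u w : V) :
    nabla Γ (nabla Γ (ric e Γ)) y k l u w - nabla Γ (nabla Γ (ric e Γ)) y k u l w
      = nabla Γ (fderiv ℝ f) y k (curv Γ y l u w)
        + fderiv ℝ f y (nabla Γ (curv Γ) y k l u w) := by
  have h1 := h.nabla_congr_on hy (S := fun z => -nabla Γ (nabla Γ (fderiv ℝ f)) z)
    (fun z hz => h.nabla_ric_eq_neg_nabla_hess hs hz)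
  rw [h1, nabla_neg]
  have := h.nabla_nabla_hess_sub hy hs.1 k l u w
  simp only [neg_apply]
  linarith

/-- `∇R = 2 Rc(∇f)`. -/
theorem fderiv_scalar (hy : y ∈ U) (u : V) :
    fderiv ℝ (scalar e γ Γ) y u = 2 * ric e Γ y (γ y (fderiv ℝ f y)) u := by
  obtain ⟨b, hb⟩ := h.exists_frame hy
  have h0 := h.sum_nabla_ric e hy hb u
  have h1 : fderiv ℝ (scalar e γ Γ) y u = ∑ i, nabla Γ (ric e Γ) y u (b i) (b i) := by
    have := h.nabla_mtr_eq_sum e hy hb (h.smooth_ric e) u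
    rwa [nabla_apply, act_real, add_zero] at this
  -- The trace of `nabla_ric_sub` reads `div Rc - dR = -Rc(∇f)`; with `2 div Rc = dR` from `h0` this
  -- determines `dR`.
  have h2 : ∑ i, fderiv ℝ f y (curv Γ y (b i) u (b i))
      = -ric e Γ y (γ y (fderiv ℝ f y)) u := by
    rw [← map_sum, h.ric_sharp (e := e) hy hb, map_neg, h.ric_symm e hy _ u,
      ← h.metric_inv_apply hy (fderiv ℝ f y), h.symm y hy, h.metric_inv y hy]
  simp only [← h.nabla_ric_sub hs hy, Finset.sum_sub_distrib, ← h1] at h2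
  simp only [h.nabla_ric_symm e hy _ u] at h2
  linarith

/-- `div Rc = Rc(∇f)`, that is, `div_f Rc = 0`. -/
theorem div_ric (hy : y ∈ U) (hb : IsFrame (g y) b) (u : V) :
    ∑ i, nabla Γ (ric e Γ) y (b i) (b i) u = ric e Γ y (γ y (fderiv ℝ f y)) u := by
  have h0 := h.sum_nabla_ric e hy hb u
  rw [h.fderiv_scalar hs hy] at h0
  linarith

omit [Fintype ι] in
theorem nabla_grad_potential (hy : y ∈ U) (u : V) :
    nabla Γ (fun z => γ z (fderiv ℝ f z)) y u = c • u - γ y (ric e Γ y u) := by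
  rw [h.nabla_grad hy hs.1]
  have : nabla Γ (fderiv ℝ f) y u = c • g y u - ric e Γ y u := by
    ext w
    exact hess_eq_of_soliton hs hy u w
  rw [this, map_sub, map_smul, h.inv_metric y hy]

omit [Fintype ι] in
theorem nabla_ric_grad (hy : y ∈ U) (u : V) :
    nabla Γ (fun z => ric e Γ z (γ z (fderiv ℝ f z))) y u
      = nabla Γ (ric e Γ) y u (γ y (fderiv ℝ f y)) + (c • ric e Γ y u
        - ric e Γ y (γ y (ric e Γ y u))) := by
  rw [nabla_clm_apply (h.differentiableAt hy (h.smooth_ric e))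
    (h.differentiableAt hy (h.smooth_grad hs.1)), h.nabla_grad_potential hs hy]
  simp

/-- `Δ_f R = 2 c R - 2 |Rc|²`. -/
theorem lap_scalar (hy : y ∈ U) (hb : IsFrame (g y) b) :
    ∑ i, nabla Γ (fderiv ℝ (scalar e γ Γ)) y (b i) (b i)
      - fderiv ℝ (scalar e γ Γ) y (γ y (fderiv ℝ f y))
      = 2 * c * scalar e γ Γ y - 2 * ∑ i, ric e Γ y (b i) (γ y (ric e Γ y (b i))) := by
  -- Differentiate `dR = 2 Rc(∇f)` using `∇∇f = c - Rc`. In the trace, `2 (div Rc)(∇f) = 2 Rc(∇f,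
  -- ∇f) = dR(∇f)` is the drift term, and the rest is `2cR - 2|Rc|²`.
  have h1 : ∀ u, nabla Γ (fderiv ℝ (scalar e γ Γ)) y u
      = (2 : ℝ) • (nabla Γ (ric e Γ) y u (γ y (fderiv ℝ f y)) + (c • ric e Γ y u
        - ric e Γ y (γ y (ric e Γ y u)))) := by
    intro u
    rw [h.nabla_congr_on hy (S := fun z => (2 : ℝ) • ric e Γ z (γ z (fderiv ℝ f z)))
      (fun z hz => by ext w; simpa using h.fderiv_scalar hs hz w),
      nabla_const_smul, smul_apply, h.nabla_ric_grad hs hy]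
    exact h.differentiableAt hy ((h.smooth_ric e).clm_apply (h.smooth_grad hs.1))
  have h2 := h.div_ric hs hy hb (γ y (fderiv ℝ f y))
  have h3 : scalar e γ Γ y = ∑ i, ric e Γ y (b i) (b i) := h.mtr_eq_sum e hy hb _
  have h4 := h.fderiv_scalar hs hy (γ y (fderiv ℝ f y))
  rw [h4, h3, ← h2]
  simp only [h1, smul_apply, add_apply, sub_apply, smul_eq_mul, ← Finset.mul_sum,
    Finset.sum_add_distrib, Finset.sum_sub_distrib, h.nabla_ric_symm e hy _ (γ y (fderiv ℝ f y))]
  simp only [h.ric_symm e hy (γ y _) (b _)]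
  ring

/-- `Δ_f Rc + 2 Rm(Rc, ·) = 2 c Rc`. -/
theorem lap_ric (hy : y ∈ U) (hb : IsFrame (g y) b) (u w : V) :
    ∑ i, nabla Γ (nabla Γ (ric e Γ)) y (b i) (b i) u w
      - nabla Γ (ric e Γ) y (γ y (fderiv ℝ f y)) u w
      = 2 * c * ric e Γ y u w - 2 * ∑ i, ric e Γ y (b i) (curv Γ y (b i) u w) := by
  set N := γ y (fderiv ℝ f y) with hN
  have hK := h.smooth_nabla (h.smooth_ric e)
  -- Two exchanges: the inner derivative with the slot of `u`, by the differentiated `nabla_ric_sub`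
  -- (`h1`), then the two derivatives, by the Ricci identity (`h2`). The Hessian of `f` that appears
  -- is replaced by `c g - Rc`; so the term `Rm(Rc, ·)` arises twice.
  have s1 : ∀ i, nabla Γ (nabla Γ (ric e Γ)) y (b i) (b i) u w
      = nabla Γ (nabla Γ (ric e Γ)) y u (b i) (b i) w
        - ric e Γ y (curv Γ y (b i) u (b i)) w - ric e Γ y (b i) (curv Γ y (b i) u w)
        + (c * g y (curv Γ y (b i) u w) (b i) - ric e Γ y (b i) (curv Γ y (b i) u w))
        + g y (nabla Γ (curv Γ) y (b i) (b i) u w) N := by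
    intro i
    have h1 := h.nabla_nabla_ric_sub hs hy (b i) (b i) u w
    have h2 := congrArg (fun L => L (b i) w) (nabla_nabla_sub h.isOpen hy h.smooth_conn
      (h.torsion_free y hy) (h.smooth_ric e) (b i) u)
    simp only [sub_apply, act_hom, act_real, act_self] at h2
    rw [hess_eq_of_soliton hs hy, ← h.metric_inv_apply hy (fderiv ℝ f y) (nabla Γ (curv Γ) y _ _ _ _),
      h.symm y hy (γ y _), h.symm y hy (b i), ← hN] at h1
    linarith
  -- The divergence of Ricci equals `Rc(∇f)` on all of `U`, so its covariant derivative is known.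
  -- The quadratic Ricci term obtained here cancels the one in `s3`.
  have s2 : ∑ i, nabla Γ (nabla Γ (ric e Γ)) y u (b i) (b i) w
      = nabla Γ (ric e Γ) y u N w + c * ric e Γ y u w - ric e Γ y (γ y (ric e Γ y u)) w := by
    have h1 := h.nabla_mtr_eq_sum e hy hb hK u
    have h2 : ∀ z ∈ U, mtr e γ (nabla Γ (ric e Γ)) z = ric e Γ z (γ z (fderiv ℝ f z)) := by
      intro z hz
      obtain ⟨b', hb'⟩ := h.exists_frame hz
      rw [h.mtr_eq_sum e hz hb']
      ext x
      rw [sum_apply]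
      exact h.div_ric hs hz hb' x
    rw [h.nabla_congr_on hy h2, h.nabla_ric_grad hs hy] at h1
    have h3 := congrArg (fun L => L w) h1
    simp only [add_apply, sub_apply, smul_apply, smul_eq_mul, sum_apply] at h3
    linarith
  have s3 : ∑ i, ric e Γ y (curv Γ y (b i) u (b i)) w = -ric e Γ y (γ y (ric e Γ y u)) w := by
    have := congrArg (fun L => ric e Γ y L w) (h.ric_sharp (e := e) hy hb u)
    simpa using this
  have s4 := hb.ric_eq_sum e (Γ := Γ) (y := y) u w
  -- Of the first derivatives of Ricci only `∇_N Rc` survives: `∇_u Rc(N, w)` from `s2` and `∇_w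
  -- Rc(N, u)` from `s5` differ by `df(R(u, w)N)`, which is zero by skew-symmetry because `N` is the
  -- gradient of `f`.
  have s5 := h.sum_nabla_curv e hy hb u w N
  have s6 := h.nabla_ric_sub hs hy u w N
  have s7 : fderiv ℝ f y (curv Γ y u w N) = 0 := by
    rw [← h.metric_inv_apply hy (fderiv ℝ f y), ← hN, h.symm y hy]
    have := h.curv_skew hy u w N N
    linarith
  simp only [s1, Finset.sum_add_distrib, Finset.sum_sub_distrib, ← Finset.mul_sum]
  rw [s2, s3, ← s4, s5, h.nabla_ric_symm e hy u N w, h.nabla_ric_symm e hy N w u,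
    h.nabla_ric_symm e hy w N u] 
  have s8 := h.nabla_ric_symm e hy w N u
  have s9 := h.nabla_ric_symm e hy u N w
  linarith

end Soliton

end IsLeviCivita

/-! ### Invariance of connection, Hessian and curvature under isometries -/

section Isometry

variable {V : Type*} [NormedAddCommGroup V] [NormedSpace ℝ V]
  {U U' : Set V} {g g' : V → V →L[ℝ] V →L[ℝ] ℝ} {γ γ' : V → (V →L[ℝ] ℝ) →L[ℝ] V}
  {Γ Γ' : V → V →L[ℝ] V →L[ℝ] V} {T : V → V} {z : V}

/-- `T` is a smooth map of `U'` to `U` that pulls the metric `g` back to `g'`. -/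
structure IsIsometricOn (U' U : Set V) (g' g : V → V →L[ℝ] V →L[ℝ] ℝ) (T : V → V) : Prop where
  smooth : ContDiffOn ℝ ∞ T U'
  mapsTo : Set.MapsTo T U' U
  isom : ∀ z ∈ U', ∀ u v, g' z u v = g (T z) (fderiv ℝ T z u) (fderiv ℝ T z v)

variable (h' : IsLeviCivita U' g' γ' Γ') (h : IsLeviCivita U g γ Γ)
  (hT : IsIsometricOn U' U g' g T)

include h' h hT

omit h in
theorem IsIsometricOn.injective (hz : z ∈ U') : Function.Injective (fderiv ℝ T z) := by
  refine (injective_iff_map_eq_zero _).2 fun v hv => ?_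
  by_contra hne
  have h1 := h'.pos z hz v hne
  rw [hT.isom z hz, hv] at h1
  simp at h1

omit h in
theorem IsIsometricOn.surjective [FiniteDimensional ℝ V] (hz : z ∈ U') :
    Function.Surjective (fderiv ℝ T z) :=
  LinearMap.injective_iff_surjective (f := (fderiv ℝ T z).toLinearMap).1 (hT.injective h' hz)

/-- The transformation law of the Levi-Civita connection. -/
theorem IsIsometricOn.conn [FiniteDimensional ℝ V] (hz : z ∈ U') (a b : V) :
    fderiv ℝ T z (Γ' z a b) = Γ (T z) (fderiv ℝ T z a) (fderiv ℝ T z b)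
      + fderiv ℝ (fderiv ℝ T) z a b := by
  have hy := hT.mapsTo hz
  have hTz : ContDiffAt ℝ ∞ T z := hT.smooth.contDiffAt (h'.mem_nhds hz)
  have hT1 := (hTz.differentiableAt (by simp)).hasFDerivAt
  have hT2 := (h'.differentiableAt hz
    (hT.smooth.fderiv_of_isOpen h'.isOpen (m := ∞) (by simp))).hasFDerivAt
  have hg := (h.differentiableAt hy h.smooth_metric).hasFDerivAt
  have hg' := (h'.differentiableAt hz h'.smooth_metric).hasFDerivAt
  have hsymm : ∀ a b, fderiv ℝ (fderiv ℝ T) z a b = fderiv ℝ (fderiv ℝ T) z b a :=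
    fun a b => (hTz.isSymmSndFDerivAt two_le_smooth).eq a b
  -- The defect `C` of the transformation law is symmetric because both connections are torsion
  -- free, and `g(C(a, b), dT c)` is skew in `b` and `c` because both are metric. A trilinear
  -- expression with both symmetries vanishes.
  set C : V → V → V := fun a b => fderiv ℝ T z (Γ' z a b)
    - Γ (T z) (fderiv ℝ T z a) (fderiv ℝ T z b) - fderiv ℝ (fderiv ℝ T) z a b with hC
  have hCs : ∀ a b, C a b = C b a := fun a b => by
    simp only [hC]
    rw [h'.torsion_free z hz, h.torsion_free _ hy, hsymm]
  have hskew : ∀ a b c, g (T z) (C a b) (fderiv ℝ T z c)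
      + g (T z) (C a c) (fderiv ℝ T z b) = 0 := by
    intro a b c
    have h1 := (hg'.clm_apply (hasFDerivAt_const b z)).clm_apply (hasFDerivAt_const c z)
    have h2 := ((hg.comp z hT1).clm_apply (hT2.clm_apply (hasFDerivAt_const b z))).clm_apply
      (hT2.clm_apply (hasFDerivAt_const c z))
    have hE : (fun w => g' w b c) =ᶠ[nhds z]
        fun w => g (T w) (fderiv ℝ T w b) (fderiv ℝ T w c) :=
      Filter.mem_of_superset (h'.mem_nhds hz) fun w hw => hT.isom w hw b c
    have h3 := congrArg (fun L => L a) (h1.unique (h2.congr_of_eventuallyEq hE))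
    simp only [add_apply, ContinuousLinearMap.comp_apply,
      ContinuousLinearMap.flip_apply, zero_apply, map_zero, zero_add, Function.comp_apply,
      h.fderiv_metric hy, h'.fderiv_metric hz, hT.isom z hz] at h3
    simp only [hC, map_sub, sub_apply]
    rw [h.symm _ hy _ (fderiv ℝ T z b), h.symm _ hy _ (fderiv ℝ T z b),
      h.symm _ hy _ (fderiv ℝ T z b)]
    linarith
  have hzero : ∀ a b c, g (T z) (C a b) (fderiv ℝ T z c) = 0 := by
    intro a b c
    have h1 := hskew a b c
    have h2 := hskew b c a
    have h3 := hskew c a b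
    rw [hCs c a] at h3
    rw [hCs c b] at h3
    rw [hCs b a] at h2
    linarith
  have : C a b = 0 := by
    obtain ⟨c, hc⟩ := hT.surjective h' hz (C a b)
    have h1 := hzero a b c
    rw [hc] at h1
    by_contra hne
    exact (h.pos _ hy _ hne).ne' h1
  simp only [hC] at this
  rw [sub_sub, sub_eq_zero] at this
  exact this

/-- The chain rule leaves a term with the second derivative of `T`, and exactly this term appears in
the transformation law of the connection. -/
theorem IsIsometricOn.hess [FiniteDimensional ℝ V] (hz : z ∈ U') {v : V → ℝ}
    (hv : ContDiffOn ℝ ∞ v U) (a b : V) :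
    nabla Γ' (fderiv ℝ fun w => v (T w)) z a b
      = nabla Γ (fderiv ℝ v) (T z) (fderiv ℝ T z a) (fderiv ℝ T z b) := by
  have hy := hT.mapsTo hz
  have hT1 := fun w hw => (h'.differentiableAt (y := w) hw hT.smooth).hasFDerivAt
  have hT2 := (h'.differentiableAt hz
    (hT.smooth.fderiv_of_isOpen h'.isOpen (m := ∞) (by simp))).hasFDerivAt
  have h1 : ∀ w ∈ U', fderiv ℝ (fun w => v (T w)) w = (fderiv ℝ v (T w)).comp (fderiv ℝ T w) :=
    fun w hw => ((h.differentiableAt (hT.mapsTo hw) hv).hasFDerivAt.comp w (hT1 w hw)).fderiv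
  have h2 := ((h.differentiableAt hy (h.smooth_fderiv hv)).hasFDerivAt.comp z (hT1 z hz)).clm_comp
    hT2
  have h3 : fderiv ℝ (fun w => (fderiv ℝ v (T w)).comp (fderiv ℝ T w)) z = _ := h2.fderiv
  rw [h'.nabla_congr_on hz h1, nabla_apply, nabla_apply, h3]
  simp only [add_apply, ContinuousLinearMap.comp_apply, ContinuousLinearMap.flip_apply, act_hom,
    act_real, act_self, ContinuousLinearMap.compL_apply, Function.comp_apply,
    hT.conn h' h hz, map_add]
  ring

/-- Differentiate the transformation law of the connection (`key`) and antisymmetrise: the third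
derivatives of `T` drop out by symmetry, and its second derivatives cancel against the quadratic
part of the curvature. -/
theorem IsIsometricOn.curv [FiniteDimensional ℝ V] (hz : z ∈ U') (a b c : V) :
    fderiv ℝ T z (curv Γ' z a b c)
      = curv Γ (T z) (fderiv ℝ T z a) (fderiv ℝ T z b) (fderiv ℝ T z c) := by
  have hy := hT.mapsTo hz
  have hTz : ContDiffAt ℝ ∞ T z := hT.smooth.contDiffAt (h'.mem_nhds hz)
  have hT1 := (hTz.differentiableAt (by simp)).hasFDerivAt
  have hsm := hT.smooth.fderiv_of_isOpen h'.isOpen (m := ∞) (by simp)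
  have hT2 := (h'.differentiableAt hz hsm).hasFDerivAt
  have hT3 := (h'.differentiableAt hz
    (hsm.fderiv_of_isOpen h'.isOpen (m := ∞) (by simp))).hasFDerivAt
  have hT3s : ∀ a b c, fderiv ℝ (fderiv ℝ (fderiv ℝ T)) z a b c
      = fderiv ℝ (fderiv ℝ (fderiv ℝ T)) z b a c := fun a b c => by
    rw [((hsm.contDiffAt (h'.mem_nhds hz)).isSymmSndFDerivAt two_le_smooth).eq a b]
  have hT2s : ∀ a b, fderiv ℝ (fderiv ℝ T) z a b = fderiv ℝ (fderiv ℝ T) z b a :=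
    fun a b => (hTz.isSymmSndFDerivAt two_le_smooth).eq a b
  have hΓ := (h.differentiableAt hy h.smooth_conn).hasFDerivAt
  have hΓ' := (h'.differentiableAt hz h'.smooth_conn).hasFDerivAt
  have key : ∀ a b c, fderiv ℝ (fderiv ℝ T) z a (Γ' z b c) + fderiv ℝ T z (fderiv ℝ Γ' z a b c)
      = fderiv ℝ Γ (T z) (fderiv ℝ T z a) (fderiv ℝ T z b) (fderiv ℝ T z c)
        + Γ (T z) (fderiv ℝ (fderiv ℝ T) z a b) (fderiv ℝ T z c)
        + Γ (T z) (fderiv ℝ T z b) (fderiv ℝ (fderiv ℝ T) z a c)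
        + fderiv ℝ (fderiv ℝ (fderiv ℝ T)) z a b c := by
    intro a b c
    have h1 := hT2.clm_apply ((hΓ'.clm_apply (hasFDerivAt_const b z)).clm_apply
      (hasFDerivAt_const c z))
    have h2 := (((hΓ.comp z hT1).clm_apply (hT2.clm_apply (hasFDerivAt_const b z))).clm_apply
      (hT2.clm_apply (hasFDerivAt_const c z))).add
        ((hT3.clm_apply (hasFDerivAt_const b z)).clm_apply (hasFDerivAt_const c z))
    have hE : (fun w => fderiv ℝ T w (Γ' w b c)) =ᶠ[nhds z]
        fun w => Γ (T w) (fderiv ℝ T w b) (fderiv ℝ T w c) + fderiv ℝ (fderiv ℝ T) w b c :=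
      Filter.mem_of_superset (h'.mem_nhds hz) fun w hw => hT.conn h' h hw b c
    have h3 := congrArg (fun L => L a) (h1.unique (h2.congr_of_eventuallyEq hE))
    simp only [add_apply, ContinuousLinearMap.comp_apply, ContinuousLinearMap.flip_apply,
      zero_apply, map_zero, zero_add, Function.comp_apply] at h3
    rw [add_comm, h3]
    abel
  have k1 := key a b c
  have k2 := key b a c
  have m1 := hT.conn h' h hz a (Γ' z b c)
  have m2 := hT.conn h' h hz b (Γ' z a c)
  rw [hT.conn h' h hz b c, map_add] at m1
  rw [hT.conn h' h hz a c, map_add] at m2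
  rw [hT3s b a c, hT2s b a] at k2
  simp only [curv_apply, sub_apply, add_apply, ContinuousLinearMap.comp_apply, map_sub, map_add]
  rw [m1, m2, eq_sub_of_add_eq' k1, eq_sub_of_add_eq' k2]
  abel

omit h in
theorem IsIsometricOn.isFrame [FiniteDimensional ℝ V] (hz : z ∈ U') {ι : Type*} [Fintype ι]
    {b : ι → V} (hb : IsFrame (g' z) b) : IsFrame (g (T z)) fun i => fderiv ℝ T z (b i) := by
  intro x
  obtain ⟨x, rfl⟩ := hT.surjective h' hz x
  conv_rhs => rw [← hb x]
  simp [hT.isom z hz]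

theorem IsIsometricOn.ric [FiniteDimensional ℝ V] {κ : Type*} [Fintype κ]
    (e : Module.Basis κ ℝ V) (hz : z ∈ U') (u w : V) :
    ric e Γ' z u w = ric e Γ (T z) (fderiv ℝ T z u) (fderiv ℝ T z w) := by
  obtain ⟨b, hb⟩ := h'.exists_frame hz
  rw [hb.ric_eq_sum e, (hT.isFrame h' hz hb).ric_eq_sum e]
  refine Finset.sum_congr rfl fun i _ => ?_
  rw [hT.isom z hz, hT.curv h' h hz]

end Isometry

/-! ### The index formulas in terms of the invariant calculus -/

section Bridge

variable {n : ℕ}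

/-- The standard basis vectors of `ℝⁿ`. -/
def sv (i : Fin n) : E n := EuclideanSpace.single i 1

/-- The standard basis of `ℝⁿ`. -/
def eb (n : ℕ) : Module.Basis (Fin n) ℝ (E n) := (EuclideanSpace.basisFun (Fin n) ℝ).toBasis

@[simp] theorem eb_apply (i : Fin n) : eb n i = sv i := by
  simp [eb, sv]

@[simp] theorem sv_apply (i j : Fin n) : (sv i : E n) j = if j = i then 1 else 0 := by
  simp [sv]

@[simp] theorem eb_repr (v : E n) (i : Fin n) : (eb n).repr v i = v i := by
  simp [eb]

theorem sum_sv (v : E n) : ∑ i, v i • (sv i : E n) = v := by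
  have := (eb n).sum_repr v
  simpa using this

theorem clm_ext_sv {W : Type*} [NormedAddCommGroup W] [NormedSpace ℝ W] {L L' : E n →L[ℝ] W}
    (h : ∀ i, L (sv i) = L' (sv i)) : L = L' := by
  ext v
  rw [← sum_sv v]
  simp [h]

theorem pd_eq (i : Fin n) (F : E n → ℝ) (y : E n) : pd i F y = fderiv ℝ F y (sv i) := rfl

/-- The bilinear form with the given components. -/
def metricL (G : E n → Matrix (Fin n) (Fin n) ℝ) (y : E n) : E n →L[ℝ] E n →L[ℝ] ℝ :=
  ∑ i, ∑ j, G y i j • (EuclideanSpace.proj i : E n →L[ℝ] ℝ).smulRight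
    (EuclideanSpace.proj j : E n →L[ℝ] ℝ)

/-- The inverse metric as a map from covectors to vectors. -/
def invL (G : E n → Matrix (Fin n) (Fin n) ℝ) (y : E n) : (E n →L[ℝ] ℝ) →L[ℝ] E n :=
  ∑ k, ∑ l, (G y)⁻¹ k l • (ContinuousLinearMap.apply ℝ ℝ (sv l : E n)).smulRight (sv k : E n)

/-- The Levi-Civita connection as a bilinear map. -/
def connL (G : E n → Matrix (Fin n) (Fin n) ℝ) (y : E n) : E n →L[ℝ] E n →L[ℝ] E n :=
  ∑ k, ∑ i, ∑ j, christoffel G k i j y • (EuclideanSpace.proj i : E n →L[ℝ] ℝ).smulRight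
    ((EuclideanSpace.proj j : E n →L[ℝ] ℝ).smulRight (sv k : E n))

variable {G : E n → Matrix (Fin n) (Fin n) ℝ} {U : Set (E n)} {y : E n}

theorem metricL_apply (u v : E n) : metricL G y u v = ∑ i, ∑ j, G y i j * (u i * v j) := by
  simp [metricL]

@[simp] theorem metricL_sv (i j : Fin n) : metricL G y (sv i) (sv j) = G y i j := by
  rw [metricL_apply, Finset.sum_eq_single i (by intro b _ hb; simp [hb]) (by simp),
    Finset.sum_eq_single j (by intro b _ hb; simp [hb]) (by simp)]
  simp

theorem metricL_sv_left (i : Fin n) (v : E n) : metricL G y (sv i) v = ∑ j, G y i j * v j := by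
  conv_lhs => rw [← sum_sv v]
  simp [mul_comm]

theorem invL_apply (φ : E n →L[ℝ] ℝ) :
    invL G y φ = ∑ k, ∑ l, ((G y)⁻¹ k l * φ (sv l)) • (sv k : E n) := by
  simp [invL, smul_smul]

theorem connL_sv (i j : Fin n) :
    connL G y (sv i) (sv j) = ∑ k, christoffel G k i j y • (sv k : E n) := by
  simp only [connL, sum_apply, smul_apply, ContinuousLinearMap.smulRight_apply]
  refine Finset.sum_congr rfl fun k _ => ?_
  rw [Finset.sum_eq_single i (by intro b _ hb; simp [hb]) (by simp),
    Finset.sum_eq_single j (by intro b _ hb; simp [hb]) (by simp)]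
  simp

theorem connL_sv_apply (k i j : Fin n) : connL G y (sv i) (sv j) k = christoffel G k i j y := by
  rw [connL_sv]
  simp

/-- The components of a smooth Riemannian metric on an open set. -/
structure IsMetricOn (U : Set (E n)) (G : E n → Matrix (Fin n) (Fin n) ℝ) : Prop where
  isOpen : IsOpen U
  smooth : ∀ i j, ContDiffOn ℝ ∞ (fun y => G y i j) U
  posDef : ∀ y ∈ U, (G y).PosDef

theorem contDiffOn_det {m : ℕ} {A : E n → Matrix (Fin m) (Fin m) ℝ}
    (hA : ∀ i j, ContDiffOn ℝ ∞ (fun y => A y i j) U) :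
    ContDiffOn ℝ ∞ (fun y => (A y).det) U := by
  simp only [Matrix.det_apply']
  exact ContDiffOn.sum fun σ _ => contDiffOn_const.mul (contDiffOn_prod fun i _ => hA _ _)

namespace IsMetricOn

theorem symm (h : IsMetricOn U G) (hy : y ∈ U) (i j : Fin n) : G y i j = G y j i := by
  have := (h.posDef y hy).isHermitian.apply i j
  simpa using this.symm

theorem det_pos (h : IsMetricOn U G) (hy : y ∈ U) : 0 < (G y).det := (h.posDef y hy).det_pos

theorem isUnit_det (h : IsMetricOn U G) (hy : y ∈ U) : IsUnit (G y).det :=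
  (h.det_pos hy).ne'.isUnit

theorem inv_symm (h : IsMetricOn U G) (hy : y ∈ U) (i j : Fin n) :
    (G y)⁻¹ i j = (G y)⁻¹ j i := by
  have := (h.posDef y hy).isHermitian.inv.apply i j
  simpa using this.symm

theorem sum_inv_mul (h : IsMetricOn U G) (hy : y ∈ U) (i j : Fin n) :
    ∑ k, (G y)⁻¹ i k * G y k j = if i = j then 1 else 0 := by
  rw [← Matrix.mul_apply, Matrix.nonsing_inv_mul _ (h.isUnit_det hy), Matrix.one_apply]

theorem sum_mul_inv (h : IsMetricOn U G) (hy : y ∈ U) (i j : Fin n) :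
    ∑ k, G y i k * (G y)⁻¹ k j = if i = j then 1 else 0 := by
  rw [← Matrix.mul_apply, Matrix.mul_nonsing_inv _ (h.isUnit_det hy), Matrix.one_apply]

theorem smooth_det (h : IsMetricOn U G) : ContDiffOn ℝ ∞ (fun y => (G y).det) U :=
  contDiffOn_det h.smooth

theorem smooth_inv (h : IsMetricOn U G) (i j : Fin n) :
    ContDiffOn ℝ ∞ (fun y => (G y)⁻¹ i j) U := by
  -- Cramer's rule: an entry of the inverse is a quotient of determinants of smooth entries.
  have h1 : ∀ y ∈ U, (G y)⁻¹ i j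
      = ((G y).det)⁻¹ * ((G y).updateRow j (Pi.single i 1)).det := by
    intro y hy
    rw [Matrix.inv_def, Matrix.smul_apply, Matrix.adjugate_apply, Ring.inverse_eq_inv', smul_eq_mul]
  refine ContDiffOn.congr ?_ h1
  refine (h.smooth_det.inv fun y hy => (h.det_pos hy).ne').mul (contDiffOn_det fun a b => ?_)
  by_cases ha : a = j
  · subst ha
    simp only [Matrix.updateRow_self]
    exact contDiffOn_const
  · simp only [Matrix.updateRow_ne ha]
    exact h.smooth a b

theorem differentiableAt (h : IsMetricOn U G) (hy : y ∈ U) (i j : Fin n) :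
    DifferentiableAt ℝ (fun z => G z i j) y :=
  ((h.smooth i j).contDiffAt (h.isOpen.mem_nhds hy)).differentiableAt (by simp)

theorem smooth_christoffel (h : IsMetricOn U G) (k i j : Fin n) :
    ContDiffOn ℝ ∞ (christoffel G k i j) U := by
  have hp : ∀ i a b, ContDiffOn ℝ ∞ (pd i fun z => G z a b) U := fun i a b =>
    ((h.smooth a b).fderiv_of_isOpen h.isOpen (m := ∞) (by simp)).clm_apply contDiffOn_const
  exact contDiffOn_const.mul (ContDiffOn.sum fun l _ => (h.smooth_inv k l).mul
    (((hp i j l).add (hp j i l)).sub (hp l i j)))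

theorem christoffel_symm (h : IsMetricOn U G) (hy : y ∈ U) (k i j : Fin n) :
    christoffel G k i j y = christoffel G k j i y := by
  have : ∀ l, pd l (fun z => G z i j) y = pd l (fun z => G z j i) y := fun l => by
    have hE : (fun z => G z i j) =ᶠ[nhds y] fun z => G z j i :=
      Filter.mem_of_superset (h.isOpen.mem_nhds hy) fun z hz => h.symm hz i j
    rw [pd_eq, pd_eq, hE.fderiv_eq]
  simp only [christoffel, this]
  congr 1
  exact Finset.sum_congr rfl fun l _ => by ring

/-- The Christoffel symbols of the first kind. -/
theorem sum_mul_christoffel (h : IsMetricOn U G) (hy : y ∈ U) (k i j : Fin n) :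
    ∑ m, G y k m * christoffel G m i j y = (1 / 2) * (pd i (fun z => G z j k) y
      + pd j (fun z => G z i k) y - pd k (fun z => G z i j) y) := by
  have h1 : ∑ m, G y k m * christoffel G m i j y
      = ∑ l, (1 / 2) * (∑ m, G y k m * (G y)⁻¹ m l) * (pd i (fun z => G z j l) y
        + pd j (fun z => G z i l) y - pd l (fun z => G z i j) y) := by
    simp only [christoffel, Finset.mul_sum, Finset.sum_mul]
    rw [Finset.sum_comm]
    exact Finset.sum_congr rfl fun l _ => Finset.sum_congr rfl fun m _ => by ring
  rw [h1]
  simp [h.sum_mul_inv hy]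

/-- `∂_k g_ij = Γ_kij + Γ_kji`. -/
theorem pd_eq_christoffel (h : IsMetricOn U G) (hy : y ∈ U) (k i j : Fin n) :
    pd k (fun z => G z i j) y = ∑ m, G y i m * christoffel G m k j y
      + ∑ m, G y j m * christoffel G m k i y := by
  have hs : ∀ l a b, pd l (fun z => G z a b) y = pd l (fun z => G z b a) y := fun l a b => by
    have hE : (fun z => G z a b) =ᶠ[nhds y] fun z => G z b a :=
      Filter.mem_of_superset (h.isOpen.mem_nhds hy) fun z hz => h.symm hz a b
    rw [pd_eq, pd_eq, hE.fderiv_eq]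
  rw [h.sum_mul_christoffel hy, h.sum_mul_christoffel hy, hs k j i, hs j k i, hs i k j]
  ring

theorem smooth_connL (h : IsMetricOn U G) : ContDiffOn ℝ ∞ (connL G) U :=
  ContDiffOn.sum fun k _ => ContDiffOn.sum fun i _ => ContDiffOn.sum fun j _ =>
    (h.smooth_christoffel k i j).smul contDiffOn_const

theorem smooth_metricL (h : IsMetricOn U G) : ContDiffOn ℝ ∞ (metricL G) U :=
  ContDiffOn.sum fun i _ => ContDiffOn.sum fun j _ => (h.smooth i j).smul contDiffOn_const

theorem smooth_invL (h : IsMetricOn U G) : ContDiffOn ℝ ∞ (invL G) U :=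
  ContDiffOn.sum fun i _ => ContDiffOn.sum fun j _ => (h.smooth_inv i j).smul contDiffOn_const

theorem fderiv_metricL (h : IsMetricOn U G) (hy : y ∈ U) (u : E n) (i j : Fin n) :
    fderiv ℝ (metricL G) y u (sv i) (sv j) = fderiv ℝ (fun z => G z i j) y u := by
  have hd : DifferentiableAt ℝ (metricL G) y :=
    (h.smooth_metricL.contDiffAt (h.isOpen.mem_nhds hy)).differentiableAt (by simp)
  have h1 := ((hd.hasFDerivAt.clm_apply (hasFDerivAt_const (sv i) y)).clm_apply
    (hasFDerivAt_const (sv j) y)).fderiv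
  simp only [metricL_sv] at h1
  rw [h1]
  simp

theorem isLeviCivita (h : IsMetricOn U G) : IsLeviCivita U (metricL G) (invL G) (connL G) where
  isOpen := h.isOpen
  smooth_metric := h.smooth_metricL
  smooth_inv := h.smooth_invL
  smooth_conn := h.smooth_connL
  symm y hy u v := by
    rw [metricL_apply, metricL_apply, Finset.sum_comm]
    exact Finset.sum_congr rfl fun i _ => Finset.sum_congr rfl fun j _ => by
      rw [h.symm hy j i]; ring
  pos y hy v hv := by
    have h1 := (h.posDef y hy).dotProduct_mulVec_pos (x := fun i => v i)
      (by intro h0; apply hv; ext i; exact congrFun h0 i)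
    rw [metricL_apply]
    refine lt_of_lt_of_eq h1 ?_
    simp only [dotProduct, Matrix.mulVec, star_trivial, Finset.mul_sum]
    exact Finset.sum_congr rfl fun i _ => Finset.sum_congr rfl fun j _ => by
      ring
  inv_metric y hy v := by
    rw [invL_apply]
    conv_rhs => rw [← sum_sv v]
    refine Finset.sum_congr rfl fun k _ => ?_
    rw [← Finset.sum_smul]
    congr 1
    have h1 : ∀ l, metricL G y v (sv l) = ∑ i, v i * G y i l := fun l => by
      conv_lhs => rw [← sum_sv v]
      simp
    simp only [h1, Finset.mul_sum]
    rw [Finset.sum_comm]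
    have h2 : ∀ i, ∑ l, (G y)⁻¹ k l * (v i * G y i l) = v i * if k = i then 1 else 0 := by
      intro i
      rw [← h.sum_inv_mul hy, Finset.mul_sum]
      exact Finset.sum_congr rfl fun l _ => by rw [h.symm hy i l]; ring
    simp [h2]
  metric_inv y hy φ := by
    refine clm_ext_sv fun i => ?_
    rw [invL_apply]
    simp only [map_sum, map_smul, sum_apply, smul_apply, metricL_sv, smul_eq_mul]
    rw [Finset.sum_comm]
    have h2 : ∀ l, ∑ k, (G y)⁻¹ k l * φ (sv l) * G y k i
        = φ (sv l) * if l = i then 1 else 0 := by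
      intro l
      rw [← h.sum_inv_mul hy, Finset.mul_sum]
      exact Finset.sum_congr rfl fun k _ => by rw [h.inv_symm hy k l]; ring
    simp [h2]
  torsion_free y hy u v := by
    have h1 : connL G y = (connL G y).flip := clm_ext_sv fun i => clm_ext_sv fun j => by
      rw [ContinuousLinearMap.flip_apply, connL_sv, connL_sv]
      exact Finset.sum_congr rfl fun k _ => by rw [h.christoffel_symm hy]
    conv_lhs => rw [h1]
    rfl
  parallel y hy := by
    refine clm_ext_sv fun k => clm_ext_sv fun i => clm_ext_sv fun j => ?_
    simp only [nabla_apply, add_apply, act_hom, sub_apply, act_real, act_self, zero_apply,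
      h.fderiv_metricL hy]
    have h1 := h.pd_eq_christoffel hy k i j
    rw [pd_eq] at h1
    have h2 : ∀ a b c, metricL G y (connL G y (sv a) (sv b)) (sv c)
        = ∑ m, G y c m * christoffel G m a b y := by
      intro a b c
      rw [connL_sv]
      simp only [map_sum, map_smul, sum_apply, smul_apply, metricL_sv, smul_eq_mul]
      exact Finset.sum_congr rfl fun m _ => by rw [h.symm hy m c]; ring
    have h3 : metricL G y (sv i) (connL G y (sv k) (sv j))
        = ∑ m, G y i m * christoffel G m k j y := by
      rw [metricL_sv_left]
      simp only [connL_sv_apply]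
    rw [h2, h3, h1]
    ring

variable {W : Type*} [NormedAddCommGroup W] [NormedSpace ℝ W] {ι : Type*} [Fintype ι]
  {b : ι → E n}

/-- Index traces as sums over a frame. -/
theorem sum_inv_eq (h : IsMetricOn U G) (hy : y ∈ U) (hb : IsFrame (metricL G y) b)
    (T : E n →L[ℝ] E n →L[ℝ] W) :
    ∑ j, ∑ k, (G y)⁻¹ j k • T (sv j) (sv k) = ∑ i, T (b i) (b i) := by
  rw [← h.isLeviCivita.mtr_eq_sum (eb n) hy hb (fun _ => T), mtr, contr_apply, Finset.sum_comm]
  refine Finset.sum_congr rfl fun k _ => ?_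
  simp only [ContinuousLinearMap.comp_apply, invL_apply, dualVec_apply, eb_repr, eb_apply, sv_apply,
    map_sum, map_smul, sum_apply, smul_apply]
  refine Finset.sum_congr rfl fun j _ => ?_
  rw [Finset.sum_eq_single k (by intro l _ hl; simp [hl.symm]) (by simp)]
  simp

theorem trC_eq (h : IsMetricOn U G) (hy : y ∈ U) (hb : IsFrame (metricL G y) b)
    {k : Fin n → Fin n → E n → ℝ} {k' : E n →L[ℝ] E n →L[ℝ] ℝ}
    (hk : ∀ i j, k i j y = k' (sv i) (sv j)) : trC G k y = ∑ i, k' (b i) (b i) := by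
  rw [← h.sum_inv_eq hy hb]
  simp [trC, hk]

theorem innerC_eq (h : IsMetricOn U G) (hy : y ∈ U) (hb : IsFrame (metricL G y) b)
    {k l : Fin n → Fin n → E n → ℝ} {k' l' : E n →L[ℝ] E n →L[ℝ] ℝ}
    (hk : ∀ i j, k i j y = k' (sv i) (sv j)) (hl : ∀ i j, l i j y = l' (sv i) (sv j)) :
    innerC G k l y = ∑ i, ∑ j, k' (b i) (b j) * l' (b i) (b j) := by
  have h1 : ∀ p q : E n, ∑ j, ∑ c, (G y)⁻¹ j c * (k' p (sv j) * l' q (sv c))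
      = ∑ s, k' p (b s) * l' q (b s) := fun p q => by
    have := h.sum_inv_eq hy hb ((k' p).smulRight (l' q))
    simpa using this
  have h2 := h.sum_inv_eq hy hb (∑ s, (k'.flip (b s)).smulRight (l'.flip (b s)))
  simp only [sum_apply, ContinuousLinearMap.smulRight_apply, ContinuousLinearMap.flip_apply,
    smul_apply, smul_eq_mul, ← h1] at h2
  rw [← Finset.sum_congr rfl fun i _ => h1 (b i) (b i), ← h2]
  simp only [innerC, hk, hl, Finset.mul_sum]
  refine Finset.sum_congr rfl fun i _ => ?_
  rw [Finset.sum_comm]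
  refine Finset.sum_congr rfl fun a _ => Finset.sum_congr rfl fun j _ =>
    Finset.sum_congr rfl fun c _ => by ring

theorem curvUp_eq (h : IsMetricOn U G) (hy : y ∈ U) (i j l m : Fin n) :
    curvUp G i j l m y = curv (connL G) y (sv i) (sv j) (sv l) m := by
  have hd : ∀ i j l, pd i (christoffel G m j l) y = fderiv ℝ (connL G) y (sv i) (sv j) (sv l) m := by
    intro i j l
    have h0 := (h.isLeviCivita.differentiableAt hy h.smooth_connL).hasFDerivAt
    have h1 := (EuclideanSpace.proj m : E n →L[ℝ] ℝ).hasFDerivAt.comp y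
      ((h0.clm_apply (hasFDerivAt_const (sv j) y)).clm_apply (hasFDerivAt_const (sv l) y))
    have h2 : (⇑(EuclideanSpace.proj m : E n →L[ℝ] ℝ) ∘ fun z => connL G z (sv j) (sv l))
        = christoffel G m j l := by
      ext z
      simp [connL_sv_apply]
    rw [h2] at h1
    rw [pd_eq, h1.fderiv]
    simp
  have hq : ∀ i j l, connL G y (sv i) (connL G y (sv j) (sv l)) m
      = ∑ p, christoffel G m i p y * christoffel G p j l y := by
    intro i j l
    rw [connL_sv j l]
    simp only [map_sum, map_smul]
    simp [connL_sv_apply, mul_comm]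
  simp only [curvUp, curv_apply, sub_apply, add_apply, ContinuousLinearMap.comp_apply,
    PiLp.sub_apply, PiLp.add_apply, hd, hq, Finset.sum_sub_distrib]
  ring

theorem riem_eq (h : IsMetricOn U G) (hy : y ∈ U) (i j k l : Fin n) :
    riem G i j k l y = metricL G y (curv (connL G) y (sv i) (sv j) (sv l)) (sv k) := by
  rw [h.isLeviCivita.symm y hy, metricL_sv_left]
  simp only [riem, h.curvUp_eq hy]

/-- The index formula contracts the second and fourth slots of `R_ijkl`, while `ric` is a trace over
the first argument of the curvature. The skew-symmetries make them agree, sign included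
(`ric_eq_sum'`). -/
theorem ricC_eq (h : IsMetricOn U G) (hy : y ∈ U) (i k : Fin n) :
    ricC G i k y = ric (eb n) (connL G) y (sv i) (sv k) := by
  obtain ⟨b, hb⟩ := h.isLeviCivita.exists_frame hy
  rw [h.isLeviCivita.ric_eq_sum' (eb n) hy hb]
  have := h.sum_inv_eq hy hb ((ContinuousLinearMap.compL ℝ (E n) (E n) ℝ
    ((metricL G y).flip (sv k))).comp (curv (connL G) y (sv i)))
  simp only [ContinuousLinearMap.comp_apply, ContinuousLinearMap.compL_apply,
    ContinuousLinearMap.flip_apply] at this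
  rw [← this]
  simp [ricC, h.riem_eq hy]

/-- One of the two contractions is absorbed by expanding the curvature vector in the frame; the
result has the shape in which the curvature term comes out of `lap_ric`. -/
theorem rmC_eq (h : IsMetricOn U G) (hy : y ∈ U) (hb : IsFrame (metricL G y) b)
    {k : Fin n → Fin n → E n → ℝ} {k' : E n →L[ℝ] E n →L[ℝ] ℝ}
    (hk : ∀ i j, k i j y = k' (sv i) (sv j)) (i l : Fin n) :
    rmC G k i l y = ∑ s, k' (b s) (curv (connL G) y (b s) (sv i) (sv l)) := by
  have h0 := h.isLeviCivita
  have h2 : ∀ s, k' (b s) (curv (connL G) y (b s) (sv i) (sv l))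
      = ∑ t, metricL G y (curv (connL G) y (sv i) (b s) (b t)) (sv l) * k' (b s) (b t) := by
    intro s
    rw [← hb.apply (k' (b s))]
    refine Finset.sum_congr rfl fun t _ => ?_
    rw [h0.curv_skew hy, curv_antisymm]
    simp
  let R' : E n →L[ℝ] E n →L[ℝ] ℝ := (ContinuousLinearMap.compL ℝ (E n) (E n) ℝ
    ((metricL G y).flip (sv l))).comp (curv (connL G) y (sv i))
  have h3 : ∀ p q, metricL G y (curv (connL G) y (sv i) p q) (sv l) = R' p q := fun p q => rfl
  have h4 := h.innerC_eq hy hb (k := fun j l' z => R' (sv j) (sv l')) (l := k) (fun _ _ => rfl) hk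
  simp only [h2, h3]
  rw [← h4, rmC, innerC]
  simp only [h.riem_eq hy, h3]
  

theorem cov1_eq (h : IsMetricOn U G) (hy : y ∈ U) {θ : Fin n → E n → ℝ} {θ' : E n → E n →L[ℝ] ℝ}
    (hd : DifferentiableAt ℝ θ' y) (hθ : ∀ z ∈ U, ∀ i, θ i z = θ' z (sv i)) (k i : Fin n) :
    cov1 G θ k i y = nabla (connL G) θ' y (sv k) (sv i) := by
  have hE : θ i =ᶠ[nhds y] fun z => θ' z (sv i) :=
    Filter.mem_of_superset (h.isOpen.mem_nhds hy) fun z hz => hθ z hz i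
  have h1 := hd.hasFDerivAt.clm_apply (hasFDerivAt_const (sv i) y)
  rw [cov1, pd_eq, hE.fderiv_eq, h1.fderiv]
  simp only [nabla_apply, add_apply, act_hom, act_real, act_self, connL_sv, map_sum, map_smul,
    smul_eq_mul, hθ y hy]
  simp
  ring

theorem cov2_eq (h : IsMetricOn U G) (hy : y ∈ U) {k : Fin n → Fin n → E n → ℝ}
    {k' : E n → E n →L[ℝ] E n →L[ℝ] ℝ}
    (hd : DifferentiableAt ℝ k' y) (hk : ∀ z ∈ U, ∀ i j, k i j z = k' z (sv i) (sv j))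
    (a i j : Fin n) :
    cov2 G k a i j y = nabla (connL G) k' y (sv a) (sv i) (sv j) := by
  have hE : k i j =ᶠ[nhds y] fun z => k' z (sv i) (sv j) :=
    Filter.mem_of_superset (h.isOpen.mem_nhds hy) fun z hz => hk z hz i j
  have h1 := (hd.hasFDerivAt.clm_apply (hasFDerivAt_const (sv i) y)).clm_apply
    (hasFDerivAt_const (sv j) y)
  rw [cov2, pd_eq, hE.fderiv_eq, h1.fderiv]
  simp only [nabla_apply, add_apply, act_hom, act_real, act_self, connL_sv, map_sum, map_smul,
    smul_eq_mul, hk y hy, sub_apply, sum_apply, smul_apply]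
  simp
  ring

theorem cov3_eq (h : IsMetricOn U G) (hy : y ∈ U) {T : Fin n → Fin n → Fin n → E n → ℝ}
    {T' : E n → E n →L[ℝ] E n →L[ℝ] E n →L[ℝ] ℝ} (hd : DifferentiableAt ℝ T' y)
    (hT : ∀ z ∈ U, ∀ a i j, T a i j z = T' z (sv a) (sv i) (sv j)) (k a i j : Fin n) :
    cov3 G T k a i j y = nabla (connL G) T' y (sv k) (sv a) (sv i) (sv j) := by
  have hE : T a i j =ᶠ[nhds y] fun z => T' z (sv a) (sv i) (sv j) :=
    Filter.mem_of_superset (h.isOpen.mem_nhds hy) fun z hz => hT z hz a i j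
  have h1 := ((hd.hasFDerivAt.clm_apply (hasFDerivAt_const (sv a) y)).clm_apply
    (hasFDerivAt_const (sv i) y)).clm_apply (hasFDerivAt_const (sv j) y)
  rw [cov3, pd_eq, hE.fderiv_eq, h1.fderiv]
  simp only [nabla_apply, add_apply, act_hom, act_real, act_self, connL_sv, map_sum, map_smul,
    smul_eq_mul, hT y hy, sub_apply, sum_apply, smul_apply]
  simp
  ring

theorem hessC_eq (h : IsMetricOn U G) (hy : y ∈ U) {v : E n → ℝ} (hv : ContDiffOn ℝ ∞ v U)
    (i j : Fin n) : hessC G v i j y = nabla (connL G) (fderiv ℝ v) y (sv i) (sv j) :=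
  h.cov1_eq hy (h.isLeviCivita.differentiableAt hy (h.isLeviCivita.smooth_fderiv hv))
    (fun _ _ _ => rfl) i j

/-- Contraction with the gradient as a sum over a frame. -/
theorem sum_frame_smul (h : IsMetricOn U G) (hy : y ∈ U) (hb : IsFrame (metricL G y) b)
    (φ : E n →L[ℝ] ℝ) (L : E n →L[ℝ] W) : ∑ i, φ (b i) • L (b i) = L (invL G y φ) := by
  rw [← hb.apply L]
  simp only [h.isLeviCivita.metric_inv_apply hy]

theorem lapF0C_eq (h : IsMetricOn U G) (hy : y ∈ U) (hb : IsFrame (metricL G y) b)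
    {f v : E n → ℝ} (hv : ContDiffOn ℝ ∞ v U) :
    lapF0C G f v y = ∑ i, nabla (connL G) (fderiv ℝ v) y (b i) (b i)
      - fderiv ℝ v y (invL G y (fderiv ℝ f y)) := by
  rw [← h.sum_frame_smul hy hb, ← Finset.sum_sub_distrib]
  have := h.sum_inv_eq hy hb (nabla (connL G) (fderiv ℝ v) y
    - (fderiv ℝ f y).smulRight (fderiv ℝ v y))
  simp only [sub_apply, ContinuousLinearMap.smulRight_apply, smul_apply] at this
  rw [← this]
  simp only [lapF0C, h.hessC_eq hy hv, pd_eq, smul_eq_mul]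

theorem lapF2C_eq (h : IsMetricOn U G) (hy : y ∈ U) (hb : IsFrame (metricL G y) b)
    {f : E n → ℝ} {k : Fin n → Fin n → E n → ℝ}
    {k' : E n → E n →L[ℝ] E n →L[ℝ] ℝ} (hs : ContDiffOn ℝ ∞ k' U)
    (hk : ∀ z ∈ U, ∀ i j, k i j z = k' z (sv i) (sv j)) (i j : Fin n) :
    lapF2C G f k i j y
      = ∑ s, nabla (connL G) (nabla (connL G) k') y (b s) (b s) (sv i) (sv j)
        - nabla (connL G) k' y (invL G y (fderiv ℝ f y)) (sv i) (sv j) := by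
  have hn := h.isLeviCivita.smooth_nabla hs
  have h2 : ∀ z ∈ U, ∀ a i j, cov2 G k a i j z = nabla (connL G) k' z (sv a) (sv i) (sv j) :=
    fun z hz => h.cov2_eq hz (h.isLeviCivita.differentiableAt hz hs) hk
  have h3 := h.cov3_eq hy (h.isLeviCivita.differentiableAt hy hn) h2
  have h4 := h.sum_inv_eq hy hb (nabla (connL G) (nabla (connL G) k') y
    - (fderiv ℝ f y).smulRight (nabla (connL G) k' y))
  have h5 := congrArg (fun L => L (sv i) (sv j)) h4
  simp only [sub_apply, ContinuousLinearMap.smulRight_apply, smul_apply, sum_apply] at h5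
  rw [← h.sum_frame_smul hy hb]
  simp only [sum_apply, smul_apply]
  rw [← Finset.sum_sub_distrib, ← h5]
  simp only [lapF2C, h3, h2 y hy, pd_eq, smul_eq_mul]

theorem divF2C_eq (h : IsMetricOn U G) (hy : y ∈ U) (hb : IsFrame (metricL G y) b)
    {f : E n → ℝ} {k : Fin n → Fin n → E n → ℝ}
    {k' : E n → E n →L[ℝ] E n →L[ℝ] ℝ} (hs : ContDiffOn ℝ ∞ k' U)
    (hk : ∀ z ∈ U, ∀ i j, k i j z = k' z (sv i) (sv j)) (i : Fin n) :
    divF2C G f k i y = ∑ s, nabla (connL G) k' y (b s) (sv i) (b s)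
      - k' y (sv i) (invL G y (fderiv ℝ f y)) := by
  have h2 := h.cov2_eq hy (h.isLeviCivita.differentiableAt hy hs) hk
  rw [← h.sum_frame_smul hy hb, ← Finset.sum_sub_distrib]
  have := h.sum_inv_eq hy hb ((nabla (connL G) k' y).flip (sv i)
    - (fderiv ℝ f y).smulRight (k' y (sv i)))
  simp only [sub_apply, ContinuousLinearMap.smulRight_apply, smul_apply,
    ContinuousLinearMap.flip_apply] at this
  rw [← this, divF2C, Finset.sum_comm]
  simp only [h2, hk y hy, pd_eq, smul_eq_mul]
  refine Finset.sum_congr rfl fun a _ => Finset.sum_congr rfl fun c _ => ?_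
  rw [h.inv_symm hy]
  ring

end IsMetricOn

end Bridge

/-! ### Tensor fields on the manifold in charts, and independence of the chart -/

section Charts

variable {n : ℕ} {M : Type*} [TopologicalSpace M] [ChartedSpace (E n) M]

/-- The differential of the inverse of the chart at `p`. -/
def dsym (p : M) (y : E n) : E n →L[ℝ] TangentSpace (𝓡 n) ((chartAt (E n) p).symm y) :=
  mfderiv (𝓡 n) (𝓡 n) (chartAt (E n) p).symm y

theorem coordVec_eq (p : M) (i : Fin n) (y : E n) : coordVec p i y = dsym p y (sv i) := rfl

/-- The transition map from the chart at `q` to the chart at `p`. -/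
def trans (q p : M) (y : E n) : E n := chartAt (E n) p ((chartAt (E n) q).symm y)

/-- The domain of the transition map from the chart at `q` to the chart at `p`. -/
def transDom (q p : M) : Set (E n) :=
  (chartAt (E n) q).target ∩ (chartAt (E n) q).symm ⁻¹' (chartAt (E n) p).source

theorem isOpen_transDom (q p : M) : IsOpen (transDom (n := n) q p) :=
  (chartAt (E n) q).isOpen_inter_preimage_symm (chartAt (E n) p).open_source

theorem mapsTo_trans (q p : M) :
    Set.MapsTo (trans q p) (transDom (n := n) q p) (chartAt (E n) p).target :=
  fun _ hy => (chartAt (E n) p).map_source hy.2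

theorem symm_trans {q p : M} {y : E n} (hy : y ∈ transDom q p) :
    (chartAt (E n) p).symm (trans q p y) = (chartAt (E n) q).symm y :=
  (chartAt (E n) p).left_inv hy.2

theorem coord_mem_target (x : M) : coord x ∈ (chartAt (E n) x).target :=
  mem_chart_target (E n) x

@[simp] theorem symm_coord (x : M) : (chartAt (E n) x).symm (coord x) = x :=
  (chartAt (E n) x).left_inv (mem_chart_source (E n) x)

theorem mem_transDom_self {q : M} {y : E n} (hy : y ∈ (chartAt (E n) q).target) :
    y ∈ transDom q ((chartAt (E n) q).symm y) :=
  ⟨hy, mem_chart_source (E n) _⟩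

theorem comp0_trans (u : M → ℝ) {q p : M} {y : E n} (hy : y ∈ transDom q p) :
    comp0 u q y = comp0 u p (trans q p y) := by
  rw [comp0, comp0, symm_trans hy]

variable [IsManifold (𝓡 n) ∞ M]

theorem contDiffOn_trans (q p : M) : ContDiffOn ℝ ∞ (trans q p) (transDom (n := n) q p) := by
  rw [← contMDiffOn_iff_contDiffOn]
  exact (contMDiffOn_chart (I := 𝓡 n) (n := ∞) (x := p)).comp
    ((contMDiffOn_chart_symm (I := 𝓡 n) (n := ∞) (x := q)).mono Set.inter_subset_left)
    (fun y hy => hy.2)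

theorem isManifold_one : IsManifold (𝓡 n) 1 M := IsManifold.of_le (n := ∞) (by simp)

/-- The content is the chain rule. The two base points are equal by `symm_trans` but not
definitionally, hence `HEq`. -/
theorem dsym_eq {q p : M} {y : E n} (hy : y ∈ transDom q p) (v : E n) :
    HEq (dsym q y v) (dsym p (trans q p y) (fderiv ℝ (trans q p) y v)) := by
  have : IsManifold (𝓡 n) 1 M := isManifold_one
  have hE : (chartAt (E n) q).symm =ᶠ[nhds y] (chartAt (E n) p).symm ∘ trans q p :=
    Filter.mem_of_superset ((isOpen_transDom q p).mem_nhds hy) fun z hz => (symm_trans hz).symm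
  have h1 : MDifferentiableAt (𝓡 n) (𝓡 n) (chartAt (E n) p).symm (trans q p y) :=
    mdifferentiableAt_atlas_symm (chart_mem_atlas _ p) (mapsTo_trans q p hy)
  have h2 : MDifferentiableAt (𝓡 n) (𝓡 n) (trans q p) y :=
    (((contDiffOn_trans q p).contDiffAt ((isOpen_transDom q p).mem_nhds hy)).differentiableAt
      (by simp)).mdifferentiableAt
  have h3 : HasMFDerivAt (𝓡 n) (𝓡 n) (chartAt (E n) q).symm y _ :=
    (h1.hasMFDerivAt.comp y h2.hasMFDerivAt).congr_of_eventuallyEq hE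
  have h4 := h3.mfderiv
  rw [dsym, h4, mfderiv_eq_fderiv]
  rfl

theorem coordCovec_dsym {q p : M} {y : E n} (hy : y ∈ transDom q p) (v : E n) :
    (mfderiv (𝓡 n) (𝓡 n) (chartAt (E n) p) ((chartAt (E n) q).symm y) (dsym q y v) : E n)
      = fderiv ℝ (trans q p) y v := by
  have : IsManifold (𝓡 n) 1 M := isManifold_one
  have h1 : MDifferentiableAt (𝓡 n) (𝓡 n) (chartAt (E n) q).symm y :=
    mdifferentiableAt_atlas_symm (chart_mem_atlas _ q) hy.1
  have h2 : MDifferentiableAt (𝓡 n) (𝓡 n) (chartAt (E n) p) ((chartAt (E n) q).symm y) :=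
    mdifferentiableAt_atlas (chart_mem_atlas _ p) hy.2
  have h3 := (h2.hasMFDerivAt.comp y h1.hasMFDerivAt).mfderiv
  have h4 : mfderiv (𝓡 n) (𝓡 n) (chartAt (E n) p ∘ (chartAt (E n) q).symm) y
    = fderiv ℝ (trans q p) y := mfderiv_eq_fderiv
  rw [← h4, h3]
  rfl

theorem dsym_injective {p : M} {y : E n} (hy : y ∈ (chartAt (E n) p).target) :
    Function.Injective (dsym p y) := by
  have : IsManifold (𝓡 n) 1 M := isManifold_one
  exact (mdifferentiable_of_mem_atlas (I := 𝓡 n) (chart_mem_atlas _ p)).symm.mfderiv_injective hy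

theorem comp2_trans (h : Tensor2 n M) {q p : M} {y : E n} (hy : y ∈ transDom q p) (u v : E n) :
    h _ (dsym q y u) (dsym q y v)
      = h _ (dsym p (trans q p y) (fderiv ℝ (trans q p) y u))
        (dsym p (trans q p y) (fderiv ℝ (trans q p) y v)) := by
  have h1 := symm_trans hy
  have key : ∀ (x x' : M) (_ : x = x') (a b : TangentSpace (𝓡 n) x)
      (a' b' : TangentSpace (𝓡 n) x'), HEq a a' → HEq b b' → h x a b = h x' a' b' := by
    rintro x _ rfl a b a' b' ha hb
    rw [eq_of_heq ha, eq_of_heq hb]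
  exact key _ _ h1.symm _ _ _ _ (dsym_eq hy u) (dsym_eq hy v)

/-- The components in the chart at `q` of a tensor field that is given by its components in the
charts at the various points. -/
theorem comp2_ofComp2 (A : M → Fin n → Fin n → ℝ) (B : M → E n →L[ℝ] E n →L[ℝ] ℝ)
    (hAB : ∀ x i j, A x i j = B x (sv i) (sv j)) {q : M} {y : E n}
    (hy : y ∈ (chartAt (E n) q).target) (i j : Fin n) :
    comp2 (fun x => ofComp2 x (A x)) q i j y
      = B ((chartAt (E n) q).symm y) (fderiv ℝ (trans q ((chartAt (E n) q).symm y)) y (sv i))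
          (fderiv ℝ (trans q ((chartAt (E n) q).symm y)) y (sv j)) := by
  set x := (chartAt (E n) q).symm y with hx
  have hy' : y ∈ transDom q x := mem_transDom_self hy
  have h1 : ∀ i a, coordCovec x a (coordVec q i y) = fderiv ℝ (trans q x) y (sv i) a := by
    intro i a
    rw [← coordCovec_dsym hy']
    rfl
  have h2 : comp2 (fun x => ofComp2 x (A x)) q i j y
      = ∑ a, ∑ b, A x a b * (coordCovec x a (coordVec q i y) * coordCovec x b (coordVec q j y)) := by
    simp only [comp2, ofComp2]
    rw [← hx]
    simp only [sum_apply, smul_apply, ContinuousLinearMap.smulRight_apply, smul_eq_mul]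
  rw [h2, ← sum_sv (fderiv ℝ (trans q x) y (sv i)), ← sum_sv (fderiv ℝ (trans q x) y (sv j))]
  simp only [h1, hAB, map_sum, map_smul, sum_apply, smul_apply, smul_eq_mul, Finset.mul_sum]
  rw [Finset.sum_comm]
  refine Finset.sum_congr rfl fun a _ => Finset.sum_congr rfl fun b _ => ?_
  ring

theorem metricL_gram (g : Metric n M) (p : M) (y : E n) (u v : E n) :
    metricL (gram g p) y u v = g.inner _ (dsym p y u) (dsym p y v) := by
  conv_rhs => rw [← sum_sv u, ← sum_sv v]
  rw [metricL_apply]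
  simp only [map_sum, map_smul, sum_apply, smul_apply, smul_eq_mul, Finset.mul_sum]
  rw [Finset.sum_comm]
  refine Finset.sum_congr rfl fun a _ => Finset.sum_congr rfl fun b _ => ?_
  simp only [gram, comp2, Matrix.of_apply, coordVec_eq]
  ring

/-- A coordinate field is the tangent map of the smooth inverse chart applied to a constant vector
field. This gives the smoothness of `g_ij`. -/
theorem contMDiffOn_coordVec (p : M) (i : Fin n) :
    ContMDiffOn (𝓡 n) (𝓡 n).tangent ∞
      (fun y => (⟨(chartAt (E n) p).symm y, coordVec p i y⟩ : TangentBundle (𝓡 n) M))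
      (chartAt (E n) p).target := by
  have : IsManifold (𝓡 n) 1 M := isManifold_one
  have h1 : ContMDiff (𝓡 n) (𝓡 n).tangent ∞
      (fun y : E n => (⟨y, sv i⟩ : TangentBundle (𝓡 n) (E n))) :=
    contMDiff_vectorSpace_iff_contDiff.2 contDiff_const
  have h2 := (contMDiffOn_chart_symm (I := 𝓡 n) (n := ∞) (x := p)).contMDiffOn_tangentMapWithin
    (m := ∞) (by simp) (chartAt (E n) p).open_target.uniqueMDiffOn
  refine (h2.comp h1.contMDiffOn (fun y hy => hy)).congr fun y hy => ?_
  simp only [Function.comp_apply, tangentMapWithin,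
    mfderivWithin_of_isOpen (chartAt (E n) p).open_target hy]
  rfl

theorem isMetricOn_gram (g : Metric n M) (p : M) :
    IsMetricOn (chartAt (E n) p).target (gram g p) where
  isOpen := (chartAt (E n) p).open_target
  smooth i j := by
    rw [← contMDiffOn_iff_contDiffOn]
    have h1 := g.contMDiff.comp_contMDiffOn
      (contMDiffOn_chart_symm (I := 𝓡 n) (n := ∞) (x := p))
    have h2 := ContMDiffOn.clm_bundle_apply₂ (F₁ := E n) (F₂ := E n) (F₃ := ℝ)
      (E₃ := fun _ => ℝ) (b := (chartAt (E n) p).symm)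
      (ψ := fun y => g.inner ((chartAt (E n) p).symm y)) h1
      (contMDiffOn_coordVec p i) (contMDiffOn_coordVec p j)
    intro y hy
    exact (Bundle.contMDiffWithinAt_totalSpace.1 (h2 y hy)).2
  posDef y hy := by
    refine Matrix.PosDef.of_dotProduct_mulVec_pos ?_ ?_
    · ext i j
      simp only [gram, comp2, Matrix.conjTranspose_apply, Matrix.of_apply, star_trivial]
      exact g.symm _ _ _
    · intro x hx
      have h1 : dsym p y (WithLp.toLp 2 x) ≠ 0 := by
        intro h0
        apply hx
        have := dsym_injective hy (h0.trans (map_zero _).symm)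
        simpa using this
      have h2 := g.pos _ _ h1
      rw [← metricL_gram, metricL_apply] at h2
      refine lt_of_lt_of_eq h2 ?_
      simp only [dotProduct, Matrix.mulVec, star_trivial, Finset.mul_sum]
      exact Finset.sum_congr rfl fun i _ => Finset.sum_congr rfl fun j _ => by ring

theorem IsMetricOn.mono {U U' : Set (E n)} {G : E n → Matrix (Fin n) (Fin n) ℝ}
    (h : IsMetricOn U G) (hU' : IsOpen U') (hs : U' ⊆ U) : IsMetricOn U' G :=
  ⟨hU', fun i j => (h.smooth i j).mono hs, fun y hy => h.posDef y (hs hy)⟩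

theorem isMetricOn_transDom (g : Metric n M) (q p : M) : IsMetricOn (transDom q p) (gram g q) :=
  (isMetricOn_gram g q).mono (isOpen_transDom q p) Set.inter_subset_left

/-- Both Gram matrices represent the same metric, so the results on isometries apply to every change
of chart. All independence of the chart comes from here. -/
theorem isIsometricOn_trans (g : Metric n M) (q p : M) :
    IsIsometricOn (transDom q p) (chartAt (E n) p).target (metricL (gram g q))
      (metricL (gram g p)) (trans q p) where
  smooth := contDiffOn_trans q p
  mapsTo := mapsTo_trans q p
  isom z hz u v := by
    rw [metricL_gram, metricL_gram]
    exact comp2_trans g.inner hz u v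

variable {g : Metric n M} {p q : M} {y : E n}

/-- The components of the Ricci tensor. -/
theorem comp2_ricci (hy : y ∈ (chartAt (E n) q).target) (i j : Fin n) :
    comp2 (ricci g) q i j y = ric (eb n) (connL (gram g q)) y (sv i) (sv j) := by
  -- The Ricci tensor at the point with coordinates `y` is computed in the chart at that point and
  -- pulled back by the transition map; invariance under isometries brings it back to the chart at
  -- `q`.
  have h1 := comp2_ofComp2 (fun x i j => ricC (gram g x) i j (coord x))
    (fun x => ric (eb n) (connL (gram g x)) (coord x))
    (fun x i j => (isMetricOn_gram g x).ricC_eq (coord_mem_target x) i j) hy i j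
  refine h1.trans ?_
  rw [(isIsometricOn_trans g q ((chartAt (E n) q).symm y)).ric
    (isMetricOn_transDom g q _).isLeviCivita (isMetricOn_gram g _).isLeviCivita (eb n)
    (mem_transDom_self hy)]
  rfl

theorem contDiffOn_comp0 {v : M → ℝ} (hv : ContMDiff (𝓡 n) 𝓘(ℝ, ℝ) ∞ v) (p : M) :
    ContDiffOn ℝ ∞ (comp0 v p) (chartAt (E n) p).target := by
  rw [← contMDiffOn_iff_contDiffOn]
  exact hv.comp_contMDiffOn (contMDiffOn_chart_symm (I := 𝓡 n) (n := ∞) (x := p))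

theorem nabla_fderiv_trans {v : M → ℝ} (hv : ContMDiff (𝓡 n) 𝓘(ℝ, ℝ) ∞ v)
    (hy : y ∈ transDom q p) (a b : E n) :
    nabla (connL (gram g q)) (fderiv ℝ (comp0 v q)) y a b
      = nabla (connL (gram g p)) (fderiv ℝ (comp0 v p)) (trans q p y)
        (fderiv ℝ (trans q p) y a) (fderiv ℝ (trans q p) y b) := by
  have h0 := (isMetricOn_transDom g q p).isLeviCivita
  rw [← (isIsometricOn_trans g q p).hess h0 (isMetricOn_gram g p).isLeviCivita hy
    (contDiffOn_comp0 hv p)]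
  rw [h0.nabla_congr_on hy (S := fderiv ℝ fun w => comp0 v p (trans q p w))]
  intro z hz
  have hE : comp0 v q =ᶠ[nhds z] fun w => comp0 v p (trans q p w) :=
    Filter.mem_of_superset ((isOpen_transDom q p).mem_nhds hz) fun w hw => comp0_trans v hw
  exact hE.fderiv_eq

theorem fderiv_comp0_trans {v : M → ℝ} (hv : ContMDiff (𝓡 n) 𝓘(ℝ, ℝ) ∞ v)
    (hy : y ∈ transDom q p) (a : E n) :
    fderiv ℝ (comp0 v q) y a = fderiv ℝ (comp0 v p) (trans q p y) (fderiv ℝ (trans q p) y a) := by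
  have hE : comp0 v q =ᶠ[nhds y] fun w => comp0 v p (trans q p w) :=
    Filter.mem_of_superset ((isOpen_transDom q p).mem_nhds hy) fun w hw => comp0_trans v hw
  have h1 := (((contDiffOn_comp0 hv p).contDiffAt ((chartAt (E n) p).open_target.mem_nhds
    (mapsTo_trans q p hy))).differentiableAt (by simp)).hasFDerivAt
  have h2 := (((contDiffOn_trans q p).contDiffAt ((isOpen_transDom q p).mem_nhds
    hy)).differentiableAt (by simp)).hasFDerivAt
  rw [hE.fderiv_eq]
  have h3 : fderiv ℝ (fun w => comp0 v p (trans q p w)) y = _ := (h1.comp y h2).fderiv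
  rw [h3]
  rfl

/-- The components of the Hessian of a function. -/
theorem comp2_hess {v : M → ℝ} (hv : ContMDiff (𝓡 n) 𝓘(ℝ, ℝ) ∞ v)
    (hy : y ∈ (chartAt (E n) q).target) (i j : Fin n) :
    comp2 (hess g v) q i j y
      = nabla (connL (gram g q)) (fderiv ℝ (comp0 v q)) y (sv i) (sv j) := by
  have h1 := comp2_ofComp2 (fun x i j => hessC (gram g x) (comp0 v x) i j (coord x))
    (fun x => nabla (connL (gram g x)) (fderiv ℝ (comp0 v x)) (coord x))
    (fun x i j => (isMetricOn_gram g x).hessC_eq (coord_mem_target x) (contDiffOn_comp0 hv x) i j)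
    hy i j
  refine h1.trans ?_
  rw [nabla_fderiv_trans hv (mem_transDom_self hy)]
  rfl

/-- `Δ_f v` in any chart. -/
theorem lapF0_eq {f v : M → ℝ} (hf : ContMDiff (𝓡 n) 𝓘(ℝ, ℝ) ∞ f)
    (hv : ContMDiff (𝓡 n) 𝓘(ℝ, ℝ) ∞ v) (hy : y ∈ (chartAt (E n) q).target) :
    lapF0 g f v ((chartAt (E n) q).symm y) = lapF0C (gram g q) (comp0 f q) (comp0 v q) y := by
  set x := (chartAt (E n) q).symm y with hx
  have hy' : y ∈ transDom q x := mem_transDom_self hy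
  have hq := isMetricOn_gram g q
  have hp := isMetricOn_gram g x
  obtain ⟨b, hb⟩ := hq.isLeviCivita.exists_frame hy
  have hb' := (isIsometricOn_trans g q x).isFrame (isMetricOn_transDom g q x).isLeviCivita hy' hb
  rw [lapF0, hp.lapF0C_eq (coord_mem_target x) hb' (contDiffOn_comp0 hv x),
    hq.lapF0C_eq hy hb (contDiffOn_comp0 hv q), ← hq.sum_frame_smul hy hb,
    ← hp.sum_frame_smul (coord_mem_target x) hb']
  simp only [nabla_fderiv_trans (g := g) hv hy', fderiv_comp0_trans hv hy',
    fderiv_comp0_trans hf hy']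
  rfl

/-- The scalar curvature in any chart. -/
theorem scal_eq (hy : y ∈ (chartAt (E n) q).target) :
    scal g ((chartAt (E n) q).symm y)
      = IsLeviCivita.scalar (eb n) (invL (gram g q)) (connL (gram g q)) y := by
  set x := (chartAt (E n) q).symm y with hx
  have hy' : y ∈ transDom q x := mem_transDom_self hy
  have hq := isMetricOn_gram g q
  have hp := isMetricOn_gram g x
  obtain ⟨b, hb⟩ := hq.isLeviCivita.exists_frame hy
  have hb' := (isIsometricOn_trans g q x).isFrame (isMetricOn_transDom g q x).isLeviCivita hy' hb
  rw [scal, hp.trC_eq (coord_mem_target x) hb' (comp2_ricci (coord_mem_target x)),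
    IsLeviCivita.scalar, hq.isLeviCivita.mtr_eq_sum (eb n) hy hb]
  refine Finset.sum_congr rfl fun i _ => ?_
  rw [(isIsometricOn_trans g q x).ric (isMetricOn_transDom g q x).isLeviCivita hp.isLeviCivita
    (eb n) hy']
  rfl

theorem contMDiff_of_comp0 {u : M → ℝ}
    (hu : ∀ p : M, ContDiffOn ℝ ∞ (comp0 u p) (chartAt (E n) p).target) :
    ContMDiff (𝓡 n) 𝓘(ℝ, ℝ) ∞ u := by
  intro x
  have h1 : ContMDiffAt (𝓡 n) 𝓘(ℝ, ℝ) ∞ (comp0 u x) (chartAt (E n) x x) :=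
    (((hu x).contDiffAt ((chartAt (E n) x).open_target.mem_nhds
      (coord_mem_target x)))).contMDiffAt
  have h2 : ContMDiffAt (𝓡 n) (𝓡 n) ∞ (chartAt (E n) x) x :=
    (contMDiffOn_chart (I := 𝓡 n) (n := ∞) (x := x)).contMDiffAt
      ((chartAt (E n) x).open_source.mem_nhds (mem_chart_source _ x))
  refine (h1.comp x h2).congr_of_eventuallyEq ?_
  refine Filter.mem_of_superset ((chartAt (E n) x).open_source.mem_nhds (mem_chart_source _ x))
    fun z hz => ?_
  simp only [Set.mem_ofPred_eq, Function.comp_apply, comp0, (chartAt (E n) x).left_inv hz]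

theorem contMDiff_scal (g : Metric n M) : ContMDiff (𝓡 n) 𝓘(ℝ, ℝ) ∞ (scal g) :=
  contMDiff_of_comp0 fun p => by
    have h := (isMetricOn_gram g p).isLeviCivita
    exact (h.smooth_mtr (eb n) (h.smooth_ric (eb n))).congr fun y hy => scal_eq hy

/-- The soliton equation in a chart. -/
theorem isSoliton_of_shrinker {f : M → ℝ} {τ : ℝ} (h : IsGradientShrinker g f τ) (p : M) :
    IsLeviCivita.IsSoliton (chartAt (E n) p).target (metricL (gram g p)) (connL (gram g p)) (eb n)
      (comp0 f p) (1 / (2 * τ)) := by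
  refine ⟨contDiffOn_comp0 h.smooth p, fun z hz => ?_⟩
  refine clm_ext_sv fun i => clm_ext_sv fun j => ?_
  have h1 := congrArg (fun k => comp2 k p i j z) h.soliton
  have h2 : comp2 (ricci g + hess g f) p i j z
      = comp2 (ricci g) p i j z + comp2 (hess g f) p i j z := rfl
  have h3 : comp2 ((1 / (2 * τ)) • (g.inner : Tensor2 n M)) p i j z
      = (1 / (2 * τ)) * gram g p z i j := rfl
  simp only [h2, h3, comp2_ricci hz, comp2_hess h.smooth hz] at h1
  simpa using h1

end Charts

/-! ### Second derivatives at a maximum; the Bochner formula on a soliton -/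

section Local

variable {V : Type*} [NormedAddCommGroup V] [NormedSpace ℝ V]
  {U : Set V} {g : V → V →L[ℝ] V →L[ℝ] ℝ} {γ : V → (V →L[ℝ] ℝ) →L[ℝ] V}
  {Γ : V → V →L[ℝ] V →L[ℝ] V} {y : V} {f v : V → ℝ} {c : ℝ}

/-- Restrict to a line. A positive second derivative at the critical point would make it a local
minimum as well, so the restriction would be locally constant and its second derivative zero. -/
theorem sndDeriv_nonpos_of_isLocalMax {u : V → ℝ} (hu : ContDiffAt ℝ ∞ u y)
    (hm : IsLocalMax u y) (w : V) : fderiv ℝ (fderiv ℝ u) y w w ≤ 0 := by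
  by_contra! hpos
  set l : ℝ → V := fun t => y + t • w with hl
  have hl0 : l 0 = y := by simp [hl]
  have hld : ∀ t, HasDerivAt l w t := fun t => by
    have := ((hasDerivAt_id t).smul_const w).const_add y
    rwa [one_smul] at this
  have hlc : Filter.Tendsto l (nhds 0) (nhds y) := by
    rw [← hl0]
    exact (hld 0).continuousAt
  have hev : ∀ᶠ z in nhds y, ContDiffAt ℝ 2 u z :=
    (hu.of_le (m := 2) (WithTop.coe_le_coe.2 (le_top : (2 : ℕ∞) ≤ ⊤))).eventually (by simp)
  have h1 : ∀ᶠ t in nhds (0 : ℝ), deriv (u ∘ l) t = fderiv ℝ u (l t) w := by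
    filter_upwards [hlc.eventually hev] with t ht
    exact ((ht.differentiableAt (by simp)).hasFDerivAt.comp_hasDerivAt t (hld t)).deriv
  have h2 : deriv (deriv (u ∘ l)) 0 = fderiv ℝ (fderiv ℝ u) y w w := by
    rw [Filter.EventuallyEq.deriv_eq h1]
    have h3 : HasFDerivAt (fderiv ℝ u) (fderiv ℝ (fderiv ℝ u) y) (l 0) := by
      rw [hl0]
      exact ((hu.fderiv_right (m := ∞) (by simp)).differentiableAt (by simp)).hasFDerivAt
    have h4 := (h3.comp_hasDerivAt 0 (hld 0)).clm_apply (hasDerivAt_const (0 : ℝ) w)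
    have h5 : deriv (fun t => fderiv ℝ u (l t) w) 0 = _ := h4.deriv
    rw [h5]
    simp
  have hmax : IsLocalMax (u ∘ l) 0 := by
    have := hlc.eventually hm
    filter_upwards [this] with t ht
    simpa [hl0] using ht
  have hd1 : deriv (u ∘ l) 0 = 0 := hmax.deriv_eq_zero
  have hc : ContinuousAt (u ∘ l) 0 :=
    ContinuousAt.comp (by rw [hl0]; exact hu.continuousAt) (hld 0).continuousAt
  have hmin := isLocalMin_of_deriv_deriv_pos (by rw [h2]; exact hpos) hd1 hc
  have hconst : (u ∘ l) =ᶠ[nhds 0] fun _ => (u ∘ l) 0 := by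
    filter_upwards [hmin, hmax] with t h3 h4
    exact le_antisymm h4 h3
  have h6 : deriv (u ∘ l) =ᶠ[nhds 0] fun _ => 0 := by
    filter_upwards [hconst.eventuallyEq_nhds] with t ht
    rw [ht.deriv_eq]
    simp
  rw [h6.deriv_eq] at h2
  simp at h2
  linarith

namespace IsLeviCivita

theorem hess_nonpos_of_isLocalMax (h : IsLeviCivita U g γ Γ) (hy : y ∈ U)
    (hv : ContDiffOn ℝ ∞ v U) (hm : IsLocalMax v y) (w : V) :
    nabla Γ (fderiv ℝ v) y w w ≤ 0 := by
  have h1 := sndDeriv_nonpos_of_isLocalMax (hv.contDiffAt (h.mem_nhds hy)) hm w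
  simpa [nabla_apply, hm.fderiv_eq_zero] using h1

theorem nabla_fderiv_exp (h : IsLeviCivita U g γ Γ) (hy : y ∈ U) (hv : ContDiffOn ℝ ∞ v U)
    (K : ℝ) (a b : V) : nabla Γ (fderiv ℝ fun z => Real.exp (K * v z)) y a b
      = K * Real.exp (K * v y) * (nabla Γ (fderiv ℝ v) y a b
        + K * (fderiv ℝ v y a * fderiv ℝ v y b)) := by
  have hd : ∀ z ∈ U, HasFDerivAt (fun z => Real.exp (K * v z))
      (Real.exp (K * v z) • K • fderiv ℝ v z) z := fun z hz =>
    ((h.differentiableAt hz hv).hasFDerivAt.const_mul K).exp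
  have h1 := (hd y hy).smul
    ((h.differentiableAt hy (h.smooth_fderiv hv)).hasFDerivAt.const_smul K)
  have h2 : fderiv ℝ (fun z => Real.exp (K * v z) • K • fderiv ℝ v z) y = _ := h1.fderiv
  rw [h.nabla_congr_on hy fun z hz => (hd z hz).fderiv, nabla_apply, nabla_apply, h2]
  simp
  ring

variable {ι : Type*} [Fintype ι] {b : ι → V}

theorem inv_apply_eq_sum (h : IsLeviCivita U g γ Γ) (hy : y ∈ U) (hb : IsFrame (g y) b)
    (φ ψ : V →L[ℝ] ℝ) : ψ (γ y φ) = ∑ i, φ (b i) * ψ (b i) := by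
  rw [← hb.apply ψ]
  simp only [h.metric_inv_apply hy, smul_eq_mul]

theorem nabla_normSq (h : IsLeviCivita U g γ Γ) (hy : y ∈ U) (hv : ContDiffOn ℝ ∞ v U) (u : V) :
    fderiv ℝ (fun z => fderiv ℝ v z (γ z (fderiv ℝ v z))) y u
      = 2 * nabla Γ (fderiv ℝ v) y u (γ y (fderiv ℝ v y)) := by
  have := nabla_clm_apply (Γ := Γ) (h.differentiableAt hy (h.smooth_fderiv hv))
    (h.differentiableAt hy (h.smooth_grad hv)) u
  rw [nabla_apply, act_real, add_zero, h.nabla_grad hy hv] at this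
  rw [this, ← h.metric_inv_apply hy (fderiv ℝ v y) (γ y (nabla Γ _ y u)), h.symm y hy,
    h.metric_inv y hy]
  ring

variable [FiniteDimensional ℝ V] {κ : Type*} [Fintype κ] {e : Module.Basis κ ℝ V}

/-- On a soliton, the Bochner formula for eigenfunctions `Δ_f v = -c v` reads
`Δ_f |∇v|² = 2 |∇²v|²`. -/
theorem bochner_soliton (h : IsLeviCivita U g γ Γ) (hs : IsSoliton U g Γ e f c) (hy : y ∈ U)
    (hb : IsFrame (g y) b) (hv : ContDiffOn ℝ ∞ v U)
    (heq : ∀ z ∈ U, mtr e γ (nabla Γ (fderiv ℝ v)) z - fderiv ℝ v z (γ z (fderiv ℝ f z))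
      = -(c * v z)) :
    ∑ i, nabla Γ (fderiv ℝ fun z => fderiv ℝ v z (γ z (fderiv ℝ v z))) y (b i) (b i)
      - fderiv ℝ (fun z => fderiv ℝ v z (γ z (fderiv ℝ v z))) y (γ y (fderiv ℝ f y))
      = 2 * ∑ i, nabla Γ (fderiv ℝ v) y (b i) (γ y (nabla Γ (fderiv ℝ v) y (b i))) := by
  rw [h.bochner (e := e) hy hb hv, h.nabla_normSq hy hv]
  set X := γ y (fderiv ℝ v y) with hX
  -- Differentiate `Δv = dv(∇f) - c v` along `X = ∇v`. As `∇∇f = c - Rc`, the two terms with `c`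
  -- cancel; the Ricci term then cancels the one in Bochner's formula, and the Hessian term the
  -- drift. This needs the eigenvalue to be the soliton constant.
  have h1 : fderiv ℝ (mtr e γ (nabla Γ (fderiv ℝ v))) y X
      = nabla Γ (fderiv ℝ v) y (γ y (fderiv ℝ f y)) X - ric e Γ y X X := by
    have hE : mtr e γ (nabla Γ (fderiv ℝ v))
        =ᶠ[nhds y] fun z => fderiv ℝ v z (γ z (fderiv ℝ f z)) - c * v z :=
      Filter.mem_of_superset (h.mem_nhds hy) fun z hz => by
        have := heq z hz
        show mtr e γ (nabla Γ (fderiv ℝ v)) z = _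
        linarith
    have hd := h.differentiableAt hy ((h.smooth_fderiv hv).clm_apply (h.smooth_grad hs.1))
    have h2 := nabla_clm_apply (Γ := Γ) (h.differentiableAt hy (h.smooth_fderiv hv))
      (h.differentiableAt hy (h.smooth_grad hs.1)) X
    rw [nabla_apply, act_real, add_zero, h.nabla_grad_potential hs hy] at h2
    have h3 := (h.differentiableAt hy hv).hasFDerivAt.const_mul c
    have h4 := (hd.hasFDerivAt.sub h3).fderiv
    have h5 : fderiv ℝ (fun z => fderiv ℝ v z (γ z (fderiv ℝ f z)) - c * v z) y = _ := h4
    rw [hE.fderiv_eq, h5, sub_apply, h2]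
    have h6 : fderiv ℝ v y (γ y (ric e Γ y X)) = ric e Γ y X X := by
      rw [← h.metric_inv_apply hy (fderiv ℝ v y), h.symm y hy, h.metric_inv y hy]
    rw [map_sub, h6, h.hess_symm hy hv X, map_smul, smul_apply, smul_eq_mul]
    ring
  rw [h1]
  ring

end IsLeviCivita

end Local

/-! ### The maximum principle and the equation `Δ_f v = -v/(2τ)` -/

section Global

variable {n : ℕ} {M : Type*} [TopologicalSpace M] [ChartedSpace (E n) M] [IsManifold (𝓡 n) ∞ M]
  {g : Metric n M} {f u v : M → ℝ} {τ : ℝ} {x : M}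

omit [IsManifold (𝓡 n) ∞ M] in
theorem isLocalMax_comp0 (hm : IsLocalMax u x) :
    IsLocalMax (comp0 (n := n) u x) (coord x) := by
  have hc : ContinuousAt (chartAt (E n) x).symm (coord x) :=
    (chartAt (E n) x).continuousAt_symm (coord_mem_target x)
  have h1 : Filter.Tendsto (chartAt (E n) x).symm (nhds (coord x)) (nhds x) := by
    simpa [ContinuousAt] using hc
  filter_upwards [h1.eventually hm] with z hz
  simpa [comp0] using hz

/-- The weak maximum principle. -/
theorem lapF0_nonpos_of_isLocalMax (hu : ContMDiff (𝓡 n) 𝓘(ℝ, ℝ) ∞ u) (hm : IsLocalMax u x) :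
    lapF0 g f u x ≤ 0 := by
  have hg := isMetricOn_gram g x
  have hx := coord_mem_target (n := n) x
  obtain ⟨b, hb⟩ := hg.isLeviCivita.exists_frame hx
  have hm' := isLocalMax_comp0 (n := n) hm
  rw [lapF0, hg.lapF0C_eq hx hb (contDiffOn_comp0 hu x), hm'.fderiv_eq_zero]
  simp only [zero_apply, sub_zero]
  exact Finset.sum_nonpos fun i _ =>
    hg.isLeviCivita.hess_nonpos_of_isLocalMax hx (contDiffOn_comp0 hu x) hm' _

theorem lapF0_add (hu : ContMDiff (𝓡 n) 𝓘(ℝ, ℝ) ∞ u) (hv : ContMDiff (𝓡 n) 𝓘(ℝ, ℝ) ∞ v) (x : M) :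
    lapF0 g f (fun z => u z + v z) x = lapF0 g f u x + lapF0 g f v x := by
  have hg := isMetricOn_gram g x
  have h := hg.isLeviCivita
  have hx := coord_mem_target (n := n) x
  have hu' := contDiffOn_comp0 hu x
  have hv' := contDiffOn_comp0 hv x
  obtain ⟨b, hb⟩ := h.exists_frame hx
  have h1 : ∀ z ∈ (chartAt (E n) x).target, fderiv ℝ (comp0 (fun z => u z + v z) x) z
      = fderiv ℝ (comp0 u x) z + fderiv ℝ (comp0 v x) z := fun z hz =>
    fderiv_fun_add (h.differentiableAt hz hu') (h.differentiableAt hz hv')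
  have hw : ContDiffOn ℝ ∞ (comp0 (fun z => u z + v z) x) (chartAt (E n) x).target := hu'.add hv'
  rw [lapF0, lapF0, lapF0, hg.lapF0C_eq hx hb hw, hg.lapF0C_eq hx hb hu',
    hg.lapF0C_eq hx hb hv', h.nabla_congr_on hx h1, h1 _ hx,
    nabla_add (h.differentiableAt hx (h.smooth_fderiv hu'))
      (h.differentiableAt hx (h.smooth_fderiv hv'))]
  simp only [add_apply, Finset.sum_add_distrib]
  ring

theorem lapF0_const_mul (c : ℝ) (hu : ContMDiff (𝓡 n) 𝓘(ℝ, ℝ) ∞ u) (x : M) :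
    lapF0 g f (fun z => c * u z) x = c * lapF0 g f u x := by
  have hg := isMetricOn_gram g x
  have h := hg.isLeviCivita
  have hx := coord_mem_target (n := n) x
  have hu' := contDiffOn_comp0 hu x
  obtain ⟨b, hb⟩ := h.exists_frame hx
  have h1 : ∀ z ∈ (chartAt (E n) x).target, fderiv ℝ (comp0 (fun z => c * u z) x) z
      = c • fderiv ℝ (comp0 u x) z := fun z hz =>
    ((h.differentiableAt hz hu').hasFDerivAt.const_mul c).fderiv
  have hw : ContDiffOn ℝ ∞ (comp0 (fun z => c * u z) x) (chartAt (E n) x).target :=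
    contDiffOn_const.mul hu'
  rw [lapF0, lapF0, hg.lapF0C_eq hx hb hw, hg.lapF0C_eq hx hb hu',
    h.nabla_congr_on hx h1, h1 _ hx,
    nabla_const_smul c (h.differentiableAt hx (h.smooth_fderiv hu'))]
  simp only [smul_apply, smul_eq_mul, ← Finset.mul_sum]
  ring

theorem lapF0_zero (x : M) : lapF0 g f (fun _ => 0) x = 0 := by
  have := lapF0_const_mul (g := g) (f := f) 0 (u := fun _ => 0) contMDiff_const x
  simpa using this

theorem lapF0_nonneg_of_isLocalMin (hu : ContMDiff (𝓡 n) 𝓘(ℝ, ℝ) ∞ u) (hm : IsLocalMin u x) :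
    0 ≤ lapF0 g f u x := by
  have h1 := lapF0_nonpos_of_isLocalMax (g := g) (f := f) (u := fun z => -1 * u z)
    (contMDiff_const.mul hu) (x := x) (by simpa using hm.neg)
  rw [lapF0_const_mul _ hu] at h1
  linarith

/-- The squared norm of the gradient of a function. -/
def gradSq (g : Metric n M) (v : M → ℝ) (x : M) : ℝ :=
  fderiv ℝ (comp0 v x) (coord x) (invL (gram g x) (coord x) (fderiv ℝ (comp0 v x) (coord x)))

theorem gradSq_eq (hv : ContMDiff (𝓡 n) 𝓘(ℝ, ℝ) ∞ v) {q : M} {y : E n}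
    (hy : y ∈ (chartAt (E n) q).target) : gradSq g v ((chartAt (E n) q).symm y)
      = fderiv ℝ (comp0 v q) y (invL (gram g q) y (fderiv ℝ (comp0 v q) y)) := by
  set x := (chartAt (E n) q).symm y with hx
  have hy' : y ∈ transDom q x := mem_transDom_self hy
  have hq := isMetricOn_gram g q
  have hp := isMetricOn_gram g x
  obtain ⟨b, hb⟩ := hq.isLeviCivita.exists_frame hy
  have hb' := (isIsometricOn_trans g q x).isFrame (isMetricOn_transDom g q x).isLeviCivita hy' hb
  rw [gradSq, hp.isLeviCivita.inv_apply_eq_sum (coord_mem_target x) hb',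
    hq.isLeviCivita.inv_apply_eq_sum hy hb]
  simp only [fderiv_comp0_trans hv hy']
  rfl

theorem contMDiff_gradSq (g : Metric n M) (hv : ContMDiff (𝓡 n) 𝓘(ℝ, ℝ) ∞ v) :
    ContMDiff (𝓡 n) 𝓘(ℝ, ℝ) ∞ (gradSq g v) :=
  contMDiff_of_comp0 fun p => by
    have h := (isMetricOn_gram g p).isLeviCivita
    exact ((h.smooth_fderiv (contDiffOn_comp0 hv p)).clm_apply
      (h.smooth_grad (contDiffOn_comp0 hv p))).congr fun y hy => gradSq_eq hv hy

/-- The gradient term makes the exponential a barrier: for large `K` it dominates `Δ_f v` wherever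
`|∇v|²` is bounded below. -/
theorem lapF0_exp (hv : ContMDiff (𝓡 n) 𝓘(ℝ, ℝ) ∞ v) (K : ℝ) (x : M) :
    lapF0 g f (fun z => Real.exp (K * v z)) x
      = K * Real.exp (K * v x) * (lapF0 g f v x + K * gradSq g v x) := by
  have hg := isMetricOn_gram g x
  have h := hg.isLeviCivita
  have hx := coord_mem_target (n := n) x
  have hv' := contDiffOn_comp0 hv x
  obtain ⟨b, hb⟩ := h.exists_frame hx
  have hexp : ContDiffOn ℝ ∞ (comp0 (fun z => Real.exp (K * v z)) x) (chartAt (E n) x).target :=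
    (contDiffOn_const.mul hv').exp
  have hd : fderiv ℝ (comp0 (fun z => Real.exp (K * v z)) x) (coord x)
      = Real.exp (K * comp0 v x (coord x)) • K • fderiv ℝ (comp0 v x) (coord x) :=
    ((h.differentiableAt hx hv').hasFDerivAt.const_mul K).exp.fderiv
  have hn : ∀ a b, nabla (connL (gram g x))
      (fderiv ℝ (comp0 (fun z => Real.exp (K * v z)) x)) (coord x) a b = _ :=
    h.nabla_fderiv_exp hx hv' K
  have h0 : comp0 (n := n) v x (coord x) = v x := by simp [comp0]
  rw [lapF0, lapF0, hg.lapF0C_eq hx hb hexp, hg.lapF0C_eq hx hb hv', hd, gradSq,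
    h.inv_apply_eq_sum hx hb (fderiv ℝ (comp0 v x) (coord x))]
  simp only [hn, h0, smul_apply, smul_eq_mul, ← Finset.mul_sum, Finset.sum_add_distrib]
  ring

theorem lapF0_gradSq_nonneg (hs : IsGradientShrinker g f τ) (hv : ContMDiff (𝓡 n) 𝓘(ℝ, ℝ) ∞ v)
    (heq : ∀ x, lapF0 g f v x + v x / (2 * τ) = 0) (x : M) : 0 ≤ lapF0 g f (gradSq g v) x := by
  have hg := isMetricOn_gram g x
  have h := hg.isLeviCivita
  have hx := coord_mem_target (n := n) x
  have hv' := contDiffOn_comp0 hv x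
  obtain ⟨b, hb⟩ := h.exists_frame hx
  have hE : ∀ z ∈ (chartAt (E n) x).target, comp0 (gradSq g v) x z
      = fderiv ℝ (comp0 v x) z (invL (gram g x) z (fderiv ℝ (comp0 v x) z)) :=
    fun z hz => gradSq_eq hv hz
  have hfd : ∀ z ∈ (chartAt (E n) x).target, fderiv ℝ (comp0 (gradSq g v) x) z
      = fderiv ℝ (fun z => fderiv ℝ (comp0 v x) z (invL (gram g x) z (fderiv ℝ (comp0 v x) z))) z :=
    fun z hz => Filter.EventuallyEq.fderiv_eq (Filter.mem_of_superset (h.mem_nhds hz) hE)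
  have h1 : ∀ z ∈ (chartAt (E n) x).target,
      mtr (eb n) (invL (gram g x)) (nabla (connL (gram g x)) (fderiv ℝ (comp0 v x))) z
        - fderiv ℝ (comp0 v x) z (invL (gram g x) z (fderiv ℝ (comp0 f x) z))
      = -(1 / (2 * τ) * comp0 v x z) := by
    intro z hz
    obtain ⟨b', hb'⟩ := h.exists_frame hz
    rw [h.mtr_eq_sum (eb n) hz hb', ← hg.lapF0C_eq hz hb' hv', ← lapF0_eq hs.smooth hv hz, comp0]
    have := heq ((chartAt (E n) x).symm z)
    have h2 : v ((chartAt (E n) x).symm z) / (2 * τ)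
      = 1 / (2 * τ) * v ((chartAt (E n) x).symm z) := by ring
    linarith
  rw [lapF0, hg.lapF0C_eq hx hb (contDiffOn_comp0 (contMDiff_gradSq g hv) x),
    h.nabla_congr_on hx hfd, hfd _ hx,
    h.bochner_soliton (isSoliton_of_shrinker hs x) hx hb hv' h1]
  refine mul_nonneg zero_le_two (Finset.sum_nonneg fun i _ => ?_)
  rw [h.inv_apply_eq_sum hx hb]
  exact Finset.sum_nonneg fun j _ => mul_self_nonneg _

theorem gradSq_nonneg (x : M) : 0 ≤ gradSq g v x := by
  have hg := isMetricOn_gram g x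
  have hx := coord_mem_target (n := n) x
  obtain ⟨b, hb⟩ := hg.isLeviCivita.exists_frame hx
  rw [gradSq, hg.isLeviCivita.inv_apply_eq_sum hx hb]
  exact Finset.sum_nonneg fun j _ => mul_self_nonneg _

/-- On a compact shrinker `1 / (2τ)` is not an eigenvalue of `-Δ_f`. -/
theorem eq_zero_of_eigen [CompactSpace M] (hs : IsGradientShrinker g f τ)
    (hv : ContMDiff (𝓡 n) 𝓘(ℝ, ℝ) ∞ v) (heq : ∀ x, lapF0 g f v x + v x / (2 * τ) = 0) (x : M) :
    v x = 0 := by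
  have hne : Nonempty M := ⟨x⟩
  have hτ := hs.pos
  have hQ := contMDiff_gradSq g hv
  -- Since `Δ_f |∇v|²` is only known to be nonnegative, a maximum of `|∇v|²` gives no contradiction.
  -- If the maximum `m` is positive, adding `ε e^{Kv}` makes the inequality strict at a maximum
  -- point of the sum.
  have hgrad : ∀ z, gradSq g v z = 0 := by
    obtain ⟨x₁, -, hx₁⟩ := isCompact_univ.exists_isMaxOn Set.univ_nonempty hQ.continuous.continuousOn
    have hx₁' : ∀ z, gradSq g v z ≤ gradSq g v x₁ := fun z => hx₁ (Set.mem_univ z)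
    set m := gradSq g v x₁ with hm
    rcases (gradSq_nonneg (g := g) (v := v) x₁).eq_or_lt with h0 | hpos
    · intro z
      exact le_antisymm ((hx₁' z).trans h0.ge) (gradSq_nonneg z)
    exfalso
    obtain ⟨x₂, -, hx₂⟩ := isCompact_univ.exists_isMaxOn Set.univ_nonempty
      hv.continuous.abs.continuousOn
    set A := |v x₂| with hA
    have hA' : ∀ z, |v z| ≤ A := fun z => hx₂ (Set.mem_univ z)
    set c := 1 / (2 * τ) with hc
    have hc0 : 0 < c := by positivity
    have hA0 : 0 ≤ A := abs_nonneg _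
    -- Chosen so that `K m / 2 = c A + 1` exceeds `|Δ_f v| ≤ c A`.
    set K := 2 * (c * A + 1) / m with hK
    have hK0 : 0 < K := by positivity
    set B := Real.exp (K * A) with hB
    have hB0 : 0 < B := Real.exp_pos _
    -- Chosen so that the perturbation is at most `m / 2`; hence `|∇v|² ≥ m / 2` at the maximum
    -- point of the sum (`h7`).
    set ε := m / (2 * B) with hε
    have hε0 : 0 < ε := by positivity
    have hεB : ε * B = m / 2 := by
      rw [hε]
      field_simp
    have hexp : ContMDiff (𝓡 n) 𝓘(ℝ, ℝ) ∞ fun z => Real.exp (K * v z) :=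
      Real.contDiff_exp.contMDiff.comp (contMDiff_const.mul hv)
    have hεs : ContMDiff (𝓡 n) 𝓘(ℝ, ℝ) ∞ fun z => ε * Real.exp (K * v z) :=
      contMDiff_const.mul hexp
    have hP : ContMDiff (𝓡 n) 𝓘(ℝ, ℝ) ∞ fun z => gradSq g v z + ε * Real.exp (K * v z) :=
      hQ.add hεs
    obtain ⟨x₃, -, hx₃⟩ := isCompact_univ.exists_isMaxOn Set.univ_nonempty
      hP.continuous.continuousOn
    have hx₃' : ∀ z, gradSq g v z + ε * Real.exp (K * v z)
        ≤ gradSq g v x₃ + ε * Real.exp (K * v x₃) := fun z => hx₃ (Set.mem_univ z)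
    have hmax : IsLocalMax (fun z => gradSq g v z + ε * Real.exp (K * v z)) x₃ :=
      Filter.Eventually.of_forall hx₃'
    have h1 := lapF0_nonpos_of_isLocalMax (g := g) (f := f) hP hmax
    have h2 := lapF0_add (g := g) (f := f) hQ hεs x₃
    have h3 := lapF0_const_mul (g := g) (f := f) ε hexp x₃
    have h4 := lapF0_exp (g := g) (f := f) hv K x₃
    have h5 := lapF0_gradSq_nonneg hs hv heq x₃
    have h6 : Real.exp (K * v x₃) ≤ B :=
      Real.exp_le_exp.2 (mul_le_mul_of_nonneg_left ((le_abs_self _).trans (hA' x₃)) hK0.le)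
    have h7 : m / 2 ≤ gradSq g v x₃ := by
      have h8 := hx₃' x₁
      have h9 : 0 < ε * Real.exp (K * v x₁) := by positivity
      have h10 := mul_le_mul_of_nonneg_left h6 hε0.le
      linarith
    have h8 : c * A + 1 ≤ K * gradSq g v x₃ := by
      have : K * (m / 2) = c * A + 1 := by
        have hm0 : m ≠ 0 := hpos.ne'
        rw [hK]
        field_simp
      rw [← this]
      exact mul_le_mul_of_nonneg_left h7 hK0.le
    have h9 : lapF0 g f v x₃ = -(c * v x₃) := by
      have h10 := heq x₃
      have h11 : v x₃ / (2 * τ) = c * v x₃ := by rw [hc]; ring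
      linarith
    have h10 : c * v x₃ ≤ c * A :=
      mul_le_mul_of_nonneg_left ((le_abs_self _).trans (hA' x₃)) hc0.le
    have h11 : 0 < K * Real.exp (K * v x₃) * (lapF0 g f v x₃ + K * gradSq g v x₃) := by
      refine mul_pos (by positivity) ?_
      linarith
    have h12 := mul_pos hε0 h11
    rw [← h4, ← h3] at h12
    linarith
  have hg := isMetricOn_gram g x
  have h := hg.isLeviCivita
  have hx := coord_mem_target (n := n) x
  have hv' := contDiffOn_comp0 hv x
  obtain ⟨b, hb⟩ := h.exists_frame hx
  have h1 : ∀ z ∈ (chartAt (E n) x).target, fderiv ℝ (comp0 v x) z = 0 := by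
    intro z hz
    have h2 : fderiv ℝ (comp0 v x) z
        (invL (gram g x) z (fderiv ℝ (comp0 v x) z)) = 0 := by
      rw [← gradSq_eq hv hz, hgrad]
    rw [← h.metric_inv_apply hz (fderiv ℝ (comp0 v x) z)] at h2
    have h3 : invL (gram g x) z (fderiv ℝ (comp0 v x) z) = 0 := by
      by_contra hne
      exact (h.pos _ hz _ hne).ne' h2
    rw [← h.metric_inv _ hz (fderiv ℝ (comp0 v x) z), h3, map_zero]
  have h2 : lapF0 g f v x = 0 := by
    rw [lapF0, hg.lapF0C_eq hx hb hv', h.nabla_congr_on hx h1, h1 _ hx, nabla_zero]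
    simp
  have h3 := heq x
  rw [h2, zero_add, div_eq_zero_iff] at h3
  rcases h3 with h3 | h3
  · exact h3
  · linarith

end Global

/-! ### The Riemannian measure -/

section Volume

variable {n : ℕ} {M : Type*} [TopologicalSpace M] [ChartedSpace (E n) M] [IsManifold (𝓡 n) ∞ M]
  {g : Metric n M} {p q : M}

/-- The determinant of the metric transforms by the square of the Jacobian. -/
theorem det_gram_trans {y : E n} (hy : y ∈ transDom q p) :
    (gram g q y).det = (fderiv ℝ (trans q p) y).det ^ 2 * (gram g p (trans q p y)).det := by
  set J : Matrix (Fin n) (Fin n) ℝ :=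
    LinearMap.toMatrix (eb n) (eb n) (fderiv ℝ (trans q p) y).toLinearMap with hJ
  have hJa : ∀ a i, J a i = fderiv ℝ (trans q p) y (sv i) a := fun a i => by
    simp [hJ, LinearMap.toMatrix_apply]
  have h1 : gram g q y = J.transpose * gram g p (trans q p y) * J := by
    ext i j
    have h2 := (isIsometricOn_trans g q p).isom y hy (sv i) (sv j)
    rw [metricL_sv, metricL_apply] at h2
    rw [h2, Matrix.mul_apply]
    simp only [Matrix.mul_apply, Matrix.transpose_apply, hJa, Finset.sum_mul]
    rw [Finset.sum_comm]
    exact Finset.sum_congr rfl fun b _ => Finset.sum_congr rfl fun a _ => by ring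
  have h3 : (fderiv ℝ (trans q p) y).det = J.det := by
    rw [hJ, LinearMap.det_toMatrix]
  rw [h1, Matrix.det_mul, Matrix.det_mul, Matrix.det_transpose, h3]
  ring

/-- The volume density in the chart at `p`. -/
def density (g : Metric n M) (p : M) (y : E n) : ℝ := Real.sqrt (gram g p y).det

theorem density_trans {y : E n} (hy : y ∈ transDom q p) :
    density g q y = |(fderiv ℝ (trans q p) y).det| * density g p (trans q p y) := by
  rw [density, density, det_gram_trans hy, Real.sqrt_mul (sq_nonneg _), Real.sqrt_sq_eq_abs]

theorem density_pos {y : E n} (hy : y ∈ (chartAt (E n) p).target) : 0 < density g p y :=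
  Real.sqrt_pos.2 ((isMetricOn_gram g p).det_pos hy)

theorem contDiffOn_density : ContDiffOn ℝ ∞ (density g p) (chartAt (E n) p).target :=
  (isMetricOn_gram g p).smooth_det.sqrt fun _ hy => ((isMetricOn_gram g p).det_pos hy).ne'

omit [IsManifold (𝓡 n) ∞ M] in
theorem measurableSet_target : MeasurableSet (chartAt (E n) p).target :=
  (chartAt (E n) p).open_target.measurableSet

theorem aemeasurable_density : AEMeasurable (fun y => ENNReal.ofReal (density g p y))
    ((volume : Measure (E n)).restrict (chartAt (E n) p).target) :=
  (contDiffOn_density.continuousOn.aemeasurable measurableSet_target).ennreal_ofReal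

variable [MeasurableSpace M] [BorelSpace M]

omit [IsManifold (𝓡 n) ∞ M] in
theorem aemeasurable_symm (μ : Measure (E n)) : AEMeasurable (chartAt (E n) p).symm
    (μ.restrict (chartAt (E n) p).target) :=
  (chartAt (E n) p).continuousOn_symm.aemeasurable measurableSet_target

theorem aemeasurable_symm' : AEMeasurable (chartAt (E n) p).symm
    (((volume : Measure (E n)).restrict (chartAt (E n) p).target).withDensity
      fun y => ENNReal.ofReal (Real.sqrt (gram g p y).det)) :=
  (aemeasurable_symm volume).mono_ac (withDensity_absolutelyContinuous _ _)

theorem chartVolume_apply {S : Set M} (hS : MeasurableSet S) :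
    chartVolume g p S = ∫⁻ y in (chartAt (E n) p).symm ⁻¹' S ∩ (chartAt (E n) p).target,
      ENNReal.ofReal (density g p y) := by
  rw [chartVolume, Measure.map_apply_of_aemeasurable aemeasurable_symm' hS, withDensity_apply',
    Measure.restrict_restrict' measurableSet_target]
  rfl

omit [IsManifold (𝓡 n) ∞ M] in
-- The inverse chart is continuous only on its target, so measurability is obtained on that subtype
-- and pushed forward.
theorem measurableSet_preimage_symm {S : Set M} (hS : MeasurableSet S) :
    MeasurableSet ((chartAt (E n) p).symm ⁻¹' S ∩ (chartAt (E n) p).target) := by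
  have h1 : Measurable ((chartAt (E n) p).target.domRestrict (chartAt (E n) p).symm) :=
    (continuousOn_iff_continuous_domRestrict.1 (chartAt (E n) p).continuousOn_symm).measurable
  have h2 := measurableSet_target.subtype_image (h1 hS)
  convert h2 using 1
  ext y
  simp [Set.domRestrict, and_comm]

/-- The chart measures agree on overlaps. -/
theorem chartVolume_le {S : Set M} (hS : MeasurableSet S) (hSp : S ⊆ (chartAt (E n) p).source) :
    chartVolume g q S ≤ chartVolume g p S := by
  rw [chartVolume_apply hS, chartVolume_apply hS]
  set A := (chartAt (E n) q).symm ⁻¹' S ∩ (chartAt (E n) q).target with hA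
  have hAD : A ⊆ transDom q p := fun y hy => ⟨hy.2, hSp hy.1⟩
  have hd : ∀ y ∈ A, HasFDerivWithinAt (trans q p) (fderiv ℝ (trans q p) y) A y := fun y hy =>
    (((contDiffOn_trans q p).contDiffAt ((isOpen_transDom q p).mem_nhds
      (hAD hy))).differentiableAt (by simp)).hasFDerivAt.hasFDerivWithinAt
  have hinj : Set.InjOn (trans q p) A := by
    intro y hy z hz hyz
    have h1 := congrArg (chartAt (E n) p).symm hyz
    rw [symm_trans (hAD hy), symm_trans (hAD hz)] at h1
    exact (chartAt (E n) q).symm.injOn hy.2 hz.2 h1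
  have himg : trans q p '' A ⊆ (chartAt (E n) p).symm ⁻¹' S ∩ (chartAt (E n) p).target := by
    rintro _ ⟨y, hy, rfl⟩
    refine ⟨?_, mapsTo_trans q p (hAD hy)⟩
    rw [Set.mem_preimage, symm_trans (hAD hy)]
    exact hy.1
  have hAm : MeasurableSet A := measurableSet_preimage_symm hS
  calc ∫⁻ y in A, ENNReal.ofReal (density g q y)
      = ∫⁻ y in A, ENNReal.ofReal |(fderiv ℝ (trans q p) y).det|
          * ENNReal.ofReal (density g p (trans q p y)) := by
        refine setLIntegral_congr_fun hAm fun y hy => ?_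
        rw [density_trans (hAD hy), ENNReal.ofReal_mul (abs_nonneg _)]
    _ = ∫⁻ y in trans q p '' A, ENNReal.ofReal (density g p y) :=
        (lintegral_image_eq_lintegral_abs_det_fderiv_mul volume hAm hd hinj
          fun y => ENNReal.ofReal (density g p y)).symm
    _ ≤ _ := lintegral_mono_set himg

theorem chartVolume_compl_source : chartVolume g p (chartAt (E n) p).sourceᶜ = 0 := by
  rw [chartVolume_apply (chartAt (E n) p).open_source.measurableSet.compl]
  have : (chartAt (E n) p).symm ⁻¹' (chartAt (E n) p).sourceᶜ ∩ (chartAt (E n) p).target = ∅ := by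
    ext y
    simp only [Set.mem_inter_iff, Set.mem_preimage, Set.mem_compl_iff, Set.mem_empty_iff_false,
      iff_false, not_and]
    intro h1 h2
    exact h1 ((chartAt (E n) p).map_target h2)
  rw [this]
  simp

/-- The Riemannian measure restricts to the chart measure on the domain of a chart. -/
theorem riemVolume_restrict [T2Space M] :
    (riemVolume g).restrict (chartAt (E n) p).source = chartVolume g p := by
  have hsrc : MeasurableSet (chartAt (E n) p).source := (chartAt (E n) p).open_source.measurableSet
  -- A supremum of measures is not computed set by set, so an upper bound is exhibited instead. It
  -- is infinite on every set that meets the complement of the source; any other set lies in the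
  -- source, where `chartVolume_le` applies. Inside the source the infinite part contributes
  -- nothing.
  have hle : riemVolume g ≤ chartVolume g p
      + (⊤ : ENNReal) • Measure.count.restrict (chartAt (E n) p).sourceᶜ := by
    refine iSup_le fun q => Measure.le_iff.2 fun S hS => ?_
    by_cases hne : (S ∩ (chartAt (E n) p).sourceᶜ).Nonempty
    · have h1 : Measure.count (S ∩ (chartAt (E n) p).sourceᶜ) ≠ 0 := fun h0 =>
        hne.ne_empty (Measure.count_eq_zero_iff.1 h0)
      rw [Measure.add_apply, Measure.smul_apply, Measure.restrict_apply hS, smul_eq_mul,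
        ENNReal.top_mul h1]
      simp
    · rw [Set.not_nonempty_iff_eq_empty, ← Set.sdiff_eq, Set.sdiff_eq_empty] at hne
      exact (chartVolume_le hS hne).trans (by rw [Measure.add_apply]; exact le_self_add)
  refine Measure.ext fun S hS => ?_
  rw [Measure.restrict_apply hS]
  have hsplit : chartVolume g p S = chartVolume g p (S ∩ (chartAt (E n) p).source) := by
    rw [← measure_inter_add_sdiff S hsrc]
    have : chartVolume g p (S \ (chartAt (E n) p).source) = 0 :=
      measure_mono_null (fun x hx => hx.2) chartVolume_compl_source
    rw [this, add_zero]
  rw [hsplit]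
  refine le_antisymm ?_ (le_iSup (fun q => chartVolume g q) p _)
  refine (hle _).trans ?_
  rw [Measure.add_apply, Measure.smul_apply, Measure.restrict_apply (hS.inter hsrc)]
  have : S ∩ (chartAt (E n) p).source ∩ (chartAt (E n) p).sourceᶜ = ∅ := by
    rw [Set.inter_assoc, Set.inter_compl_self, Set.inter_empty]
  rw [this]
  simp

variable [T2Space M]

/-- The integral over `M` of a function that vanishes outside the domain of a chart. -/
theorem integral_riemVolume_eq {u : M → ℝ} (hu : ∀ x ∉ (chartAt (E n) p).source, u x = 0)
    (hm : AEStronglyMeasurable u (chartVolume g p)) :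
    ∫ x, u x ∂(riemVolume g)
      = ∫ y in (chartAt (E n) p).target, density g p y * u ((chartAt (E n) p).symm y) := by
  rw [← setIntegral_eq_integral_of_forall_compl_eq_zero hu, riemVolume_restrict, chartVolume,
    integral_map aemeasurable_symm' hm,
    integral_withDensity_eq_integral_toReal_smul₀
      (f := fun y => ENNReal.ofReal (Real.sqrt (gram g p y).det)) aemeasurable_density
      (Filter.Eventually.of_forall fun _ => ENNReal.ofReal_lt_top)]
  refine integral_congr_ae (Filter.Eventually.of_forall fun y => ?_)
  simp only [smul_eq_mul]
  rw [ENNReal.toReal_ofReal (Real.sqrt_nonneg _)]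
  rfl

/-- The density is bounded on a closed ball inside the chart. With compactness of `M`, local
finiteness gives a finite total volume. -/
theorem exists_open_riemVolume_lt_top (x : M) : ∃ S ∈ nhds x, riemVolume g S < ⊤ := by
  obtain ⟨r, hr, hrs⟩ := Metric.nhds_basis_closedBall.mem_iff.1
    ((chartAt (E n) x).open_target.mem_nhds (coord_mem_target x))
  set S := (chartAt (E n) x).source ∩ (chartAt (E n) x) ⁻¹' Metric.ball (coord x) r with hS
  have hSo : IsOpen S := (chartAt (E n) x).isOpen_inter_preimage Metric.isOpen_ball
  refine ⟨S, hSo.mem_nhds ⟨mem_chart_source _ x, Metric.mem_ball_self hr⟩, ?_⟩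
  have h1 : riemVolume g S = chartVolume g x S := by
    rw [← riemVolume_restrict (g := g) (p := x), Measure.restrict_apply hSo.measurableSet,
      Set.inter_eq_left.2 Set.inter_subset_left]
  rw [h1, chartVolume_apply hSo.measurableSet]
  have h2 : (chartAt (E n) x).symm ⁻¹' S ∩ (chartAt (E n) x).target
      ⊆ Metric.closedBall (coord x) r := by
    rintro y ⟨hy1, hy2⟩
    have := hy1.2
    rw [Set.mem_preimage, (chartAt (E n) x).right_inv hy2] at this
    exact Metric.ball_subset_closedBall this
  refine (lintegral_mono_set h2).trans_lt ?_
  have h3 : IntegrableOn (density g x) (Metric.closedBall (coord x) r) :=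
    (contDiffOn_density.continuousOn.mono hrs).integrableOn_compact (isCompact_closedBall _ _)
  exact h3.lintegral_lt_top

instance [CompactSpace M] : IsFiniteMeasure (riemVolume g) := by
  have : IsLocallyFiniteMeasure (riemVolume g) := ⟨fun x => by
    obtain ⟨S, hS, hlt⟩ := exists_open_riemVolume_lt_top (g := g) x
    exact ⟨S, hS, hlt⟩⟩
  exact ⟨isCompact_univ.measure_lt_top⟩

omit [T2Space M] in
theorem riemVolume_pos {S : Set M} (hS : IsOpen S) (hne : S.Nonempty) : 0 < riemVolume g S := by
  obtain ⟨x, hx⟩ := hne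
  refine lt_of_lt_of_le ?_ (le_iSup (fun q => chartVolume g q) x S)
  rw [chartVolume_apply hS.measurableSet]
  have ho : IsOpen ((chartAt (E n) x).symm ⁻¹' S ∩ (chartAt (E n) x).target) := by
    rw [Set.inter_comm]
    exact (chartAt (E n) x).isOpen_inter_preimage_symm hS
  have hmem : coord x ∈ (chartAt (E n) x).symm ⁻¹' S ∩ (chartAt (E n) x).target :=
    ⟨by rw [Set.mem_preimage, symm_coord]; exact hx, coord_mem_target x⟩
  refine pos_iff_ne_zero.2 fun h0 => (ho.measure_pos volume ⟨_, hmem⟩).ne' ?_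
  rw [lintegral_eq_zero_iff' (aemeasurable_density.mono_measure
    (Measure.restrict_mono Set.inter_subset_right le_rfl)), Filter.EventuallyEq,
    ae_restrict_iff' ho.measurableSet, ae_iff] at h0
  refine measure_mono_null (fun y hy => ?_) h0
  simp only [Set.mem_ofPred_eq, Classical.not_imp, Pi.zero_apply, ENNReal.ofReal_eq_zero, not_le]
  exact ⟨hy, density_pos hy.2⟩

end Volume

/-! ### Jacobi's formula and the divergence form of the weighted Laplacian -/

section Jacobi

variable {V : Type*} [NormedAddCommGroup V] [NormedSpace ℝ V] {n : ℕ}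

/-- Jacobi's formula for the derivative of a determinant. -/
theorem fderiv_det {A : V → Matrix (Fin n) (Fin n) ℝ} {y : V}
    (hA : ∀ i j, DifferentiableAt ℝ (fun z => A z i j) y) (w : V) :
    fderiv ℝ (fun z => (A z).det) y w
      = ((Matrix.of fun i j => fderiv ℝ (fun z => A z i j) y w) * (A y).adjugate).trace := by
  let D : ContinuousMultilinearMap ℝ (fun _ : Fin n => Fin n → ℝ) ℝ :=
    ⟨(Matrix.detRowAlternating (n := Fin n) (R := ℝ)).toMultilinearMap,
      (continuous_id.matrix_det : Continuous fun A : Matrix (Fin n) (Fin n) ℝ => A.det)⟩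
  have h1 : HasFDerivAt (fun z i j => A z i j)
      (ContinuousLinearMap.pi fun i => ContinuousLinearMap.pi fun j =>
        fderiv ℝ (fun z => A z i j) y) y :=
    hasFDerivAt_pi.2 fun i => hasFDerivAt_pi.2 fun j => (hA i j).hasFDerivAt
  have h2 := (D.hasFDerivAt (fun i j => A y i j)).comp y h1
  have h3 : fderiv ℝ (fun z => (A z).det) y = _ := h2.fderiv
  rw [h3, ContinuousLinearMap.comp_apply, ContinuousMultilinearMap.linearDeriv_apply,
    Matrix.trace]
  refine Finset.sum_congr rfl fun i _ => ?_
  -- By multilinearity the derivative is a sum of determinants with one row replaced by its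
  -- derivative; Cramer's rule expands each of them in the adjugate.
  have h4 := congrFun (Matrix.cramer_eq_adjugate_mulVec (A y).transpose
    (fun j => fderiv ℝ (fun z => A z i j) y w)) i
  rw [Matrix.cramer_transpose_apply, ← Matrix.adjugate_transpose] at h4
  refine Eq.trans (b := ((A y).updateRow i fun j => fderiv ℝ (fun z => A z i j) y w).det) rfl ?_
  rw [h4, Matrix.diag_apply, Matrix.mul_apply, Matrix.mulVec, dotProduct]
  exact Finset.sum_congr rfl fun j _ => by
    rw [Matrix.transpose_apply, Matrix.of_apply, mul_comm]

end Jacobi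

namespace IsMetricOn

variable {n : ℕ} {G : E n → Matrix (Fin n) (Fin n) ℝ} {U : Set (E n)} {y : E n}

/-- With `A` the matrix of `Γ(w)`, metric compatibility reads `∂_w G = Aᵀ G + G A`. Its trace
against the adjugate `det G · G⁻¹` is `2 det G · tr A`. -/
theorem fderiv_det (h : IsMetricOn U G) (hy : y ∈ U) (w : E n) :
    fderiv ℝ (fun z => (G z).det) y w = 2 * (G y).det * ∑ k, connL G y w (sv k) k := by
  rw [Shrinker.fderiv_det fun i j => h.differentiableAt hy i j]
  set A : Matrix (Fin n) (Fin n) ℝ := Matrix.of fun k j => connL G y w (sv j) k with hA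
  have h1 : (Matrix.of fun i j => fderiv ℝ (fun z => G z i j) y w)
      = A.transpose * G y + G y * A := by
    ext i j
    rw [Matrix.of_apply, ← h.fderiv_metricL hy, h.isLeviCivita.fderiv_metric hy, Matrix.add_apply,
      Matrix.mul_apply, Matrix.mul_apply, h.isLeviCivita.symm y hy _ (sv j),
      metricL_sv_left, metricL_sv_left]
    simp only [hA, Matrix.transpose_apply, Matrix.of_apply]
    congr 1
    exact Finset.sum_congr rfl fun k _ => by rw [h.symm hy, mul_comm]
  have h2 : A.trace = ∑ k, connL G y w (sv k) k := rfl
  rw [h1, Matrix.add_mul, Matrix.trace_add, Matrix.mul_assoc, Matrix.mul_adjugate,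
    Matrix.trace_mul_comm (G y * A), ← Matrix.mul_assoc, Matrix.adjugate_mul, ← h2]
  simp only [Matrix.mul_smul, Matrix.smul_mul, Matrix.mul_one, Matrix.one_mul, Matrix.trace_smul,
    Matrix.trace_transpose, smul_eq_mul]
  ring

theorem fderiv_sqrt_det (h : IsMetricOn U G) (hy : y ∈ U) (w : E n) :
    fderiv ℝ (fun z => Real.sqrt (G z).det) y w
      = Real.sqrt (G y).det * ∑ k, connL G y w (sv k) k := by
  have hd := h.isLeviCivita.differentiableAt hy h.smooth_det
  have h1 := (hd.hasFDerivAt.sqrt (h.det_pos hy).ne').fderiv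
  rw [h1, smul_apply, h.fderiv_det hy, smul_eq_mul]
  have h2 := Real.mul_self_sqrt (h.det_pos hy).le
  have h3 := (Real.sqrt_pos.2 (h.det_pos hy)).ne'
  field_simp
  rw [pow_two, h2]

/-- The weighted Laplacian in divergence form. -/
theorem sum_fderiv_eq_lapF0C (h : IsMetricOn U G) (hy : y ∈ U) {f v : E n → ℝ}
    (hf : ContDiffOn ℝ ∞ f U) (hv : ContDiffOn ℝ ∞ v U) :
    ∑ k, fderiv ℝ (fun z => Real.exp (-f z) * Real.sqrt (G z).det
        * invL G z (fderiv ℝ v z) k) y (sv k)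
      = Real.exp (-f y) * Real.sqrt (G y).det * lapF0C G f v y := by
  have hL := h.isLeviCivita
  obtain ⟨b, hb⟩ := hL.exists_frame hy
  have hs : ContDiffOn ℝ ∞ (fun z => Real.sqrt (G z).det) U :=
    h.smooth_det.sqrt fun _ hz => (h.det_pos hz).ne'
  have h1 := (hL.differentiableAt hy hf).hasFDerivAt.neg.exp
  have h2 := (hL.differentiableAt hy hs).hasFDerivAt
  have h3 := (hL.differentiableAt hy (hL.smooth_grad hv)).hasFDerivAt
  set X := invL G y (fderiv ℝ v y) with hX
  have h4 : ∀ k, fderiv ℝ (fun z => Real.exp (-f z) * Real.sqrt (G z).det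
        * invL G z (fderiv ℝ v z) k) y (sv k) = Real.exp (-f y) * Real.sqrt (G y).det *
      (fderiv ℝ (fun z => invL G z (fderiv ℝ v z)) y (sv k) k
        + X k * (∑ j, connL G y (sv k) (sv j) j) - X k * fderiv ℝ f y (sv k)) := fun k => by
    have h5 := ((h1.mul h2).mul
      (((EuclideanSpace.proj k : E n →L[ℝ] ℝ).hasFDerivAt).comp y h3)).fderiv
    have h6 : fderiv ℝ (fun z => Real.exp (-f z) * Real.sqrt (G z).det
        * invL G z (fderiv ℝ v z) k) y = _ := h5
    have h7 : ∀ w : E n, (EuclideanSpace.proj k : E n →L[ℝ] ℝ) w = w k := fun _ => rfl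
    rw [h6]
    simp only [add_apply, smul_apply, neg_apply, smul_eq_mul, ContinuousLinearMap.comp_apply,
      h.fderiv_sqrt_det hy, h7, Pi.mul_apply, Pi.neg_apply, Function.comp_apply, ← hX]
    ring
  have h5 : ∀ L : E n →L[ℝ] ℝ, ∑ k, X k * L (sv k) = L X := fun L => by
    conv_rhs => rw [← sum_sv X]
    simp
  have h6 : ∑ k, X k * (∑ j, connL G y (sv k) (sv j) j) = ∑ j, connL G y X (sv j) j := by
    simp only [Finset.mul_sum]
    rw [Finset.sum_comm]
    exact Finset.sum_congr rfl fun j _ =>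
      h5 ((EuclideanSpace.proj j : E n →L[ℝ] ℝ).comp ((connL G y).flip (sv j)))
  -- The coordinate divergence of `∇v` is the trace of its Hessian minus a trace of `Γ`; that trace
  -- is what the derivative of `√det G` contributes (`h6`).
  have h7 : ∑ k, fderiv ℝ (fun z => invL G z (fderiv ℝ v z)) y (sv k) k
      = ∑ i, nabla (connL G) (fderiv ℝ v) y (b i) (b i) - ∑ j, connL G y X (sv j) j := by
    have h8 := hb.sum_coord (eb n) ((invL G y).comp (nabla (connL G) (fderiv ℝ v) y))
    simp only [Module.Basis.coord_apply, eb_repr, eb_apply, ContinuousLinearMap.comp_apply,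
      hL.metric_inv y hy] at h8
    rw [← h8, ← Finset.sum_sub_distrib]
    refine Finset.sum_congr rfl fun k _ => ?_
    rw [← hL.nabla_grad hy hv, nabla_apply, act_self, hL.torsion_free y hy X]
    simp [hX]
  rw [Finset.sum_congr rfl fun k _ => h4 k, ← Finset.mul_sum, Finset.sum_sub_distrib,
    Finset.sum_add_distrib, h6, h7, h5, h.lapF0C_eq hy hb hv, hX,
    hL.inv_apply_eq_sum hy hb, hL.inv_apply_eq_sum hy hb]
  simp only [mul_comm (fderiv ℝ f y _)]
  ring

end IsMetricOn

/-! ### The divergence theorem for compactly supported fields on a vector space -/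

section Euclidean

variable {V : Type*} [NormedAddCommGroup V] [NormedSpace ℝ V] {U K : Set V} {F : V → ℝ}

omit [NormedSpace ℝ V] in
theorem indicator_eventuallyEq_zero (hK : IsClosed K) (h0 : ∀ y ∈ U, y ∉ K → F y = 0) {y : V}
    (hy : y ∉ K) : U.indicator F =ᶠ[nhds y] 0 :=
  Filter.mem_of_superset (hK.isOpen_compl.mem_nhds hy) fun z hz => by
    by_cases hzU : z ∈ U
    · exact (Set.indicator_of_mem hzU F).trans (h0 z hzU hz)
    · exact Set.indicator_of_notMem hzU F

/-- A function on a chart that vanishes off a compact set extends smoothly by zero, so the integral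
theorems on the whole vector space apply. -/
theorem contDiff_indicator (hU : IsOpen U) (hK : IsClosed K) (hKU : K ⊆ U)
    (hF : ContDiffOn ℝ ∞ F U) (h0 : ∀ y ∈ U, y ∉ K → F y = 0) :
    ContDiff ℝ ∞ (U.indicator F) := by
  refine contDiff_iff_contDiffAt.2 fun y => ?_
  by_cases hy : y ∈ U
  · refine (hF.contDiffAt (hU.mem_nhds hy)).congr_of_eventuallyEq ?_
    exact Filter.mem_of_superset (hU.mem_nhds hy) fun z hz => Set.indicator_of_mem hz F
  · exact contDiffAt_const.congr_of_eventuallyEq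
      (indicator_eventuallyEq_zero hK h0 fun h => hy (hKU h))

omit [NormedSpace ℝ V] in
theorem hasCompactSupport_indicator (hK : IsCompact K) (h0 : ∀ y ∈ U, y ∉ K → F y = 0) :
    HasCompactSupport (U.indicator F) :=
  HasCompactSupport.of_support_subset_isCompact hK fun y hy => by
    by_contra h
    by_cases hyU : y ∈ U
    · exact hy ((Set.indicator_of_mem hyU F).trans (h0 y hyU h))
    · exact hy (Set.indicator_of_notMem hyU F)

variable [FiniteDimensional ℝ V] [MeasurableSpace V] [BorelSpace V] {μ : Measure V}
  [μ.IsAddHaarMeasure]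

omit [FiniteDimensional ℝ V] in
theorem integrable_fderiv_apply (hF : ContDiff ℝ ∞ F) (hc : HasCompactSupport F) (v : V) :
    Integrable (fun y => fderiv ℝ F y v) μ :=
  ((hF.continuous_fderiv (by simp)).clm_apply continuous_const).integrable_of_hasCompactSupport
    (hc.fderiv_apply ℝ v)

theorem integral_fderiv_apply_eq_zero (hF : ContDiff ℝ ∞ F) (hc : HasCompactSupport F) (v : V) :
    ∫ y, fderiv ℝ F y v ∂μ = 0 := by
  -- Integration by parts against the constant function 1.
  have h := integral_bilinear_hasFDerivAt_right_eq_neg_left_of_integrable (μ := μ) (v := v)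
    (f := fun _ : V => (1 : ℝ)) (f' := fun _ => 0) (g := F) (g' := fderiv ℝ F)
    (B := ContinuousLinearMap.mul ℝ ℝ) (by simp)
    (by simpa using integrable_fderiv_apply hF hc v)
    (by simpa using hF.continuous.integrable_of_hasCompactSupport hc)
    (fun x _ => hasFDerivAt_const _ _)
    (fun x _ => (hF.differentiable (by simp) x).hasFDerivAt)
  simpa using h

/-- The divergence theorem for compactly supported fields. -/
theorem setIntegral_sum_fderiv_eq_zero {ι : Type*} [Fintype ι] {F : ι → V → ℝ} (v : ι → V)
    (hU : IsOpen U) (hK : IsCompact K) (hKU : K ⊆ U) (hF : ∀ i, ContDiffOn ℝ ∞ (F i) U)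
    (h0 : ∀ i, ∀ y ∈ U, y ∉ K → F i y = 0) :
    ∫ y in U, ∑ i, fderiv ℝ (F i) y (v i) ∂μ = 0 := by
  have h1 : ∀ y ∈ U, ∑ i, fderiv ℝ (F i) y (v i)
      = ∑ i, fderiv ℝ (U.indicator (F i)) y (v i) := fun y hy =>
    Finset.sum_congr rfl fun i _ => by
      have : U.indicator (F i) =ᶠ[nhds y] F i :=
        Filter.mem_of_superset (hU.mem_nhds hy) fun z hz => Set.indicator_of_mem hz _
      rw [this.fderiv_eq]
  rw [setIntegral_congr_fun hU.measurableSet h1, setIntegral_eq_integral_of_forall_compl_eq_zero,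
    integral_finsetSum]
  · exact Finset.sum_eq_zero fun i _ => integral_fderiv_apply_eq_zero
      (contDiff_indicator hU hK.isClosed hKU (hF i) (h0 i))
      (hasCompactSupport_indicator hK (h0 i)) _
  · exact fun i _ => integrable_fderiv_apply
      (contDiff_indicator hU hK.isClosed hKU (hF i) (h0 i))
      (hasCompactSupport_indicator hK (h0 i)) _
  · intro y hy
    refine Finset.sum_eq_zero fun i _ => ?_
    rw [(indicator_eventuallyEq_zero hK.isClosed (h0 i) fun h => hy (hKU h)).fderiv_eq]
    simp

end Euclidean

/-! ### The weighted divergence theorem on a compact manifold -/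

section Divergence

variable {n : ℕ} {M : Type*} [TopologicalSpace M] [ChartedSpace (E n) M] [IsManifold (𝓡 n) ∞ M]
  {g : Metric n M} {f u : M → ℝ} {p : M}

omit [IsManifold (𝓡 n) ∞ M] in
theorem comp0_eventuallyEq_zero {y : E n} (hy : y ∈ (chartAt (E n) p).target)
    (hu : u =ᶠ[nhds ((chartAt (E n) p).symm y)] 0) : comp0 u p =ᶠ[nhds y] 0 :=
  ((chartAt (E n) p).continuousAt_symm hy).eventually hu

theorem lapF0_eq_zero_of_eventuallyEq {x : M} (hu : u =ᶠ[nhds x] 0) : lapF0 g f u x = 0 := by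
  have h1 : comp0 u x =ᶠ[nhds (coord x)] fun _ : E n => 0 :=
    comp0_eventuallyEq_zero (coord_mem_target x) (by rwa [symm_coord])
  have h2 : ∀ i, pd i (comp0 u x) =ᶠ[nhds (coord x)] fun _ : E n => 0 := fun i => by
    filter_upwards [h1.eventuallyEq_nhds] with z hz
    rw [pd, hz.fderiv_eq]
    simp
  have h3 : ∀ i, pd i (comp0 u x) (coord x) = 0 := fun i => (h2 i).eq_of_nhds
  have h4 : ∀ i j, pd i (pd j (comp0 u x)) (coord x) = 0 := fun i j => by
    rw [pd, (h2 j).fderiv_eq]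
    simp
  simp [lapF0, lapF0C, hessC, cov1, h3, h4]

theorem contMDiff_lapF0 (hf : ContMDiff (𝓡 n) 𝓘(ℝ, ℝ) ∞ f) (hu : ContMDiff (𝓡 n) 𝓘(ℝ, ℝ) ∞ u) :
    ContMDiff (𝓡 n) 𝓘(ℝ, ℝ) ∞ (lapF0 g f u) :=
  contMDiff_of_comp0 fun p => by
    have hg := isMetricOn_gram g p
    have h := hg.isLeviCivita
    have hu' := contDiffOn_comp0 hu p
    refine ((h.smooth_mtr (eb n) (h.smooth_nabla (h.smooth_fderiv hu'))).sub
      ((h.smooth_fderiv hu').clm_apply (h.smooth_grad (contDiffOn_comp0 hf p)))).congr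
      fun y hy => ?_
    obtain ⟨b, hb⟩ := h.exists_frame hy
    rw [comp0, lapF0_eq hf hu hy, hg.lapF0C_eq hy hb hu', h.mtr_eq_sum (eb n) hy hb]

variable [MeasurableSpace M] [BorelSpace M] [T2Space M] [CompactSpace M]

theorem integrable_riemVolume (hu : Continuous u) : Integrable u (riemVolume g) := by
  obtain ⟨C, hC⟩ := isCompact_univ.exists_bound_of_continuousOn hu.continuousOn
  exact (integrable_const C).mono' hu.aestronglyMeasurable
    (Filter.Eventually.of_forall fun x => hC x (Set.mem_univ x))

/-- In the chart, `Δ_f u` times `e^{-f} √det g` is the coordinate divergence of a smooth field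
supported in the image of the support of `u`. -/
theorem wInt_lapF0_of_tsupport_subset (hf : ContMDiff (𝓡 n) 𝓘(ℝ, ℝ) ∞ f)
    (hu : ContMDiff (𝓡 n) 𝓘(ℝ, ℝ) ∞ u) (hs : tsupport u ⊆ (chartAt (E n) p).source) :
    wInt g f (lapF0 g f u) = 0 := by
  have hg := isMetricOn_gram g p
  have hL := hg.isLeviCivita
  have hu' := contDiffOn_comp0 hu p
  have hf' := contDiffOn_comp0 hf p
  have hzero : ∀ x ∉ tsupport u, u =ᶠ[nhds x] 0 := fun x hx =>
    notMem_tsupport_iff_eventuallyEq.1 hx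
  have hcont : Continuous fun x => lapF0 g f u x * Real.exp (-f x) :=
    (contMDiff_lapF0 hf hu).continuous.mul (Real.continuous_exp.comp hf.continuous.neg)
  set K : Set (E n) := chartAt (E n) p '' tsupport u with hK
  have hKc : IsCompact K := (isClosed_tsupport u).isCompact.image_of_continuousOn
    ((chartAt (E n) p).continuousOn.mono hs)
  have hKU : K ⊆ (chartAt (E n) p).target := by
    rintro _ ⟨x, hx, rfl⟩
    exact (chartAt (E n) p).map_source (hs hx)
  rw [wInt, integral_riemVolume_eq (p := p) (fun x hx => by
    rw [lapF0_eq_zero_of_eventuallyEq (hzero x fun h => hx (hs h)), zero_mul])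
    hcont.aestronglyMeasurable]
  rw [← setIntegral_sum_fderiv_eq_zero (μ := (volume : Measure (E n)))
    (F := fun k z => Real.exp (-comp0 f p z) * Real.sqrt (gram g p z).det
      * invL (gram g p) z (fderiv ℝ (comp0 u p) z) k) (fun k => sv k)
    (chartAt (E n) p).open_target hKc hKU]
  · refine setIntegral_congr_fun measurableSet_target fun y hy => ?_
    rw [hg.sum_fderiv_eq_lapF0C hy hf' hu', lapF0_eq hf hu hy, density]
    simp only [comp0]
    ring
  · intro k
    refine ((Real.contDiff_exp.comp_contDiffOn hf'.neg).mul contDiffOn_density).mul ?_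
    exact (EuclideanSpace.proj k : E n →L[ℝ] ℝ).contDiff.comp_contDiffOn (hL.smooth_grad hu')
  · intro k y hy hyK
    have h1 : comp0 u p =ᶠ[nhds y] fun _ => 0 := comp0_eventuallyEq_zero hy <| hzero _ fun h =>
      hyK ⟨_, h, (chartAt (E n) p).right_inv hy⟩
    rw [h1.fderiv_eq]
    simp

omit [BorelSpace M] [T2Space M] [CompactSpace M] in
theorem wInt_zero : wInt g f (fun _ => 0) = 0 := by simp [wInt]

/-- The weighted divergence theorem. -/
theorem wInt_lapF0 (hf : ContMDiff (𝓡 n) 𝓘(ℝ, ℝ) ∞ f) (hu : ContMDiff (𝓡 n) 𝓘(ℝ, ℝ) ∞ u) :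
    wInt g f (lapF0 g f u) = 0 := by
  obtain ⟨ρ, hρ⟩ := SmoothPartitionOfUnity.exists_isSubordinate_chartAt_source (𝓡 n) M
  have hfin : {i | (Function.support (ρ i)).Nonempty}.Finite :=
    ρ.locallyFinite.finite_nonempty_of_compact
  set T := hfin.toFinset with hT
  have hsum : ∀ x, ∑ i ∈ T, ρ i x * u x = u x := fun x => by
    rw [← Finset.sum_mul, ← finsum_eq_sum_of_support_subset, ρ.sum_eq_one (Set.mem_univ x),
      one_mul]
    intro i hi
    rw [hT, Set.Finite.coe_toFinset]
    exact ⟨x, hi⟩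
  have hsm : ∀ i, ContMDiff (𝓡 n) 𝓘(ℝ, ℝ) ∞ fun x => ρ i x * u x := fun i =>
    (ρ i).contMDiff.mul hu
  -- By compactness only finitely many members of the partition of unity are nonzero. The sum is
  -- built up by induction because additivity of `lapF0` and of the integral requires smoothness of
  -- each partial sum.
  have key : ∀ S : Finset M, ContMDiff (𝓡 n) 𝓘(ℝ, ℝ) ∞ (fun x => ∑ i ∈ S, ρ i x * u x) ∧
      wInt g f (lapF0 g f fun x => ∑ i ∈ S, ρ i x * u x) = 0 := by
    classical
    intro S
    induction S using Finset.induction_on with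
    | empty =>
      refine ⟨by simpa using contMDiff_const, ?_⟩
      have : lapF0 g f (fun _ => 0) = fun _ => 0 := funext fun x => lapF0_zero x
      simp only [Finset.sum_empty]
      rw [this, wInt_zero]
    | insert i S hi ih =>
      simp only [Finset.sum_insert hi]
      refine ⟨(hsm i).add ih.1, ?_⟩
      have h1 : lapF0 g f (fun x => ρ i x * u x + ∑ i ∈ S, ρ i x * u x)
          = fun x => lapF0 g f (fun x => ρ i x * u x) x
            + lapF0 g f (fun x => ∑ i ∈ S, ρ i x * u x) x :=
        funext fun x => lapF0_add (hsm i) ih.1 x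
      have h2 : wInt g f (lapF0 g f fun x => ρ i x * u x) = 0 :=
        wInt_lapF0_of_tsupport_subset (p := i) hf (hsm i)
          ((tsupport_mul_subset_left).trans (hρ i))
      have hint : ∀ {w : M → ℝ}, ContMDiff (𝓡 n) 𝓘(ℝ, ℝ) ∞ w →
          Integrable (fun x => lapF0 g f w x * Real.exp (-f x)) (riemVolume g) := fun hw =>
        integrable_riemVolume ((contMDiff_lapF0 hf hw).continuous.mul
          (Real.continuous_exp.comp hf.continuous.neg))
      have h3 := ih.2
      rw [wInt] at h2 h3 ⊢
      simp only [h1, add_mul]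
      rw [integral_add (hint (hsm i)) (hint ih.1), h2, h3, add_zero]
  have := (key T).2
  simpa only [hsum] using this

end Divergence

/-! ### The stability operator on the Ricci tensor of a compact shrinker -/

section Soliton

variable {n : ℕ} {M : Type*} [TopologicalSpace M] [ChartedSpace (E n) M] [IsManifold (𝓡 n) ∞ M]
  {g : Metric n M} {f : M → ℝ} {τ : ℝ}

/-- On a gradient shrinker the weighted divergence of the Ricci tensor vanishes. -/
theorem divF2_ricci (hs : IsGradientShrinker g f τ) : divF2 g f (ricci g) = 0 := by
  ext1 x
  have hg := isMetricOn_gram g x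
  have h := hg.isLeviCivita
  have hx := coord_mem_target (n := n) x
  obtain ⟨b, hb⟩ := h.exists_frame hx
  have h1 : ∀ i, divF2C (gram g x) (comp0 f x) (comp2 (ricci g) x) i (coord x) = 0 := fun i => by
    rw [hg.divF2C_eq hx hb (h.smooth_ric (eb n)) (fun z hz => comp2_ricci hz),
      Finset.sum_congr rfl fun s _ => h.nabla_ric_symm (eb n) hx (b s) (sv i) (b s),
      h.div_ric (isSoliton_of_shrinker hs x) hx hb, h.ric_symm (eb n) hx, sub_self]
  simp [divF2, ofComp1, h1]

theorem divF1_zero : divF1 g f 0 = 0 := by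
  ext x
  have h1 : ∀ i, comp1 (0 : OneForm n M) x i = fun _ => 0 := fun i => rfl
  simp [divF1, divF1C, cov1, pd, h1]

theorem divDag_zero : divDag g 0 = 0 := by
  ext1 x
  have h1 : ∀ i, comp1 (0 : OneForm n M) x i = fun _ => 0 := fun i => rfl
  simp [divDag, divDagC, cov1, pd, h1, ofComp2]

theorem hess_zero : hess g 0 = 0 := by
  ext1 x
  have h1 : comp0 (n := n) (0 : M → ℝ) x = fun _ => 0 := rfl
  have h2 : ∀ i : Fin n, pd i (fun _ : E n => (0 : ℝ)) = fun _ => 0 := fun i => by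
    ext y
    simp [pd]
  simp [hess, hessC, cov1, h1, h2, ofComp2]

/-- The evolution of the scalar curvature: `½ Δ_f R = R / (2τ) - |Rc|²`. -/
theorem lapF0_scal (hs : IsGradientShrinker g f τ) (x : M) :
    lapF0 g f (scal g) x
      = 2 * (1 / (2 * τ)) * scal g x - 2 * inner2 g (ricci g) (ricci g) x := by
  have hg := isMetricOn_gram g x
  have h := hg.isLeviCivita
  have hx := coord_mem_target (n := n) x
  obtain ⟨b, hb⟩ := h.exists_frame hx
  have hE : ∀ z ∈ (chartAt (E n) x).target, comp0 (scal g) x z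
      = IsLeviCivita.scalar (eb n) (invL (gram g x)) (connL (gram g x)) z := fun z hz => scal_eq hz
  have hfd : ∀ z ∈ (chartAt (E n) x).target, fderiv ℝ (comp0 (scal g) x) z
      = fderiv ℝ (IsLeviCivita.scalar (eb n) (invL (gram g x)) (connL (gram g x))) z :=
    fun z hz => Filter.EventuallyEq.fderiv_eq (Filter.mem_of_superset (h.mem_nhds hz) hE)
  have h0 : scal g x
      = IsLeviCivita.scalar (eb n) (invL (gram g x)) (connL (gram g x)) (coord x) := by
    rw [← scal_eq hx, symm_coord]
  rw [lapF0, hg.lapF0C_eq hx hb (contDiffOn_comp0 (contMDiff_scal g) x), h.nabla_congr_on hx hfd,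
    hfd _ hx, h.lap_scalar (isSoliton_of_shrinker hs x) hx hb, h0, inner2,
    hg.innerC_eq hx hb (comp2_ricci hx) (comp2_ricci hx)]
  simp only [h.inv_apply_eq_sum hx hb]

/-- `½ Δ_f Rc + Rm(Rc, ·) = Rc / (2τ)` on a gradient shrinker. -/
theorem lapF2_ricci_add_rm (hs : IsGradientShrinker g f τ) :
    (1 / 2 : ℝ) • lapF2 g f (ricci g) + rm g (ricci g) = (1 / (2 * τ)) • ricci g := by
  ext1 x
  have hg := isMetricOn_gram g x
  have h := hg.isLeviCivita
  have hx := coord_mem_target (n := n) x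
  obtain ⟨b, hb⟩ := h.exists_frame hx
  have h1 : ∀ i j, (1 / 2 : ℝ) * lapF2C (gram g x) (comp0 f x) (comp2 (ricci g) x) i j (coord x)
      + rmC (gram g x) (comp2 (ricci g) x) i j (coord x)
      = 1 / (2 * τ) * ricC (gram g x) i j (coord x) := fun i j => by
    rw [hg.lapF2C_eq hx hb (h.smooth_ric (eb n)) (fun z hz => comp2_ricci hz),
      h.lap_ric (isSoliton_of_shrinker hs x) hx hb, hg.rmC_eq hx hb (comp2_ricci hx),
      hg.ricC_eq hx]
    ring
  have h2 : ((1 / 2 : ℝ) • lapF2 g f (ricci g) + rm g (ricci g)) x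
      = (1 / 2 : ℝ) • lapF2 g f (ricci g) x + rm g (ricci g) x := rfl
  have h3 : ((1 / (2 * τ)) • ricci g) x = (1 / (2 * τ)) • ricci g x := rfl
  rw [h2, h3, lapF2, rm, ricci]
  simp only [ofComp2, Finset.smul_sum, smul_smul, ← Finset.sum_add_distrib, ← add_smul, ← h1]

/-- The trace of the soliton equation. -/
theorem scal_add_lap (hs : IsGradientShrinker g f τ) {x : M} {κ : Type*} [Fintype κ] {b : κ → E n}
    (hb : IsFrame (metricL (gram g x) (coord x)) b) :
    scal g x + ∑ i, nabla (connL (gram g x)) (fderiv ℝ (comp0 f x)) (coord x) (b i) (b i)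
      = n * (1 / (2 * τ)) := by
  have hg := isMetricOn_gram g x
  have h := hg.isLeviCivita
  have hx := coord_mem_target (n := n) x
  have h1 : ∑ i, metricL (gram g x) (coord x) (b i) (b i) = n := by
    have := hb.sum_coord (eb n) (ContinuousLinearMap.id ℝ (E n))
    simp only [ContinuousLinearMap.id_apply, Module.Basis.coord_apply, eb_repr, eb_apply] at this
    rw [← this]
    simp
  rw [scal, hg.trC_eq hx hb (comp2_ricci hx), ← h1, Finset.sum_mul, ← Finset.sum_add_distrib]
  refine Finset.sum_congr rfl fun i _ => ?_
  have := IsLeviCivita.hess_eq_of_soliton (isSoliton_of_shrinker hs x) hx (b i) (b i)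
  linarith

theorem inner2_self_nonneg (x : M) : 0 ≤ inner2 g (ricci g) (ricci g) x := by
  have hg := isMetricOn_gram g x
  have hx := coord_mem_target (n := n) x
  obtain ⟨b, hb⟩ := hg.isLeviCivita.exists_frame hx
  rw [inner2, hg.innerC_eq hx hb (comp2_ricci hx) (comp2_ricci hx)]
  exact Finset.sum_nonneg fun i _ => Finset.sum_nonneg fun j _ => mul_self_nonneg _

/-- A compact shrinker has nonnegative scalar curvature. -/
theorem scal_nonneg [CompactSpace M] (hs : IsGradientShrinker g f τ) (x : M) : 0 ≤ scal g x := by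
  have hne : Nonempty M := ⟨x⟩
  obtain ⟨z, -, hz⟩ := isCompact_univ.exists_isMinOn Set.univ_nonempty
    (contMDiff_scal g).continuous.continuousOn
  have h1 := lapF0_nonneg_of_isLocalMin (g := g) (f := f) (contMDiff_scal g) (x := z)
    (Filter.Eventually.of_forall fun w => hz (Set.mem_univ w))
  -- At a minimum of `R` this reads `0 ≤ R/τ - 2|Rc|²`, so the minimum value is nonnegative.
  rw [lapF0_scal hs] at h1
  have h2 := inner2_self_nonneg (g := g) z
  have h3 : 0 < 1 / (2 * τ) := by
    have := hs.pos
    positivity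
  have h4 : 0 ≤ 1 / (2 * τ) * scal g z := by linarith
  exact (nonneg_of_mul_nonneg_right h4 h3).trans (hz (Set.mem_univ x))

/-- At a maximum of `f` its Laplacian is at most zero, so the traced soliton equation gives `R ≥
n/(2τ)` there. -/
theorem exists_scal_pos [CompactSpace M] [Nonempty M] (hs : IsGradientShrinker g f τ)
    (hn : 0 < n) : ∃ x, 0 < scal g x := by
  obtain ⟨x, -, hm⟩ := isCompact_univ.exists_isMaxOn Set.univ_nonempty
    hs.smooth.continuous.continuousOn
  have h := (isMetricOn_gram g x).isLeviCivita
  have hx := coord_mem_target (n := n) x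
  obtain ⟨b, hb⟩ := h.exists_frame hx
  have hmax : IsLocalMax f x := Filter.Eventually.of_forall fun w => hm (Set.mem_univ w)
  have h1 : ∑ i, nabla (connL (gram g x)) (fderiv ℝ (comp0 f x)) (coord x) (b i) (b i) ≤ 0 :=
    Finset.sum_nonpos fun i _ => h.hess_nonpos_of_isLocalMax hx (contDiffOn_comp0 hs.smooth x)
      (isLocalMax_comp0 hmax) _
  have h2 := scal_add_lap hs hb
  have h3 : 0 < (n : ℝ) * (1 / (2 * τ)) := by
    have := hs.pos
    have : (0 : ℝ) < n := Nat.cast_pos.2 hn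
    positivity
  exact ⟨x, by linarith⟩

/-- The evolution equation of `R` expresses `|Rc|²` through `R` and `Δ_f R`, already known to be
smooth, so no chart computation is needed. -/
theorem continuous_inner2_ricci (hs : IsGradientShrinker g f τ) :
    Continuous (inner2 g (ricci g) (ricci g)) := by
  have h1 : inner2 g (ricci g) (ricci g)
      = fun x => 1 / (2 * τ) * scal g x - 1 / 2 * lapF0 g f (scal g) x := by
    ext x
    rw [lapF0_scal hs]
    ring
  rw [h1]
  exact ((contMDiff_scal g).continuous.const_mul _).sub
    ((contMDiff_lapF0 hs.smooth (contMDiff_scal g)).continuous.const_mul _)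

variable [MeasurableSpace M] [BorelSpace M] [T2Space M] [CompactSpace M]

/-- Integrate `Δ_f R = R/τ - 2|Rc|²` against `e^{-f} dV`; the left side contributes zero. -/
theorem wInt_inner2_ricci (hs : IsGradientShrinker g f τ) :
    wInt g f (inner2 g (ricci g) (ricci g)) = 1 / (2 * τ) * wInt g f (scal g) := by
  have h1 := wInt_lapF0 (g := g) hs.smooth (contMDiff_scal g)
  have hexp : Continuous fun x => Real.exp (-f x) :=
    Real.continuous_exp.comp hs.smooth.continuous.neg
  have h2 : Integrable (fun x => scal g x * Real.exp (-f x)) (riemVolume g) :=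
    integrable_riemVolume ((contMDiff_scal g).continuous.mul hexp)
  have h3 : Integrable (fun x => inner2 g (ricci g) (ricci g) x * Real.exp (-f x)) (riemVolume g) :=
    integrable_riemVolume ((continuous_inner2_ricci hs).mul hexp)
  rw [wInt] at h1 ⊢
  simp only [lapF0_scal hs, sub_mul, mul_assoc] at h1
  rw [integral_sub ((h2.const_mul _).const_mul _) (h3.const_mul _), integral_const_mul,
    integral_const_mul, integral_const_mul] at h1
  rw [wInt]
  linarith

theorem wInt_scal_pos [Nonempty M] (hs : IsGradientShrinker g f τ) (hn : 0 < n) :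
    0 < wInt g f (scal g) := by
  have hc : Continuous fun x => scal g x * Real.exp (-f x) :=
    (contMDiff_scal g).continuous.mul (Real.continuous_exp.comp hs.smooth.continuous.neg)
  rw [wInt, integral_pos_iff_support_of_nonneg
    (fun x => mul_nonneg (scal_nonneg hs x) (Real.exp_pos _).le) (integrable_riemVolume hc)]
  obtain ⟨x, hx⟩ := exists_scal_pos hs hn
  exact riemVolume_pos hc.isOpen_support ⟨x, (mul_pos hx (Real.exp_pos _)).ne'⟩

omit [BorelSpace M] [T2Space M] [CompactSpace M] in
theorem isVHat_zero (hs : IsGradientShrinker g f τ) : IsVHat g f τ (ricci g) 0 := by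
  refine ⟨contMDiff_const, fun x => ?_, wInt_zero⟩
  rw [divF2_ricci hs, divF1_zero]
  have : lapF0 g f 0 x = 0 := lapF0_zero x
  simp [this]

omit [BorelSpace M] [T2Space M] in
theorem isVHat_eq_zero (hs : IsGradientShrinker g f τ) {v : M → ℝ}
    (hv : IsVHat g f τ (ricci g) v) : v = 0 := by
  ext x
  refine eq_zero_of_eigen hs hv.1 (fun z => ?_) x
  rw [hv.2.1 z, divF2_ricci hs, divF1_zero]
  rfl

omit [BorelSpace M] [T2Space M] in
-- `vHat` is an arbitrary choice among the solutions, so it is known only because zero is the only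
-- one.
theorem vHat_ricci (hs : IsGradientShrinker g f τ) : vHat g f τ (ricci g) = 0 := by
  have H : ∃ v, IsVHat g f τ (ricci g) v := ⟨0, isVHat_zero hs⟩
  rw [vHat, dif_pos H]
  exact isVHat_eq_zero hs H.choose_spec

/-- The Ricci tensor is a null direction of the stability operator. -/
theorem stabilityOp_ricci (hs : IsGradientShrinker g f τ) : stabilityOp g f τ (ricci g) = 0 := by
  rcases isEmpty_or_nonempty M with hM | hM
  · exact funext fun x => hM.elim x
  rw [stabilityOp, divF2_ricci hs, divDag_zero, vHat_ricci hs,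
    hess_zero, lapF2_ricci_add_rm hs, wInt_inner2_ricci hs]
  -- In dimension zero the integral of `R` vanishes and the quotient has no meaning, but its factor
  -- `Rc` is zero.
  rcases n.eq_zero_or_pos with hn | hn
  · subst hn
    have h0 : ricci g = 0 := funext fun x => by simp [ricci, ofComp2]
    rw [h0]
    simp
  · rw [mul_div_cancel_right₀ _ (wInt_scal_pos hs hn).ne']
    simp

end Soliton

end Shrinker
end

theorem lemma3p3 (n : ℕ) (M : Type*) [TopologicalSpace M] [T2Space M] [CompactSpace M]
    [ChartedSpace (EuclideanSpace ℝ (Fin n)) M] [IsManifold (𝓡 n) ∞ M]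
    [MeasurableSpace M] [BorelSpace M]
    (g : Shrinker.Metric n M) (f : M → ℝ) (τ : ℝ)
    (hg : Shrinker.IsGradientShrinker g f τ) :
    (∃! v : M → ℝ, Shrinker.IsVHat g f τ (Shrinker.ricci g) v) ∧
    Shrinker.stabilityOp g f τ (Shrinker.ricci g) = 0 := by
  refine ⟨⟨0, Shrinker.isVHat_zero hg, fun v hv => Shrinker.isVHat_eq_zero hg hv⟩,
    Shrinker.stabilityOp_ricci hg⟩
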